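/- Let $\pi:Y\to X$ be a smooth fibre bundle, $\dim X=n$, $\dim Y=n+m$. For an adapted chart $(V,\psi)$, $\psi=(x^i,y^\sigma)$, of $Y$ (so that $\pi$ reads $(x,y)\mapsto x$) let $(V^r,\psi^r)$, $\psi^r=(x^i,y^\sigma_\alpha)_{|\alpha|\le r}$, be the associated chart of the jet bundle $J^rY$, where $\alpha\in\mathbb N^n$ and $y^\sigma_\alpha(j^r_x\gamma)=\partial^\alpha(y^\sigma\circ\gamma)(x)$. Put $\theta_0=dx^1\wedge\dots\wedge dx^n$, $\omega^\sigma_\alpha=dy^\sigma_\alpha-\sum_i y^\sigma_{\alpha+e_i}dx^i$, $\omega^\sigma=\omega^\sigma_0$, $d_i=\partial/\partial x^i+\sum_{\sigma,\alpha}y^\sigma_{\alpha+e_i}\,\partial/\partial y^\sigma_\alpha$ and $d_\alpha=d_1^{\alpha_1}\cdots d_n^{\alpha_n}$. A *differential equation* of order $s$ is a smooth $(n+1)$-form $T$ on $J^sY$ such that $i_\xi i_\eta T=0$ for all tangent vectors $\xi,\eta$ vertical over $X$, and $i_\xi T=0$ for all $\xi$ vertical over $Y$; equivalently, $T=\sum_\sigma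 T_\sigma\,\omega^\sigma\wedge\theta_0$ in every associated chart. For a Lagrange form $\lambda=L\,\theta_0$ ($L$ smooth on $V^r$) the Euler–Lagrange form is $$E(\lambda)=\sum_\sigma E_\sigma(L)\,\omega^\sigma\wedge\theta_0,\qquad E_\sigma(L)=\sum_{|\beta|\le r}(-1)^{|\beta|}d_\beta\frac{\partial L}{\partial y^\sigma_\beta}.$$ $T$ is *locally variational* if every point of $Y$ lies in the domain $V$ of an adapted chart for which there are an $r$ and a Lagrange form $\lambda$ on $V^r$ with $T=E(\lambda)$, both sides being pulled back to $V^t$ for $t\ge\max(s,2r)$. For $t>2s$ the *Helmholtz–Sonin form* $H(T)$ is the $(n+2)$-form on $J^tY$ given in every associated chart by $$H(T)=\sum_{|\alpha|\le s}\sum_{\sigma,\nu}H^\alpha_{\sigma\nu}\,\omega^\nu_\alpha\wedge\omega^\sigma\wedge\theta_0,\qquad H^\alpha_{\sigma\nu}=\frac{\partial T_\sigma}{\partial y^\nu_\alpha}-(-1)^{|\alpha|}\sum_{|\beta|\le s-|\alpha|}(-1)^{|\beta|}\binom{\alpha+\beta}{\alpha}d_\beta\frac{\partial T_\nu}{\partial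 y^\sigma_{\alpha+\beta}} .$$ **Corollary.** Let $T$ be a differential equation of order $s$ and let $t>2s$. Then $T$ is locally variational if and only if $H(T)=0$ (that is, its expression vanishes in every associated chart of $J^tY$). Moreover, if $H(T)=0$, then on every adapted chart $V$ whose image in $\mathbb R^n\times\mathbb R^m$ contains with $(x,y)$ also all $(x,\tau y)$, $0\le\tau\le1$, one has $T=E(L\,\theta_0)$ for the (smooth) Tonti–Vainberg Lagrangian $$L=\int_0^1\sum_\sigma y^\sigma\,(T_\sigma\circ\chi_\tau)\,d\tau\quad\text{on }V^s,\qquad \chi_\tau(x^i,y^\sigma_\alpha)=(x^i,\tau y^\sigma_\alpha).$$ -/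

import Mathlib

open scoped Manifold ContDiff Topology

noncomputable section

namespace JetVar

/-! ## Multi-indices and jet coordinates

A symmetric family `y_{j_1 ... j_k}` is recorded by its values at the multi-indices
`α : Fin n → ℕ`, where `α l` is the number of times that the index `l` occurs in
`j_1, ..., j_k`; so `|α| = ∑ l, α l = k`.  These are the independent coordinates
`y_{j_1 ... j_k}` with `j_1 ≤ ... ≤ j_k`. -/

/-- Multi-indices in `n` variables of length at most `r`. -/
abbrev MIdx (n r : ℕ) : Type := {α : Fin n → ℕ // ∑ i, α i ≤ r}

theorem midx_finite (n r : ℕ) : Finite (MIdx n r) := by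
  refine (Set.Finite.subset (Set.finite_Iic (fun _ : Fin n => r)) ?_ :
    Set.Finite {α : Fin n → ℕ | ∑ i, α i ≤ r}).to_subtype
  intro α hα i
  exact le_trans (Finset.single_le_sum (f := α) (fun _ _ => Nat.zero_le _) (Finset.mem_univ i)) hα

instance (n r : ℕ) : Fintype (MIdx n r) := by
  haveI := midx_finite n r
  exact Fintype.ofFinite _

/-- The space of the coordinates `(x^i, y^σ_α)`, `|α| ≤ r`, on the `r`-jets. -/
abbrev JSpace (n m r : ℕ) : Type := (Fin n → ℝ) × (Fin m → MIdx n r → ℝ)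

/-- For operators `D_1, ..., D_n` and a multi-index `α`, the composition
`D_1^{α_1} ∘ ... ∘ D_n^{α_n}`. -/
def iter {n : ℕ} {A : Type*} (D : Fin n → A → A) (α : Fin n → ℕ) : A → A :=
  ((List.finRange n).map (fun i => (D i)^[α i])).foldr (fun f g => f ∘ g) id

/-- The partial derivative `∂g/∂x^i` of a function on `ℝⁿ`. -/
def pderiv {n : ℕ} (i : Fin n) (g : (Fin n → ℝ) → ℝ) : (Fin n → ℝ) → ℝ :=
  fun p => fderiv ℝ g p (Pi.single i 1)

/-- The higher partial derivative `∂^|α| g / ∂x^α`. -/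
def mderiv {n : ℕ} (α : Fin n → ℕ) (g : (Fin n → ℝ) → ℝ) : (Fin n → ℝ) → ℝ :=
  iter pderiv α g

section Coordinates

variable {n m : ℕ}

/-- The coordinate function `x^i`. -/
def coordX (t : ℕ) (i : Fin n) : JSpace n m t →L[ℝ] ℝ :=
  (ContinuousLinearMap.proj (R := ℝ) (φ := fun _ : Fin n => ℝ) i).comp
    (ContinuousLinearMap.fst ℝ (Fin n → ℝ) (Fin m → MIdx n t → ℝ))

/-- The coordinate function `y^σ_α` (zero by convention when `|α| > t`). -/
def coordY (t : ℕ) (σ : Fin m) (α : Fin n → ℕ) : JSpace n m t →L[ℝ] ℝ :=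
  if h : ∑ i, α i ≤ t then
    (ContinuousLinearMap.proj (R := ℝ) (φ := fun _ : MIdx n t => ℝ) ⟨α, h⟩).comp
      ((ContinuousLinearMap.proj (R := ℝ) (φ := fun _ : Fin m => MIdx n t → ℝ) σ).comp
        (ContinuousLinearMap.snd ℝ (Fin n → ℝ) (Fin m → MIdx n t → ℝ)))
  else 0

/-- The vector `∂/∂x^i`. -/
def vecX (t : ℕ) (i : Fin n) : JSpace n m t := (Pi.single i 1, 0)

/-- The vector `∂/∂y^σ_α` (zero by convention when `|α| > t`). -/
def vecY (t : ℕ) (σ : Fin m) (α : Fin n → ℕ) : JSpace n m t :=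
  if h : ∑ i, α i ≤ t then (0, Pi.single σ (Pi.single ⟨α, h⟩ 1)) else 0

/-- The coordinate expression of the projection `π^{t,r}` of `t`-jets to `r`-jets (`r ≤ t`). -/
def jproj (t r : ℕ) : JSpace n m t →L[ℝ] JSpace n m r :=
  (ContinuousLinearMap.fst ℝ (Fin n → ℝ) (Fin m → MIdx n t → ℝ)).prod
    (ContinuousLinearMap.pi fun σ => ContinuousLinearMap.pi fun α : MIdx n r => coordY t σ α.1)

/-- `∂f/∂y^σ_α`.  With index tuples instead of multi-indices, the operator `∂_σ^{j_1...j_k}` is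
`(α! / k!) ∂/∂y^σ_α`, and there are `k! / α!` tuples that give `α`: a sum over all tuples of
products with `∂_σ^{j_1...j_k}` is the sum over all multi-indices with `∂/∂y^σ_α`. -/
def partialY {t : ℕ} (σ : Fin m) (α : Fin n → ℕ) (f : JSpace n m t → ℝ) : JSpace n m t → ℝ :=
  fun z => fderiv ℝ f z (vecY t σ α)

/-- The formal (total) derivative
`d_i = ∂/∂x^i + ∑_{σ, |α| ≤ t-1} y^σ_{α + i} ∂/∂y^σ_α` on functions of the `t`-jet coordinates. -/
def totalDeriv {t : ℕ} (i : Fin n) (f : JSpace n m t → ℝ) : JSpace n m t → ℝ :=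
  fun z => fderiv ℝ f z (vecX t i) +
    ∑ σ : Fin m, ∑ α : MIdx n t, coordY t σ (α.1 + Pi.single i 1) z * partialY σ α.1 f z

/-- `d_α = d_1^{α_1} ... d_n^{α_n}`. -/
def mtotalDeriv {t : ℕ} (α : Fin n → ℕ) (f : JSpace n m t → ℝ) : JSpace n m t → ℝ :=
  iter totalDeriv α f

/-- The multi-index binomial coefficient `∏_i binom(α_i + β_i, α_i)`. -/
def mchoose (α β : Fin n → ℕ) : ℕ := ∏ i, (α i + β i).choose (α i)

/-- The Lie-Euler operator
`E^α_σ(f) = ∑_{|β| ≤ r - |α|} (-1)^|β| binom(α + β, α) d_β (∂f/∂y^σ_{α+β})`, `|α| ≤ r`,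
for a function `f` of the `r`-jet coordinates, as a function of the `t`-jet coordinates
(`t ≥ 2 r`). -/
def lieEuler (r t : ℕ) (σ : Fin m) (α : MIdx n r) (f : JSpace n m r → ℝ) : JSpace n m t → ℝ :=
  fun z => ∑ β : MIdx n (r - ∑ i, α.1 i),
    (-1 : ℝ) ^ (∑ i, β.1 i) * (mchoose α.1 β.1 : ℝ) *
      mtotalDeriv β.1 (partialY σ (α.1 + β.1) (f ∘ jproj t r)) z

/-- The Euler-Lagrange expression `E_σ(L) = ∑_{|β| ≤ r} (-1)^|β| d_β (∂L/∂y^σ_β)`. -/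
def eulerLagrange (r t : ℕ) (σ : Fin m) (L : JSpace n m r → ℝ) : JSpace n m t → ℝ :=
  fun z => ∑ β : MIdx n r, (-1 : ℝ) ^ (∑ i, β.1 i) *
    mtotalDeriv β.1 (partialY σ β.1 (L ∘ jproj t r)) z

/-- The Helmholtz-Sonin expressions
`H^α_{σν}(T) = ∂T_σ/∂y^ν_α - (-1)^|α| E^α_σ(T_ν)`, `|α| ≤ s`. -/
def helmholtz (s t : ℕ) (T : Fin m → JSpace n m s → ℝ) (σ ν : Fin m) (α : MIdx n s) :
    JSpace n m t → ℝ :=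
  fun z => partialY ν α.1 (T σ ∘ jproj t s) z - (-1 : ℝ) ^ (∑ i, α.1 i) * lieEuler s t σ α (T ν) z

/-- The wedge product of `q` covectors,
`(v_1, ..., v_q) ↦ ∑_τ sgn τ ∏_a ℓ_a (v_{τ a}) = det (ℓ_a (v_b))`. -/
def wedge {E : Type*} [NormedAddCommGroup E] [NormedSpace ℝ E] {q : ℕ} (l : Fin q → (E →L[ℝ] ℝ)) :
    E [⋀^Fin q]→L[ℝ] ℝ :=
  ContinuousMultilinearMap.alternatization
    ((ContinuousMultilinearMap.mkPiAlgebra ℝ (Fin q) ℝ).compContinuousLinearMap l)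

/-- The contact covector `ω^σ_α = dy^σ_α - ∑_i y^σ_{α+i} dx^i` at `z` (for `|α| ≤ t - 1`). -/
def contact {t : ℕ} (σ : Fin m) (α : Fin n → ℕ) (z : JSpace n m t) : JSpace n m t →L[ℝ] ℝ :=
  coordY t σ α - ∑ i : Fin n, (coordY t σ (α + Pi.single i 1) z) • coordX t i

/-- The `(n+1)`-form `∑_σ A_σ ω^σ ∧ dx^1 ∧ ... ∧ dx^n` at `z`. -/
def sourceForm {t : ℕ} (A : Fin m → ℝ) (z : JSpace n m t) : JSpace n m t [⋀^Fin (n + 1)]→L[ℝ] ℝ :=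
  ∑ σ : Fin m, A σ • wedge (Fin.cons (contact σ 0 z) (fun i : Fin n => coordX t i))

/-- The `(n+2)`-form `∑_{|α| ≤ s} ∑_{σ,ν} H^α_{σν}(T) ω^ν_α ∧ ω^σ ∧ dx^1 ∧ ... ∧ dx^n` at `z`. -/
def helmholtzForm (s t : ℕ) (T : Fin m → JSpace n m s → ℝ) (z : JSpace n m t) :
    JSpace n m t [⋀^Fin (n + 2)]→L[ℝ] ℝ :=
  ∑ α : MIdx n s, ∑ σ : Fin m, ∑ ν : Fin m, helmholtz s t T σ ν α z •
    wedge (Fin.cons (contact ν α.1 z) (Fin.cons (contact σ 0 z) (fun i : Fin n => coordX t i)))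

/-- The Tonti-Vainberg Lagrangian `∫_0^1 y^σ (T_σ ∘ χ_τ) dτ`, with `χ_τ (x, y) = (x, τ y)` where
`y` stands for all the `y^σ_α`, `|α| ≤ s`. -/
def tonti (s : ℕ) (T : Fin m → JSpace n m s → ℝ) (z : JSpace n m s) : ℝ :=
  ∫ τ in (0 : ℝ)..1, ∑ σ : Fin m, coordY s σ 0 z * T σ (z.1, τ • z.2)

end Coordinates

/-! ## Fibre bundles, adapted charts, jets -/

section Bundle

variable {n m : ℕ}
  {X : Type*} [TopologicalSpace X] [ChartedSpace (Fin n → ℝ) X]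
  {Y : Type*} [TopologicalSpace Y] [ChartedSpace ((Fin n → ℝ) × (Fin m → ℝ)) Y]

/-- `π : Y → X` is a smooth fibre bundle with typical fibre `F`: around every point of `X` there is
a local trivialization that is smooth in both directions. -/
def IsSmoothFibreBundle (n m : ℕ) {X : Type*} [TopologicalSpace X] [ChartedSpace (Fin n → ℝ) X]
    {Y : Type*} [TopologicalSpace Y] [ChartedSpace ((Fin n → ℝ) × (Fin m → ℝ)) Y]
    (F : Type*) [TopologicalSpace F] [ChartedSpace (Fin m → ℝ) F]
    (π : Y → X) : Prop :=
  ∀ x : X, ∃ e : Bundle.Trivialization F π, x ∈ e.baseSet ∧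
    ContMDiffOn 𝓘(ℝ, (Fin n → ℝ) × (Fin m → ℝ)) (𝓘(ℝ, Fin n → ℝ).prod 𝓘(ℝ, Fin m → ℝ)) ∞
      e e.source ∧
    ContMDiffOn (𝓘(ℝ, Fin n → ℝ).prod 𝓘(ℝ, Fin m → ℝ)) 𝓘(ℝ, (Fin n → ℝ) × (Fin m → ℝ)) ∞
      e.toOpenPartialHomeomorph.symm e.target

/-- An adapted chart `(V, ψ)`, `ψ = (x^i, y^σ)`: a smooth chart of `Y` with domain `V` together with
a smooth chart of `X` with domain `π(V)`, in which `π (x, y) = x`. -/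
structure AdaptedChart (n m : ℕ) {X : Type*} [TopologicalSpace X] [ChartedSpace (Fin n → ℝ) X]
    {Y : Type*} [TopologicalSpace Y] [ChartedSpace ((Fin n → ℝ) × (Fin m → ℝ)) Y]
    (π : Y → X) where
  chart : OpenPartialHomeomorph Y ((Fin n → ℝ) × (Fin m → ℝ))
  base : OpenPartialHomeomorph X (Fin n → ℝ)
  chart_mem : chart ∈ IsManifold.maximalAtlas 𝓘(ℝ, (Fin n → ℝ) × (Fin m → ℝ)) ∞ Y
  base_mem : base ∈ IsManifold.maximalAtlas 𝓘(ℝ, Fin n → ℝ) ∞ X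
  base_source : base.source = π '' chart.source
  proj_eq : ∀ y ∈ chart.source, (chart y).1 = base (π y)

/-- The smooth sections of `π` that are defined on a neighbourhood of `x` (their values outside
some neighbourhood of `x` are irrelevant). -/
structure LocalSection (n m : ℕ) {X : Type*} [TopologicalSpace X] [ChartedSpace (Fin n → ℝ) X]
    {Y : Type*} [TopologicalSpace Y] [ChartedSpace ((Fin n → ℝ) × (Fin m → ℝ)) Y]
    (π : Y → X) (x : X) where
  toFun : X → Y
  exists_nhds : ∃ U : Set X, IsOpen U ∧ x ∈ U ∧
    ContMDiffOn 𝓘(ℝ, Fin n → ℝ) 𝓘(ℝ, (Fin n → ℝ) × (Fin m → ℝ)) ∞ toFun U ∧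
    ∀ x' ∈ U, π (toFun x') = x'

variable {π : Y → X}

/-- The coordinates `x^i`, `y^σ_α = ∂^α (y^σ ∘ γ ∘ φ⁻¹) (φ(x))` of the `r`-jet of `γ` at `x`. -/
def AdaptedChart.sectionCoord (c : AdaptedChart n m π) (r : ℕ) {x : X} (γ : LocalSection n m π x) :
    JSpace n m r :=
  (c.base x, fun σ α =>
    mderiv α.1 (fun u => (c.chart (γ.toFun (c.base.symm u))).2 σ) (c.base x))

/-- Two local sections at `x` have the same `r`-jet if they have the same value at `x` and the same
partial derivatives up to order `r` at `x` in the adapted charts. -/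
def jetSetoid (n m : ℕ) {X : Type*} [TopologicalSpace X] [ChartedSpace (Fin n → ℝ) X]
    {Y : Type*} [TopologicalSpace Y] [ChartedSpace ((Fin n → ℝ) × (Fin m → ℝ)) Y]
    (π : Y → X) (r : ℕ) (x : X) : Setoid (LocalSection n m π x) where
  r γ δ := γ.toFun x = δ.toFun x ∧ ∀ c : AdaptedChart n m π, γ.toFun x ∈ c.chart.source →
    c.sectionCoord r γ = c.sectionCoord r δ
  iseqv :=
    { refl := fun _ => ⟨rfl, fun _ _ => rfl⟩
      symm := fun h => ⟨h.1.symm, fun c hc => (h.2 c (h.1 ▸ hc)).symm⟩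
      trans := fun h h' =>
        ⟨h.1.trans h'.1, fun c hc => (h.2 c hc).trans (h'.2 c (h.1 ▸ hc))⟩ }

/-- The jet bundle extension `J^r Y`: pairs of a point `x` of `X` and an `r`-jet with source `x`. -/
structure Jet (n m : ℕ) {X : Type*} [TopologicalSpace X] [ChartedSpace (Fin n → ℝ) X]
    {Y : Type*} [TopologicalSpace Y] [ChartedSpace ((Fin n → ℝ) × (Fin m → ℝ)) Y]
    (π : Y → X) (r : ℕ) where
  source : X
  jet : Quotient (jetSetoid n m π r source)

/-- The target projection `π^{r,0} : J^r Y → Y`. -/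
def Jet.target {r : ℕ} (j : Jet n m π r) : Y :=
  Quotient.lift (s := jetSetoid n m π r j.source) (fun γ => γ.toFun j.source) (fun _ _ h => h.1) j.jet

namespace AdaptedChart

variable (c c' : AdaptedChart n m π)

/-- The domain `V^r = (π^{r,0})⁻¹(V)` of the associated chart. -/
def jetSource (r : ℕ) : Set (Jet n m π r) := {j | j.target ∈ c.chart.source}

open Classical in
/-- The associated chart `ψ^r : V^r → JSpace n m r` (zero by convention outside `V^r`). -/
def jetCoord (r : ℕ) (j : Jet n m π r) : JSpace n m r :=
  Quotient.lift (s := jetSetoid n m π r j.source)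
    (fun γ => if γ.toFun j.source ∈ c.chart.source then c.sectionCoord r γ else 0)
    (fun γ δ h => by
      by_cases hc : γ.toFun j.source ∈ c.chart.source
      · rw [if_pos hc, if_pos (h.1 ▸ hc), h.2 c hc]
      · rw [if_neg hc, if_neg (h.1 ▸ hc)]) j.jet

/-- The image `ψ^r(V^r)` of the associated chart. -/
def jetDomain (r : ℕ) : Set (JSpace n m r) := c.jetCoord r '' c.jetSource r

/-- The change of coordinates `ψ'^r ∘ (ψ^r)⁻¹` between two associated charts. -/
def jetTransition (r : ℕ) : JSpace n m r → JSpace n m r :=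
  Function.extend (fun j : c.jetSource r => c.jetCoord r j.1)
    (fun j : c.jetSource r => c'.jetCoord r j.1) 0

end AdaptedChart

/-! ## Differential forms on the jet bundle, differential equations, Lagrange forms -/

/-- A smooth differential form of degree `q` on `J^r Y`, given by its expressions in the associated
charts, which correspond to each other under the changes of coordinates.  (The values of the
expression outside the image of the chart are irrelevant.) -/
structure JetForm (n m : ℕ) {X : Type*} [TopologicalSpace X] [ChartedSpace (Fin n → ℝ) X]
    {Y : Type*} [TopologicalSpace Y] [ChartedSpace ((Fin n → ℝ) × (Fin m → ℝ)) Y]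
    (π : Y → X) (r q : ℕ) where
  expr : AdaptedChart n m π → JSpace n m r → JSpace n m r [⋀^Fin q]→L[ℝ] ℝ
  smooth : ∀ c, ContDiffOn ℝ ∞ (expr c) (c.jetDomain r)
  compat : ∀ c c' : AdaptedChart n m π, ∀ j ∈ c.jetSource r, j ∈ c'.jetSource r →
    expr c (c.jetCoord r j) = (expr c' (c'.jetCoord r j)).compContinuousLinearMap
      (fderiv ℝ (c.jetTransition c' r) (c.jetCoord r j))

/-- A differential equation of order `s`: an `(n+1)`-form `T` on `J^s Y` with
`i_ξ i_η T = 0` for all vectors `ξ, η` that are vertical over `X` (their `x`-components vanish), and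
`i_ξ T = 0` for all vectors `ξ` that are vertical over `Y` (their `x`- and `y^σ`-components
vanish). -/
structure DifferentialEquation (n m : ℕ) {X : Type*} [TopologicalSpace X]
    [ChartedSpace (Fin n → ℝ) X] {Y : Type*} [TopologicalSpace Y]
    [ChartedSpace ((Fin n → ℝ) × (Fin m → ℝ)) Y] (π : Y → X) (s : ℕ)
    extends JetForm n m π s (n + 1) where
  horizontal : ∀ c : AdaptedChart n m π, ∀ z ∈ c.jetDomain s,
    ∀ (v : Fin (n + 1) → JSpace n m s) (a b : Fin (n + 1)), a ≠ b →
      (v a).1 = 0 → (v b).1 = 0 → expr c z v = 0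
  vertical : ∀ c : AdaptedChart n m π, ∀ z ∈ c.jetDomain s,
    ∀ (v : Fin (n + 1) → JSpace n m s) (a : Fin (n + 1)),
      (v a).1 = 0 → (∀ σ : Fin m, coordY s σ 0 (v a) = 0) → expr c z v = 0

/-- A Lagrange form `λ` of order `r` on the domain `V` of an adapted chart `c`: a smooth horizontal
`n`-form on `V^r`, written in the associated chart. -/
structure LocalLagrangeForm (c : AdaptedChart n m π) (r : ℕ) where
  form : JSpace n m r → JSpace n m r [⋀^Fin n]→L[ℝ] ℝ
  smooth : ContDiffOn ℝ ∞ form (c.jetDomain r)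
  horizontal : ∀ z ∈ c.jetDomain r, ∀ (v : Fin n → JSpace n m r) (a : Fin n),
    (v a).1 = 0 → form z v = 0

/-- The function `L` with `λ = L dx^1 ∧ ... ∧ dx^n`. -/
def LocalLagrangeForm.density {c : AdaptedChart n m π} {r : ℕ} (l : LocalLagrangeForm c r)
    (z : JSpace n m r) : ℝ :=
  l.form z (fun i => vecX r i)

/-- The Euler-Lagrange form `E(λ) = ∑_σ E_σ(L) ω^σ ∧ dx^1 ∧ ... ∧ dx^n` on `V^t`, `t ≥ 2 r`. -/
def LocalLagrangeForm.eulerLagrangeForm {c : AdaptedChart n m π} {r : ℕ}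
    (l : LocalLagrangeForm c r) (t : ℕ) (z : JSpace n m t) :
    JSpace n m t [⋀^Fin (n + 1)]→L[ℝ] ℝ :=
  sourceForm (fun σ => eulerLagrange r t σ l.density z) z

namespace DifferentialEquation

variable {s : ℕ} (T : DifferentialEquation n m π s)

/-- The components `T_σ` in `T = ∑_σ T_σ ω^σ ∧ dx^1 ∧ ... ∧ dx^n` in an associated chart. -/
def comp (c : AdaptedChart n m π) (σ : Fin m) (z : JSpace n m s) : ℝ :=
  T.expr c z (Fin.cons (vecY s σ 0) (fun i : Fin n => vecX s i))

/-- `T = E(λ)` on the domain of the chart; both sides are pulled back to any jet order `t` on which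
both are defined. -/
def EqEulerLagrange {c : AdaptedChart n m π} {r : ℕ} (l : LocalLagrangeForm c r) : Prop :=
  ∀ t : ℕ, s ≤ t → 2 * r ≤ t → ∀ z ∈ c.jetDomain t,
    (T.expr c (jproj t s z)).compContinuousLinearMap (jproj t s) = l.eulerLagrangeForm t z

/-- `T` is locally variational: every point of `Y` has a neighbourhood (the domain of an adapted
chart) on which `T = E(λ)` for some Lagrange form `λ`, of some order `r`. -/
def IsLocallyVariational : Prop :=
  ∀ y : Y, ∃ c : AdaptedChart n m π, y ∈ c.chart.source ∧
    ∃ (r : ℕ) (l : LocalLagrangeForm c r), T.EqEulerLagrange l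

/-- The expression of the Helmholtz-Sonin form `H(T)` in the associated chart on `V^t`,
`t > 2 s`. -/
def helmholtzSoninForm (t : ℕ) (c : AdaptedChart n m π) (z : JSpace n m t) :
    JSpace n m t [⋀^Fin (n + 2)]→L[ℝ] ℝ :=
  helmholtzForm s t (T.comp c) z

/-- `H(T) = 0` as a form on `J^t Y`: its expression vanishes in all associated charts. -/
def HelmholtzSoninVanishes (t : ℕ) : Prop :=
  ∀ c : AdaptedChart n m π, ∀ z ∈ c.jetDomain t, T.helmholtzSoninForm t c z = 0

end DifferentialEquation

/-- The image of the chart is star-shaped along the fibres: with `(x, y)` it contains `(x, τ y)` for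
all `τ ∈ [0, 1]`. -/
def AdaptedChart.FibreStarShaped (c : AdaptedChart n m π) : Prop :=
  ∀ p ∈ c.chart.target, ∀ τ ∈ Set.Icc (0 : ℝ) 1, (p.1, τ • p.2) ∈ c.chart.target

end Bundle

end JetVar

end

/-! Everything is tested on sections. Every point of the image of an associated chart is the jet of
a polynomial section (`prolong_polyWithJet`), and along a prolonged section total derivatives become
partial derivatives (`pderiv_comp_prolong`). So `T` may be read as a nonlinear operator g ↦ T(j^s
g), whose linearization at g is the linear differential operator P with coefficients P^α_{σν} =
∂T_σ/∂y^ν_α (`linCoeff`). The Leibniz rule shows that the Helmholtz expressions along g are the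
coefficients of P - P*, where P* is the formal adjoint (`helmholtz_prolong`). The theorem is thus
the Poincaré lemma of the calculus of variations: a map is locally a gradient if and only if its
derivative is symmetric, here for the L² pairing of compactly supported variations.

Necessity. Let T = E(L θ₀) in a chart c, and take a family of sections G depending on parameters,
constant in them outside a compact set. By the first variation formula, the derivative of L along
the family in a parameter direction p has the same integral as the contraction of T with the
variation of G. Differentiating again in a direction q and antisymmetrizing in p and q cancels the
second derivatives of L along the family (`integral_dirDeriv_sourcePairing_symm`). For the family g
+ a₁φ + a₂ψ what remains is ∫ φ·Pψ = ∫ ψ·Pφ, and test functions then give P = P* coefficientwise.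
The form H(T) must vanish in every chart d, while L is known in c only. Instead of transforming
Euler-Lagrange expressions, the integrals are transported: the contraction of T with a variation
changes by the Jacobian of the base coordinates (`sourcePairing_transform`), whose sign is constant
near a point.

Sufficiency. As ω^ν ∧ ω^σ is antisymmetric, H(T) = 0 yields the vanishing of the coefficients of P -
P* of positive order, but only the symmetry in σ, ν of those of order zero. Now P - P* is
skew-adjoint, and a symmetric operator of order zero is self-adjoint; so P - P* = 0
(`skewCoeff_eq_zero_of_symm`). Let P_τ be the linearization at τg, and L the Tonti-Vainberg
Lagrangian. Then E_σ(L) along g is ∫₀¹ (T_σ(j^s(τg)) + τ (P_τ* g)_σ) dτ. Since P_τ* = P_τ, the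
integrand is the derivative of τ T_σ(j^s(τg)) in τ, and the integral is T_σ(j^s g)
(`eulerLagrange_tonti`). This works on charts that are star-shaped along the fibres; a smooth fibre
bundle has one around each point, built from a chart of the typical fibre onto a ball
(`exists_fibreStarShaped`). -/

noncomputable section

namespace JetVar

/-! ## Iterated directional derivatives on open sets -/

section Directional

variable {V : Type*} [NormedAddCommGroup V] [NormedSpace ℝ V] {U : Set V} {ι : Type*}

/-- The derivative of `f` in the direction `v`. -/
def dirDeriv (v : V) (f : V → ℝ) : V → ℝ := fun z => fderiv ℝ f z v

/-- The iterated derivative in the directions `vs i`, where `i` runs through a list. -/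
def dirDerivs (vs : ι → V) (l : List ι) (f : V → ℝ) : V → ℝ :=
  l.foldr (fun i g => dirDeriv (vs i) g) f

@[simp] theorem dirDerivs_nil (vs : ι → V) (f : V → ℝ) : dirDerivs vs [] f = f := rfl

@[simp] theorem dirDerivs_cons (vs : ι → V) (i : ι) (l : List ι) (f : V → ℝ) :
    dirDerivs vs (i :: l) f = dirDeriv (vs i) (dirDerivs vs l f) := rfl

theorem dirDerivs_append (vs : ι → V) (l l' : List ι) (f : V → ℝ) :
    dirDerivs vs (l ++ l') f = dirDerivs vs l (dirDerivs vs l' f) := by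
  simp [dirDerivs]

theorem _root_.ContDiffOn.differentiableAt_of_isOpen {f : V → ℝ} (hf : ContDiffOn ℝ ∞ f U)
    (hU : IsOpen U) {z : V} (hz : z ∈ U) : DifferentiableAt ℝ f z :=
  (hf.contDiffAt (hU.mem_nhds hz)).differentiableAt (by simp)

theorem contDiffOn_dirDeriv (hU : IsOpen U) {f : V → ℝ} (hf : ContDiffOn ℝ ∞ f U) (v : V) :
    ContDiffOn ℝ ∞ (dirDeriv v f) U :=
  (hf.fderiv_of_isOpen hU (by simp)).clm_apply contDiffOn_const

theorem dirDeriv_congr (hU : IsOpen U) {f g : V → ℝ} (h : Set.EqOn f g U) (v : V) :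
    Set.EqOn (dirDeriv v f) (dirDeriv v g) U := fun z hz => by
  have : f =ᶠ[𝓝 z] g := Filter.eventuallyEq_of_mem (hU.mem_nhds hz) h
  simp only [dirDeriv, this.fderiv_eq]

theorem dirDeriv_add (hU : IsOpen U) {f g : V → ℝ} (hf : ContDiffOn ℝ ∞ f U)
    (hg : ContDiffOn ℝ ∞ g U) (v : V) :
    Set.EqOn (dirDeriv v (fun z => f z + g z)) (fun z => dirDeriv v f z + dirDeriv v g z) U :=
  fun z hz => by
    simp only [dirDeriv]
    rw [fderiv_fun_add (hf.differentiableAt_of_isOpen hU hz) (hg.differentiableAt_of_isOpen hU hz)]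
    rfl

theorem dirDeriv_const_mul (hU : IsOpen U) {f : V → ℝ} (hf : ContDiffOn ℝ ∞ f U) (a : ℝ) (v : V) :
    Set.EqOn (dirDeriv v (fun z => a * f z)) (fun z => a * dirDeriv v f z) U :=
  fun z hz => by
    simp only [dirDeriv]
    rw [fderiv_const_mul (hf.differentiableAt_of_isOpen hU hz)]
    rfl

theorem dirDeriv_mul (hU : IsOpen U) {f g : V → ℝ} (hf : ContDiffOn ℝ ∞ f U)
    (hg : ContDiffOn ℝ ∞ g U) (v : V) :
    Set.EqOn (dirDeriv v (fun z => f z * g z))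
      (fun z => dirDeriv v f z * g z + f z * dirDeriv v g z) U :=
  fun z hz => by
    simp only [dirDeriv]
    rw [fderiv_fun_mul (hf.differentiableAt_of_isOpen hU hz) (hg.differentiableAt_of_isOpen hU hz)]
    simp; ring

theorem dirDeriv_comm (hU : IsOpen U) {f : V → ℝ} (hf : ContDiffOn ℝ ∞ f U) (v w : V) :
    Set.EqOn (dirDeriv v (dirDeriv w f)) (dirDeriv w (dirDeriv v f)) U := fun z hz => by
  have h2 : ContDiffAt ℝ 2 f z := (hf.contDiffAt (hU.mem_nhds hz)).of_le (by
    exact WithTop.coe_le_coe.2 (le_top : (2 : ℕ∞) ≤ ⊤))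
  have hd : DifferentiableAt ℝ (fderiv ℝ f) z :=
    (h2.fderiv_right (m := 1) (by norm_num)).differentiableAt (by simp)
  have key : ∀ a b : V, dirDeriv a (dirDeriv b f) z = fderiv ℝ (fderiv ℝ f) z a b := by
    intro a b
    change fderiv ℝ (fun y => fderiv ℝ f y b) z a = _
    rw [fderiv_clm_apply hd (differentiableAt_const b)]
    simp
  rw [key, key]
  exact (h2.isSymmSndFDerivAt (by simp)).eq v w

theorem contDiffOn_dirDerivs (hU : IsOpen U) {f : V → ℝ} (hf : ContDiffOn ℝ ∞ f U) (vs : ι → V)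
    (l : List ι) : ContDiffOn ℝ ∞ (dirDerivs vs l f) U := by
  induction l with
  | nil => exact hf
  | cons i l ih => exact contDiffOn_dirDeriv hU ih _

theorem dirDerivs_congr (hU : IsOpen U) {f g : V → ℝ} (h : Set.EqOn f g U) (vs : ι → V)
    (l : List ι) : Set.EqOn (dirDerivs vs l f) (dirDerivs vs l g) U := by
  induction l with
  | nil => exact h
  | cons i l ih => exact dirDeriv_congr hU ih _

theorem dirDerivs_add (hU : IsOpen U) {f g : V → ℝ} (hf : ContDiffOn ℝ ∞ f U)
    (hg : ContDiffOn ℝ ∞ g U) (vs : ι → V) (l : List ι) :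
    Set.EqOn (dirDerivs vs l (fun z => f z + g z))
      (fun z => dirDerivs vs l f z + dirDerivs vs l g z) U := by
  induction l with
  | nil => exact fun _ _ => rfl
  | cons i l ih =>
    exact (dirDeriv_congr hU ih _).trans
      (dirDeriv_add hU (contDiffOn_dirDerivs hU hf _ _) (contDiffOn_dirDerivs hU hg _ _) _)

theorem dirDerivs_const_mul (hU : IsOpen U) {f : V → ℝ} (hf : ContDiffOn ℝ ∞ f U) (a : ℝ)
    (vs : ι → V) (l : List ι) :
    Set.EqOn (dirDerivs vs l (fun z => a * f z)) (fun z => a * dirDerivs vs l f z) U := by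
  induction l with
  | nil => exact fun _ _ => rfl
  | cons i l ih =>
    exact (dirDeriv_congr hU ih _).trans
      (dirDeriv_const_mul hU (contDiffOn_dirDerivs hU hf _ _) _ _)

/-- Adjacent directions can be exchanged by the symmetry of second derivatives, and such exchanges
generate all permutations. This is what allows a multi-index to stand for a list of directions. -/
theorem dirDerivs_perm (hU : IsOpen U) {f : V → ℝ} (hf : ContDiffOn ℝ ∞ f U) (vs : ι → V)
    {l l' : List ι} (h : l.Perm l') : Set.EqOn (dirDerivs vs l f) (dirDerivs vs l' f) U := by
  induction h with
  | nil => exact fun _ _ => rfl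
  | cons i _ ih => exact dirDeriv_congr hU ih _
  | swap i j l => exact dirDeriv_comm hU (contDiffOn_dirDerivs hU hf _ _) _ _
  | trans _ _ ih ih' => exact ih.trans ih'

theorem dirDeriv_dirDerivs_comm (hU : IsOpen U) {f : V → ℝ} (hf : ContDiffOn ℝ ∞ f U) (vs : ι → V)
    (l : List ι) (w : V) :
    Set.EqOn (dirDeriv w (dirDerivs vs l f)) (dirDerivs vs l (dirDeriv w f)) U := by
  induction l with
  | nil => exact fun _ _ => rfl
  | cons i l ih =>
    exact (dirDeriv_comm hU (contDiffOn_dirDerivs hU hf _ _) _ _).trans (dirDeriv_congr hU ih _)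

/-- Derivatives in the second variable are derivatives on the product. -/
theorem dirDerivs_param {P : Type*} [NormedAddCommGroup P] [NormedSpace ℝ P] {Ω : Set (P × V)}
    (hΩ : IsOpen Ω) {G : P × V → ℝ} (hG : ContDiffOn ℝ ∞ G Ω) (vs : ι → V) (l : List ι)
    {a : P} {u : V} (hu : (a, u) ∈ Ω) :
    dirDerivs vs l (fun v => G (a, v)) u = dirDerivs (fun i => ((0 : P), vs i)) l G (a, u) := by
  have hΩa : IsOpen {v : V | (a, v) ∈ Ω} := hΩ.preimage (by fun_prop)
  suffices h : Set.EqOn (dirDerivs vs l (fun v => G (a, v)))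
      (fun v => dirDerivs (fun i => ((0 : P), vs i)) l G (a, v)) {v : V | (a, v) ∈ Ω} from h hu
  induction l with
  | nil => exact fun _ _ => rfl
  | cons i l ih =>
    refine (dirDeriv_congr hΩa ih _).trans fun v hv => ?_
    have hd := (contDiffOn_dirDerivs hΩ hG (fun i => ((0 : P), vs i)) l).differentiableAt_of_isOpen
      hΩ hv
    have hp : HasFDerivAt (fun v : V => ((a, v) : P × V)) (ContinuousLinearMap.inr ℝ P V) v :=
      hasFDerivAt_prodMk_right a v
    simp only [dirDerivs_cons, dirDeriv]
    have h2 : HasFDerivAt (fun v => dirDerivs (fun i => ((0 : P), vs i)) l G (a, v)) _ v :=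
      hd.hasFDerivAt.comp v hp
    rw [h2.fderiv]
    simp

end Directional

/-! ## Multi-indices -/

section MultiIndex

variable {n : ℕ}

/-- The list of indices in which `i` occurs `α i` times. -/
def idxList (α : Fin n → ℕ) : List (Fin n) :=
  (List.finRange n).flatMap fun i => List.replicate (α i) i

theorem count_idxList (α : Fin n → ℕ) (i : Fin n) : (idxList α).count i = α i := by
  classical
  rw [idxList, List.count_flatMap]
  have h : (List.map (List.count i ∘ fun i => List.replicate (α i) i) (List.finRange n)) =
      List.map (fun j => if j = i then α i else 0) (List.finRange n) := by
    refine List.map_congr_left fun j _ => ?_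
    simp only [Function.comp, List.count_replicate]
    by_cases hj : j = i
    · subst hj; simp
    · simp [hj]
  rw [h, ← List.ofFn_eq_map, List.sum_ofFn]
  simp

theorem length_idxList (α : Fin n → ℕ) : (idxList α).length = ∑ i, α i := by
  rw [idxList, List.length_flatMap]
  simp [← List.ofFn_eq_map, List.sum_ofFn]

theorem idxList_add_perm (α β : Fin n → ℕ) :
    (idxList (α + β)).Perm (idxList α ++ idxList β) := by
  classical
  rw [List.perm_iff_count]
  intro i
  simp [List.count_append, count_idxList]

theorem idxList_single_perm (i : Fin n) : (idxList (Pi.single i 1)).Perm [i] := by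
  classical
  rw [List.perm_iff_count]
  intro j
  rw [count_idxList]
  by_cases h : j = i
  · subst h; simp
  · rw [Pi.single_eq_of_ne h, List.count_eq_zero_of_not_mem (by simpa using h)]

theorem idxList_zero : idxList (0 : Fin n → ℕ) = [] := by
  rw [← List.length_eq_zero_iff, length_idxList]; simp

/-- With a fold over a list, facts about D_1^{α_1} ∘ ... ∘ D_n^{α_n} follow by induction, one
operator at a time. -/
theorem iter_eq_foldr {A : Type*} (D : Fin n → A → A) (α : Fin n → ℕ) (f : A) :
    iter D α f = (idxList α).foldr D f := by
  have hrep : ∀ (i : Fin n) (k : ℕ) (g : A), (D i)^[k] g = (List.replicate k i).foldr D g := by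
    intro i k g
    induction k with
    | zero => rfl
    | succ k ih => rw [Function.iterate_succ_apply', ih]; rfl
  rw [iter, idxList]
  induction List.finRange n with
  | nil => rfl
  | cons i l ih =>
    rw [List.flatMap_cons, List.foldr_append, ← ih, ← hrep]; rfl

theorem sum_add_single (α : Fin n → ℕ) (i : Fin n) :
    ∑ j, (α + Pi.single i 1 : Fin n → ℕ) j = ∑ j, α j + 1 := by
  simp [Finset.sum_add_distrib]

theorem eq_zero_of_sum_eq_zero {α : Fin n → ℕ} (h : ∑ i, α i = 0) : α = 0 := by
  funext i
  exact (Finset.sum_eq_zero_iff.1 h) i (Finset.mem_univ i)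

end MultiIndex

/-! ## Higher partial derivatives -/

section PartialDerivatives

variable {n : ℕ} {U : Set (Fin n → ℝ)}

/-- The `i`-th unit vector. -/
def unitVec (i : Fin n) : Fin n → ℝ := Pi.single i 1

theorem pderiv_eq (i : Fin n) : pderiv i = dirDeriv (unitVec i) := rfl

theorem mderiv_eq (α : Fin n → ℕ) (f : (Fin n → ℝ) → ℝ) :
    mderiv α f = dirDerivs unitVec (idxList α) f := by
  rw [mderiv, iter_eq_foldr]; rfl

theorem contDiffOn_mderiv (hU : IsOpen U) {f : (Fin n → ℝ) → ℝ} (hf : ContDiffOn ℝ ∞ f U)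
    (α : Fin n → ℕ) : ContDiffOn ℝ ∞ (mderiv α f) U := by
  rw [mderiv_eq]; exact contDiffOn_dirDerivs hU hf _ _

theorem mderiv_congr (hU : IsOpen U) {f g : (Fin n → ℝ) → ℝ} (h : Set.EqOn f g U)
    (α : Fin n → ℕ) : Set.EqOn (mderiv α f) (mderiv α g) U := by
  rw [mderiv_eq, mderiv_eq]; exact dirDerivs_congr hU h _ _

theorem mderiv_zero (f : (Fin n → ℝ) → ℝ) : mderiv 0 f = f := by
  rw [mderiv_eq, idxList_zero]; rfl

theorem mderiv_fun_add (hU : IsOpen U) {f g : (Fin n → ℝ) → ℝ} (hf : ContDiffOn ℝ ∞ f U)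
    (hg : ContDiffOn ℝ ∞ g U) (α : Fin n → ℕ) :
    Set.EqOn (mderiv α (fun z => f z + g z)) (fun z => mderiv α f z + mderiv α g z) U := by
  simp only [mderiv_eq]; exact dirDerivs_add hU hf hg _ _

theorem mderiv_const_mul (hU : IsOpen U) {f : (Fin n → ℝ) → ℝ} (hf : ContDiffOn ℝ ∞ f U) (a : ℝ)
    (α : Fin n → ℕ) :
    Set.EqOn (mderiv α (fun z => a * f z)) (fun z => a * mderiv α f z) U := by
  simp only [mderiv_eq]; exact dirDerivs_const_mul hU hf _ _ _

theorem mderiv_fun_zero (α : Fin n → ℕ) (u : Fin n → ℝ) : mderiv α (fun _ => (0 : ℝ)) u = 0 := by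
  have := mderiv_const_mul (n := n) isOpen_univ (f := fun _ => (0 : ℝ)) contDiffOn_const 0 α
    (Set.mem_univ u)
  simpa using this

theorem mderiv_fun_sum (hU : IsOpen U) {κ : Type*} (s : Finset κ) {f : κ → (Fin n → ℝ) → ℝ}
    (hf : ∀ k ∈ s, ContDiffOn ℝ ∞ (f k) U) (α : Fin n → ℕ) :
    Set.EqOn (mderiv α (fun z => ∑ k ∈ s, f k z)) (fun z => ∑ k ∈ s, mderiv α (f k) z) U := by
  classical
  induction s using Finset.induction_on with
  | empty => intro z _; simpa using mderiv_fun_zero α z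
  | insert k s hk ih =>
    simp only [Finset.sum_insert hk]
    intro z hz
    have hs : ContDiffOn ℝ ∞ (fun z => ∑ k ∈ s, f k z) U :=
      ContDiffOn.sum fun j hj => hf j (Finset.mem_insert_of_mem hj)
    rw [mderiv_fun_add hU (hf k (Finset.mem_insert_self k s)) hs α hz]
    simp only
    rw [ih (fun j hj => hf j (Finset.mem_insert_of_mem hj)) hz]

theorem mderiv_add (hU : IsOpen U) {f : (Fin n → ℝ) → ℝ} (hf : ContDiffOn ℝ ∞ f U)
    (α β : Fin n → ℕ) : Set.EqOn (mderiv (α + β) f) (mderiv α (mderiv β f)) U := by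
  simp only [mderiv_eq, ← dirDerivs_append]
  exact dirDerivs_perm hU hf _ (idxList_add_perm α β)

theorem mderiv_single (hU : IsOpen U) {f : (Fin n → ℝ) → ℝ} (hf : ContDiffOn ℝ ∞ f U)
    (i : Fin n) : Set.EqOn (mderiv (Pi.single i 1) f) (pderiv i f) U := by
  rw [mderiv_eq]
  exact dirDerivs_perm hU hf _ (idxList_single_perm i)

theorem mderiv_add_single (hU : IsOpen U) {f : (Fin n → ℝ) → ℝ} (hf : ContDiffOn ℝ ∞ f U)
    (α : Fin n → ℕ) (i : Fin n) :
    Set.EqOn (mderiv (α + Pi.single i 1) f) (pderiv i (mderiv α f)) U := by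
  rw [add_comm]
  exact (mderiv_add hU hf _ _).trans (mderiv_single hU (contDiffOn_mderiv hU hf α) i)

end PartialDerivatives

/-! ## Partial derivatives of functions with parameters -/

section Parameters

variable {n : ℕ} {P : Type*} [NormedAddCommGroup P] [NormedSpace ℝ P]
  {Ω : Set (P × (Fin n → ℝ))}

/-- On an open subset of the product, derivatives of the slices are derivatives in the directions
(0, e_i), so they are jointly smooth in the parameter and the variable. -/
theorem contDiffOn_mderiv_param (hΩ : IsOpen Ω) {G : P × (Fin n → ℝ) → ℝ}
    (hG : ContDiffOn ℝ ∞ G Ω) (α : Fin n → ℕ) :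
    ContDiffOn ℝ ∞ (fun q : P × (Fin n → ℝ) => mderiv α (fun v => G (q.1, v)) q.2) Ω := by
  refine (contDiffOn_dirDerivs hΩ hG (fun i => ((0 : P), unitVec i)) (idxList α)).congr ?_
  rintro ⟨a, u⟩ hu
  simp only [mderiv_eq]
  exact dirDerivs_param hΩ hG _ _ hu

/-- Partial derivatives commute with derivatives in the parameter. -/
theorem dirDeriv_param_mderiv (hΩ : IsOpen Ω) {G : P × (Fin n → ℝ) → ℝ}
    (hG : ContDiffOn ℝ ∞ G Ω) (α : Fin n → ℕ) (p : P) {a : P} {u : Fin n → ℝ} (hu : (a, u) ∈ Ω) :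
    dirDeriv (p, (0 : Fin n → ℝ))
      (fun q : P × (Fin n → ℝ) => mderiv α (fun v => G (q.1, v)) q.2) (a, u) =
    mderiv α (fun v => dirDeriv (p, (0 : Fin n → ℝ)) G (a, v)) u := by
  rw [mderiv_eq, dirDerivs_param hΩ (contDiffOn_dirDeriv hΩ hG _) _ _ hu,
    ← dirDeriv_dirDerivs_comm hΩ hG _ _ _ hu]
  refine dirDeriv_congr hΩ ?_ _ hu
  rintro ⟨b, v⟩ hv
  simp only [mderiv_eq]
  exact dirDerivs_param hΩ hG _ _ hv

end Parameters

/-! ## The Leibniz rule -/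

section Leibniz

variable {n : ℕ} {U : Set (Fin n → ℝ)}

/-- The binomial theorem for multi-indices; applied to polynomials below, it becomes the Leibniz
rule. -/
theorem prod_add_pow {R : Type*} [CommSemiring R] (x y : Fin n → R) (α : Fin n → ℕ) :
    ∏ i, (x i + y i) ^ α i =
      ∑ p ∈ Fintype.piFinset (fun i => Finset.range (α i + 1)),
        (∏ i, x i ^ p i) * (∏ i, y i ^ (α i - p i)) * ((∏ i, (α i).choose (p i) : ℕ) : R) := by
  simp only [add_pow]
  rw [Finset.prod_univ_sum]
  refine Finset.sum_congr rfl fun p _ => ?_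
  simp [Finset.prod_mul_distrib]

theorem prod_map_idxList {R : Type*} [CommMonoid R] (x : Fin n → R) (α : Fin n → ℕ) :
    ((idxList α).map x).prod = ∏ i, x i ^ α i := by
  classical
  rw [Finset.prod_list_map_count]
  simp only [count_idxList]
  refine Finset.prod_subset (Finset.subset_univ _) fun i _ hi => ?_
  rw [List.mem_toFinset, ← List.count_eq_zero, count_idxList] at hi
  simp [hi]

/-- The linear functional `X^β Y^γ ↦ ∂^β f (u) ∂^γ g (u)` on polynomials in two sets of variables. -/
def leibnizFunctional (f g : (Fin n → ℝ) → ℝ) (u : Fin n → ℝ) :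
    MvPolynomial (Fin n ⊕ Fin n) ℝ →ₗ[ℝ] ℝ :=
  (MvPolynomial.basisMonomials (Fin n ⊕ Fin n) ℝ).constr ℝ
    (fun k => mderiv (fun i => k (Sum.inl i)) f u * mderiv (fun i => k (Sum.inr i)) g u)

theorem leibnizFunctional_monomial (f g : (Fin n → ℝ) → ℝ) (u : Fin n → ℝ)
    (k : Fin n ⊕ Fin n →₀ ℕ) (a : ℝ) :
    leibnizFunctional f g u (MvPolynomial.monomial k a) =
      a * (mderiv (fun i => k (Sum.inl i)) f u * mderiv (fun i => k (Sum.inr i)) g u) := by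
  have h := (MvPolynomial.basisMonomials (Fin n ⊕ Fin n) ℝ).constr_basis ℝ
    (fun k => mderiv (fun i => k (Sum.inl i)) f u * mderiv (fun i => k (Sum.inr i)) g u) k
  rw [MvPolynomial.coe_basisMonomials] at h
  have h2 : MvPolynomial.monomial k a = a • (MvPolynomial.monomial k (1 : ℝ)) := by
    simp [MvPolynomial.smul_monomial]
  rw [h2, map_smul, leibnizFunctional, h, smul_eq_mul]

theorem contDiffOn_leibnizFunctional (hU : IsOpen U) {f g : (Fin n → ℝ) → ℝ}
    (hf : ContDiffOn ℝ ∞ f U) (hg : ContDiffOn ℝ ∞ g U) (p : MvPolynomial (Fin n ⊕ Fin n) ℝ) :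
    ContDiffOn ℝ ∞ (fun u => leibnizFunctional f g u p) U := by
  induction p using MvPolynomial.induction_on' with
  | monomial k a =>
    simp only [leibnizFunctional_monomial]
    exact contDiffOn_const.mul ((contDiffOn_mderiv hU hf _).mul (contDiffOn_mderiv hU hg _))
  | add p q hp hq =>
    simp only [map_add]
    exact hp.add hq

/-- By the product rule, ∂_i acts on ∂^β f ∂^γ g as multiplication by X_i + Y_i acts on the monomial
X^β Y^γ. The Leibniz rule of order α is then the expansion of ∏ (X_i + Y_i)^{α_i}. -/
theorem pderiv_leibnizFunctional (hU : IsOpen U) {f g : (Fin n → ℝ) → ℝ}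
    (hf : ContDiffOn ℝ ∞ f U) (hg : ContDiffOn ℝ ∞ g U) (i : Fin n)
    (p : MvPolynomial (Fin n ⊕ Fin n) ℝ) :
    Set.EqOn (pderiv i (fun u => leibnizFunctional f g u p))
      (fun u => leibnizFunctional f g u
        ((MvPolynomial.X (Sum.inl i) + MvPolynomial.X (Sum.inr i)) * p)) U := by
  classical
  induction p using MvPolynomial.induction_on' with
  | monomial k a =>
    intro u hu
    have h1 : (MvPolynomial.X (Sum.inl i) + MvPolynomial.X (Sum.inr i)) *
        MvPolynomial.monomial k a =
        MvPolynomial.monomial (Finsupp.single (Sum.inl i) 1 + k) a +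
          MvPolynomial.monomial (Finsupp.single (Sum.inr i) 1 + k) a := by
      rw [add_mul, MvPolynomial.X, MvPolynomial.X, MvPolynomial.monomial_mul,
        MvPolynomial.monomial_mul, one_mul]
    have e1 : (fun j => (Finsupp.single (Sum.inl i) 1 + k : Fin n ⊕ Fin n →₀ ℕ) (Sum.inl j)) =
        (fun j => k (Sum.inl j)) + Pi.single i 1 := by
      funext j; simp [Finsupp.single_apply, Pi.single_apply, eq_comm, add_comm]
    have e2 : (fun j => (Finsupp.single (Sum.inl i) 1 + k : Fin n ⊕ Fin n →₀ ℕ) (Sum.inr j)) =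
        (fun j => k (Sum.inr j)) := by
      funext j; simp
    have e3 : (fun j => (Finsupp.single (Sum.inr i) 1 + k : Fin n ⊕ Fin n →₀ ℕ) (Sum.inr j)) =
        (fun j => k (Sum.inr j)) + Pi.single i 1 := by
      funext j; simp [Finsupp.single_apply, Pi.single_apply, eq_comm, add_comm]
    have e4 : (fun j => (Finsupp.single (Sum.inr i) 1 + k : Fin n ⊕ Fin n →₀ ℕ) (Sum.inl j)) =
        (fun j => k (Sum.inl j)) := by
      funext j; simp
    simp only [h1, map_add, leibnizFunctional_monomial, e1, e2, e3, e4]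
    rw [mderiv_add_single hU hf _ i hu, mderiv_add_single hU hg _ i hu, pderiv_eq,
      dirDeriv_const_mul hU ((contDiffOn_mderiv hU hf _).mul (contDiffOn_mderiv hU hg _)) _ _ hu]
    simp only
    rw [dirDeriv_mul hU (contDiffOn_mderiv hU hf _) (contDiffOn_mderiv hU hg _) _ hu]
    ring
  | add p q hp hq =>
    intro u hu
    simp only [map_add, mul_add] at hp hq ⊢
    rw [pderiv_eq, dirDeriv_add hU (contDiffOn_leibnizFunctional hU hf hg p)
      (contDiffOn_leibnizFunctional hU hf hg q) _ hu]
    simp only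
    rw [← pderiv_eq, hp hu, hq hu]

/-- The Leibniz rule for higher partial derivatives. -/
theorem mderiv_mul (hU : IsOpen U) {f g : (Fin n → ℝ) → ℝ}
    (hf : ContDiffOn ℝ ∞ f U) (hg : ContDiffOn ℝ ∞ g U) (α : Fin n → ℕ) {u : Fin n → ℝ}
    (hu : u ∈ U) :
    mderiv α (fun v => f v * g v) u =
      ∑ p ∈ Fintype.piFinset (fun i => Finset.range (α i + 1)),
        ((∏ i, (α i).choose (p i) : ℕ) : ℝ) * (mderiv p f u * mderiv (α - p) g u) := by
  classical
  have h1 : ∀ l : List (Fin n), Set.EqOn (dirDerivs unitVec l (fun v => f v * g v))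
      (fun u => leibnizFunctional f g u ((l.map fun i =>
        (MvPolynomial.X (Sum.inl i) + MvPolynomial.X (Sum.inr i) :
          MvPolynomial (Fin n ⊕ Fin n) ℝ)).prod)) U := by
    intro l
    induction l with
    | nil =>
      intro u _
      have h := leibnizFunctional_monomial f g u 0 1
      rw [MvPolynomial.monomial_zero', map_one] at h
      simp only [dirDerivs_nil, List.map_nil, List.prod_nil, h]
      have e0 : (fun _ => 0 : Fin n → ℕ) = 0 := rfl
      simp [e0, mderiv_zero]
    | cons i l ih =>
      refine (dirDeriv_congr hU ih _).trans ?_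
      simp only [List.map_cons, List.prod_cons]
      exact pderiv_leibnizFunctional hU hf hg i _
  rw [mderiv_eq, h1 _ hu]
  simp only
  rw [prod_map_idxList, prod_add_pow, map_sum]
  refine Finset.sum_congr rfl fun p hp => ?_
  have h2 : (∏ i, (MvPolynomial.X (Sum.inl i) : MvPolynomial (Fin n ⊕ Fin n) ℝ) ^ p i) *
      (∏ i, (MvPolynomial.X (Sum.inr i)) ^ (α i - p i)) *
        ((∏ i, (α i).choose (p i) : ℕ) : MvPolynomial (Fin n ⊕ Fin n) ℝ) =
      MvPolynomial.monomial (Finsupp.equivFunOnFinite.symm (Sum.elim p (α - p)))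
        ((∏ i, (α i).choose (p i) : ℕ) : ℝ) := by
    rw [MvPolynomial.monomial_eq, Finsupp.prod_fintype _ _ (by simp), Fintype.prod_sum_type]
    simp [mul_comm]
  rw [h2, leibnizFunctional_monomial]
  rfl

/-- The multi-indices of length at most `k`. -/
def midxFinset (n k : ℕ) : Finset (Fin n → ℕ) :=
  (Finset.univ : Finset (MIdx n k)).map ⟨Subtype.val, Subtype.val_injective⟩

theorem mem_midxFinset {k : ℕ} {α : Fin n → ℕ} : α ∈ midxFinset n k ↔ ∑ i, α i ≤ k := by
  simp [midxFinset]

theorem sum_midx {k : ℕ} {A : Type*} [AddCommMonoid A] (f : (Fin n → ℕ) → A) :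
    ∑ β : MIdx n k, f β.1 = ∑ β ∈ midxFinset n k, f β := by
  simp [midxFinset]

/-- The coefficient of `∂^α` in the formal adjoint of the operator `∑_{|α| ≤ s} P^α ∂^α`. -/
def adjointCoeff (s : ℕ) (P : (Fin n → ℕ) → (Fin n → ℝ) → ℝ) (α : Fin n → ℕ)
    (u : Fin n → ℝ) : ℝ :=
  (-1) ^ (∑ i, α i) * ∑ β : MIdx n (s - ∑ i, α i),
    (-1 : ℝ) ^ (∑ i, β.1 i) * (mchoose α β.1 : ℝ) * mderiv β.1 (P (α + β.1)) u

/-- Expand each ∂^α(P^α ψ) by the Leibniz rule, let p be the part of α that falls on P^α, and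
collect the terms with the same derivative of ψ. The substitution (α, p) ↦ (α - p, p) turns binom(α,
p) into the binomial coefficient of the adjoint and splits the sign (-1)^|α| accordingly. -/
theorem sum_mderiv_mul (hU : IsOpen U) (s : ℕ) {P : (Fin n → ℕ) → (Fin n → ℝ) → ℝ}
    {ψ : (Fin n → ℝ) → ℝ} (hP : ∀ α, ContDiffOn ℝ ∞ (P α) U) (hψ : ContDiffOn ℝ ∞ ψ U)
    {u : Fin n → ℝ} (hu : u ∈ U) :
    ∑ α : MIdx n s, (-1 : ℝ) ^ (∑ i, α.1 i) * mderiv α.1 (fun v => P α.1 v * ψ v) u =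
      ∑ α : MIdx n s, adjointCoeff s P α.1 u * mderiv α.1 ψ u := by
  classical
  rw [sum_midx (fun α => (-1 : ℝ) ^ (∑ i, α i) * mderiv α (fun v => P α v * ψ v) u),
    sum_midx (fun α => adjointCoeff s P α u * mderiv α ψ u)]
  have hL : ∀ α, (-1 : ℝ) ^ (∑ i, α i) * mderiv α (fun v => P α v * ψ v) u =
      ∑ p ∈ Fintype.piFinset (fun i => Finset.range (α i + 1)), (-1 : ℝ) ^ (∑ i, α i) *
        (((∏ i, (α i).choose (p i) : ℕ) : ℝ) * (mderiv p (P α) u * mderiv (α - p) ψ u)) := by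
    intro α
    rw [mderiv_mul hU (hP α) hψ α hu, Finset.mul_sum]
  have hR : ∀ α, adjointCoeff s P α u * mderiv α ψ u =
      ∑ β ∈ midxFinset n (s - ∑ i, α i), (-1) ^ (∑ i, α i) *
        ((-1 : ℝ) ^ (∑ i, β i) * (mchoose α β : ℝ) * mderiv β (P (α + β)) u) * mderiv α ψ u := by
    intro α
    rw [adjointCoeff, sum_midx (fun β => (-1 : ℝ) ^ (∑ i, β i) * (mchoose α β : ℝ) *
      mderiv β (P (α + β)) u), Finset.mul_sum, Finset.sum_mul]
  simp only [hL, hR]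
  rw [Finset.sum_sigma', Finset.sum_sigma']
  refine Finset.sum_nbij' (fun q => ⟨q.1 - q.2, q.2⟩) (fun q => ⟨q.1 + q.2, q.2⟩) ?_ ?_ ?_ ?_ ?_
  · rintro ⟨α, p⟩ h
    simp only [Finset.mem_sigma, mem_midxFinset, Fintype.mem_piFinset, Finset.mem_range] at h ⊢
    have hs : ∑ i, (α - p) i + ∑ i, p i = ∑ i, α i := by
      rw [← Finset.sum_add_distrib]
      refine Finset.sum_congr rfl fun i _ => ?_
      have := h.2 i
      simp only [Pi.sub_apply]; omega
    omega
  · rintro ⟨α, p⟩ h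
    simp only [Finset.mem_sigma, mem_midxFinset, Fintype.mem_piFinset, Finset.mem_range] at h ⊢
    refine ⟨?_, fun i => ?_⟩
    · simp only [Pi.add_apply, Finset.sum_add_distrib]; omega
    · simp only [Pi.add_apply]; omega
  · rintro ⟨α, p⟩ h
    simp only [Finset.mem_sigma, mem_midxFinset, Fintype.mem_piFinset, Finset.mem_range] at h
    have : α - p + p = α := by
      funext i
      have := h.2 i
      simp only [Pi.sub_apply, Pi.add_apply]; omega
    simp [this]
  · rintro ⟨α, p⟩ h
    simp
  · rintro ⟨α, p⟩ h
    simp only [Finset.mem_sigma, mem_midxFinset, Fintype.mem_piFinset, Finset.mem_range] at h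
    have hap : α - p + p = α := by
      funext i
      have := h.2 i
      simp only [Pi.sub_apply, Pi.add_apply]; omega
    have hs : ∑ i, α i = ∑ i, (α - p) i + ∑ i, p i := by
      rw [← Finset.sum_add_distrib]
      exact Finset.sum_congr rfl fun i _ => (congrFun hap i).symm
    have hc : (∏ i, (α i).choose (p i)) = mchoose (α - p) p := by
      refine Finset.prod_congr rfl fun i _ => ?_
      have := h.2 i
      simp only [Pi.sub_apply]
      rw [Nat.sub_add_cancel (by omega), ← Nat.choose_symm (by omega)]
    simp only [hap]
    rw [hc, hs, pow_add]
    ring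

theorem contDiffOn_adjointCoeff (hU : IsOpen U) (s : ℕ) {P : (Fin n → ℕ) → (Fin n → ℝ) → ℝ}
    (hP : ∀ α, ContDiffOn ℝ ∞ (P α) U) (α : Fin n → ℕ) :
    ContDiffOn ℝ ∞ (adjointCoeff s P α) U :=
  contDiffOn_const.mul (ContDiffOn.sum fun _ _ =>
    contDiffOn_const.mul (contDiffOn_mderiv hU (hP _) _))

theorem midx_induction {p : (Fin n → ℕ) → Prop} (h0 : p 0)
    (hs : ∀ α i, p α → p (α + Pi.single i 1)) (α : Fin n → ℕ) : p α := by
  obtain ⟨k, hk⟩ : ∃ k, ∑ i, α i = k := ⟨_, rfl⟩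
  induction k generalizing α with
  | zero => rw [eq_zero_of_sum_eq_zero hk]; exact h0
  | succ k ih =>
    obtain ⟨i, hi⟩ : ∃ i, α i ≠ 0 := by
      by_contra! h
      simp [h] at hk
    have e : α - Pi.single i 1 + Pi.single i 1 = α := by
      funext j
      by_cases hj : j = i
      · subst hj; simp; omega
      · simp [hj]
    rw [← e]
    refine hs _ _ (ih _ ?_)
    have := sum_add_single (α - Pi.single i 1) i
    rw [e] at this
    omega

end Leibniz

/-! ## Monomials -/

section Monomials

variable {n : ℕ}

/-- The monomial `(u - x)^α / α!`. -/
def monomialAt (x : Fin n → ℝ) (α : Fin n → ℕ) (u : Fin n → ℝ) : ℝ :=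
  ∏ i, (u i - x i) ^ α i / (α i).factorial

theorem contDiff_monomialAt (x : Fin n → ℝ) (α : Fin n → ℕ) : ContDiff ℝ ∞ (monomialAt x α) := by
  unfold monomialAt
  fun_prop

theorem pderiv_monomialAt (x : Fin n → ℝ) (α : Fin n → ℕ) (i : Fin n) :
    pderiv i (monomialAt x α) =
      if α i = 0 then (fun _ => 0) else monomialAt x (α - Pi.single i 1) := by
  classical
  funext u
  have hd : DifferentiableAt ℝ (monomialAt x α) u :=
    (contDiff_monomialAt x α).contDiffAt.differentiableAt (by simp)
  change fderiv ℝ (monomialAt x α) u (Pi.single i 1) = _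
  -- Along the line in the direction e_i only the i-th factor varies, so a power of one variable is
  -- differentiated.
  rw [← hd.lineDeriv_eq_fderiv, lineDeriv]
  have hf : (fun t : ℝ => monomialAt x α (u + t • Pi.single i 1)) = fun t =>
      ((u i - x i + t) ^ α i / (α i).factorial) *
        ∏ j ∈ Finset.univ.erase i, (u j - x j) ^ α j / (α j).factorial := by
    funext t
    rw [monomialAt, ← Finset.mul_prod_erase _ _ (Finset.mem_univ i)]
    congr 1
    · simp; ring
    · refine Finset.prod_congr rfl fun j hj => ?_
      simp [Finset.ne_of_mem_erase hj]
  rw [hf, deriv_mul_const (by fun_prop), deriv_div_const]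
  have hder : deriv (fun t : ℝ => (u i - x i + t) ^ α i) 0 = α i * (u i - x i) ^ (α i - 1) := by
    have h := ((hasDerivAt_id (0 : ℝ)).const_add (u i - x i)).pow (α i)
    have h2 := h.deriv
    simp only [id, add_zero, mul_one] at h2
    exact h2
  rw [hder]
  split_ifs with h0
  · simp [h0]
  · rw [monomialAt, ← Finset.mul_prod_erase _ _ (Finset.mem_univ i)]
    congr 1
    · obtain ⟨k, hk⟩ := Nat.exists_eq_succ_of_ne_zero h0
      simp only [Pi.sub_apply, Pi.single_eq_same, hk, Nat.succ_eq_add_one, Nat.add_sub_cancel,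
        Nat.factorial_succ]
      push_cast
      field_simp
    · refine Finset.prod_congr rfl fun j hj => ?_
      simp [Finset.ne_of_mem_erase hj]

open Classical in
theorem mderiv_monomialAt (x : Fin n → ℝ) (α β : Fin n → ℕ) :
    mderiv β (monomialAt x α) = if β ≤ α then monomialAt x (α - β) else fun _ => 0 := by
  classical
  induction β using midx_induction with
  | h0 => simp [mderiv_zero]
  | hs β i ih =>
    funext u
    rw [mderiv_add_single isOpen_univ (contDiff_monomialAt x α).contDiffOn β i (Set.mem_univ u), ih]
    by_cases hβ : β ≤ α
    · rw [if_pos hβ, pderiv_monomialAt]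
      by_cases h1 : (α - β) i = 0
      · rw [if_pos h1, if_neg]
        intro h
        have h2 := h i
        simp only [Pi.add_apply, Pi.single_eq_same, Pi.sub_apply] at h2 h1
        omega
      · rw [if_neg h1, if_pos]
        · rw [tsub_tsub]
        · intro j
          have := hβ j
          by_cases hj : j = i
          · subst hj
            simp only [Pi.add_apply, Pi.single_eq_same, Pi.sub_apply] at h1 ⊢
            omega
          · simpa [hj] using this
    · rw [if_neg hβ, if_neg fun h => hβ fun j => le_trans (by simp) (h j)]
      simp [pderiv]

-- At x the functions (u - x)^α / α! are dual to the operators ∂^β. They serve twice: to isolate a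
-- coefficient of a differential operator, and to build a section with a prescribed jet.
open Classical in
theorem mderiv_monomialAt_self (x : Fin n → ℝ) (α β : Fin n → ℕ) :
    mderiv β (monomialAt x α) x = if β = α then 1 else 0 := by
  classical
  rw [mderiv_monomialAt]
  by_cases h : β = α
  · subst h
    simp [monomialAt]
  · rw [if_neg h]
    split_ifs with h2
    · obtain ⟨i, hi⟩ := Function.ne_iff.1 h
      refine Finset.prod_eq_zero (Finset.mem_univ i) ?_
      have : β i ≤ α i := h2 i
      rw [sub_self, zero_pow, zero_div]
      simp only [Pi.sub_apply]; omega
    · rfl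

end Monomials

/-! ## Test functions and integration by parts -/

section TestFunctions

open MeasureTheory

variable {n : ℕ} {V K : Set (Fin n → ℝ)}

/-- Smooth functions on the open set `V` which vanish outside `K` (a compact subset of `V`). -/
structure IsTest (V K : Set (Fin n → ℝ)) (w : (Fin n → ℝ) → ℝ) : Prop where
  contDiffOn : ContDiffOn ℝ ∞ w V
  eq_zero : ∀ u ∈ V, u ∉ K → w u = 0

namespace IsTest

variable {w : (Fin n → ℝ) → ℝ}

theorem mul_left (hw : IsTest V K w) {f : (Fin n → ℝ) → ℝ} (hf : ContDiffOn ℝ ∞ f V) :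
    IsTest V K (fun u => f u * w u) :=
  ⟨hf.mul hw.contDiffOn, fun u hu hk => by simp [hw.eq_zero u hu hk]⟩

theorem mul_right (hw : IsTest V K w) {f : (Fin n → ℝ) → ℝ} (hf : ContDiffOn ℝ ∞ f V) :
    IsTest V K (fun u => w u * f u) :=
  ⟨hw.contDiffOn.mul hf, fun u hu hk => by simp [hw.eq_zero u hu hk]⟩

theorem sum {κ : Type*} {s : Finset κ} {w : κ → (Fin n → ℝ) → ℝ}
    (hw : ∀ k ∈ s, IsTest V K (w k)) : IsTest V K (fun u => ∑ k ∈ s, w k u) :=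
  ⟨ContDiffOn.sum fun k hk => (hw k hk).contDiffOn,
    fun u hu h => Finset.sum_eq_zero fun k hk => (hw k hk).eq_zero u hu h⟩

theorem zero : IsTest V K (fun _ => 0) := ⟨contDiffOn_const, fun _ _ _ => rfl⟩

theorem indicator_eq (hw : IsTest V K w) {u : Fin n → ℝ} (hu : u ∉ K) : V.indicator w u = 0 := by
  by_cases h : u ∈ V
  · rw [Set.indicator_of_mem h, hw.eq_zero u h hu]
  · exact Set.indicator_of_notMem h _

theorem dirDeriv (hw : IsTest V K w) (hV : IsOpen V) (hK : IsCompact K) (v : Fin n → ℝ) :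
    IsTest V K (dirDeriv v w) := by
  refine ⟨contDiffOn_dirDeriv hV hw.contDiffOn v, fun u hu hk => ?_⟩
  have h : Set.EqOn w (fun _ => 0) (V ∩ Kᶜ) := fun u hu => hw.eq_zero u hu.1 hu.2
  rw [dirDeriv_congr (hV.inter hK.isClosed.isOpen_compl) h v ⟨hu, hk⟩]
  simp [JetVar.dirDeriv]

theorem mderiv (hw : IsTest V K w) (hV : IsOpen V) (hK : IsCompact K) (α : Fin n → ℕ) :
    IsTest V K (mderiv α w) := by
  rw [mderiv_eq]
  induction idxList α with
  | nil => exact hw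
  | cons i l ih => exact ih.dirDeriv hV hK _

/-- A point outside V has the complement of K as a neighbourhood, and there the extension by zero is
identically zero. -/
theorem contDiff_indicator (hw : IsTest V K w) (hV : IsOpen V) (hK : IsCompact K) (hKV : K ⊆ V) :
    ContDiff ℝ ∞ (V.indicator w) := by
  rw [contDiff_iff_contDiffAt]
  intro u
  by_cases hu : u ∈ V
  · refine (hw.contDiffOn.contDiffAt (hV.mem_nhds hu)).congr_of_eventuallyEq ?_
    filter_upwards [hV.mem_nhds hu] with v hv using Set.indicator_of_mem hv _
  · refine (contDiffAt_const (c := (0 : ℝ))).congr_of_eventuallyEq ?_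
    filter_upwards [hK.isClosed.isOpen_compl.mem_nhds fun h => hu (hKV h)] with v hv
      using hw.indicator_eq hv

theorem hasCompactSupport_indicator (hw : IsTest V K w) (hK : IsCompact K) :
    HasCompactSupport (V.indicator w) :=
  HasCompactSupport.intro hK fun _ hu => hw.indicator_eq hu

theorem integrableOn (hw : IsTest V K w) (hV : IsOpen V) (hK : IsCompact K) (hKV : K ⊆ V) :
    IntegrableOn w V := by
  rw [← integrable_indicator_iff hV.measurableSet]
  exact (hw.contDiff_indicator hV hK hKV).continuous.integrable_of_hasCompactSupport
    (hw.hasCompactSupport_indicator hK)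

theorem integral_dirDeriv (hw : IsTest V K w) (hV : IsOpen V) (hK : IsCompact K) (hKV : K ⊆ V)
    (v : Fin n → ℝ) : ∫ u in V, JetVar.dirDeriv v w u = 0 := by
  have hW := hw.contDiff_indicator hV hK hKV
  have hd := hw.dirDeriv hV hK v
  have hind : V.indicator (JetVar.dirDeriv v w) = fun u => fderiv ℝ (V.indicator w) u v := by
    funext u
    by_cases hu : u ∈ V
    · rw [Set.indicator_of_mem hu]
      exact dirDeriv_congr hV (fun z hz => (Set.indicator_of_mem hz w).symm) v hu
    · rw [Set.indicator_of_notMem hu]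
      have : V.indicator w =ᶠ[𝓝 u] fun _ => 0 := by
        filter_upwards [hK.isClosed.isOpen_compl.mem_nhds fun h => hu (hKV h)] with v hv
          using hw.indicator_eq hv
      rw [this.fderiv_eq]; simp
  rw [← integral_indicator hV.measurableSet]
  have hint := hd.integrableOn hV hK hKV
  rw [← integrable_indicator_iff hV.measurableSet] at hint
  rw [hind] at hint ⊢
  have hWi := hw.integrableOn hV hK hKV
  rw [← integrable_indicator_iff hV.measurableSet] at hWi
  -- Integration by parts on the whole space against the constant function 1.
  have := integral_mul_fderiv_eq_neg_fderiv_mul_of_integrable (μ := volume)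
    (f := fun _ : Fin n → ℝ => (1 : ℝ)) (g := V.indicator w) (v := v) (by simp)
    (by simpa using hint) (by simpa using hWi) (fun _ _ => differentiableAt_const _)
    (fun x _ => hW.contDiffAt.differentiableAt (by simp))
  simpa using this

/-- Integration by parts. -/
theorem integral_mul_mderiv (hw : IsTest V K w) (hV : IsOpen V) (hK : IsCompact K) (hKV : K ⊆ V)
    {f : (Fin n → ℝ) → ℝ} (hf : ContDiffOn ℝ ∞ f V) (α : Fin n → ℕ) :
    ∫ u in V, f u * JetVar.mderiv α w u =
      (-1) ^ (∑ i, α i) * ∫ u in V, JetVar.mderiv α f u * w u := by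
  simp only [mderiv_eq]
  rw [← length_idxList]
  induction idxList α generalizing f with
  | nil => simp
  | cons i l ih =>
    have hl : IsTest V K (dirDerivs unitVec l w) := by
      clear ih
      induction l with
      | nil => exact hw
      | cons i l ih => exact ih.dirDeriv hV hK _
    have h0 := (hl.mul_left hf).integral_dirDeriv hV hK hKV (unitVec i)
    rw [setIntegral_congr_fun hV.measurableSet
      (dirDeriv_mul hV hf hl.contDiffOn (unitVec i)),
      integral_add ((hl.mul_left (contDiffOn_dirDeriv hV hf _)).integrableOn hV hK hKV)
        (((hl.dirDeriv hV hK _).mul_left hf).integrableOn hV hK hKV),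
      ih (contDiffOn_dirDeriv hV hf _)] at h0
    have h1 : ∫ u in V, dirDerivs unitVec l (JetVar.dirDeriv (unitVec i) f) u * w u =
        ∫ u in V, dirDerivs unitVec (i :: l) f u * w u := by
      refine setIntegral_congr_fun hV.measurableSet fun u hu => ?_
      rw [dirDerivs_cons, dirDeriv_dirDerivs_comm hV hf _ _ _ hu]
    rw [h1] at h0
    simp only [dirDerivs_cons, List.length_cons, pow_succ] at h0 ⊢
    linarith

end IsTest

theorem exists_isTest_eventuallyEq_one (hV : IsOpen V) {x : Fin n → ℝ} (hx : x ∈ V) :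
    ∃ (K : Set (Fin n → ℝ)) (χ : (Fin n → ℝ) → ℝ), IsCompact K ∧ K ⊆ V ∧ ContDiff ℝ ∞ χ ∧
      IsTest V K χ ∧ χ =ᶠ[𝓝 x] fun _ => 1 := by
  obtain ⟨r, hr, hrV⟩ := Metric.nhds_basis_closedBall.mem_iff.1 (hV.mem_nhds hx)
  let c : ContDiffBump x := ⟨r / 2, r, by positivity, by linarith⟩
  refine ⟨Metric.closedBall x r, c, isCompact_closedBall x r, hrV, c.contDiff,
    ⟨c.contDiff.contDiffOn, fun u _ hu => ?_⟩, c.eventuallyEq_one⟩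
  refine c.zero_of_le_dist ?_
  simp only [Metric.mem_closedBall, not_le] at hu
  exact hu.le

/-- The fundamental lemma of the calculus of variations. -/
theorem eqOn_zero_of_integral_mul_test (hV : IsOpen V) {f : (Fin n → ℝ) → ℝ}
    (hf : ContinuousOn f V)
    (h : ∀ (K : Set (Fin n → ℝ)) (w : (Fin n → ℝ) → ℝ), IsCompact K → K ⊆ V → IsTest V K w →
      ∫ u in V, w u * f u = 0) : Set.EqOn f (fun _ => 0) V := by
  have hae := hV.ae_eq_zero_of_integral_contDiff_smul_eq_zero
    (hf.locallyIntegrableOn hV.measurableSet (μ := volume)) (fun g hg hc hs => by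
      have := h (tsupport g) g hc hs
        ⟨hg.contDiffOn, fun u _ hu => image_eq_zero_of_notMem_tsupport hu⟩
      rw [← this, setIntegral_eq_integral_of_forall_compl_eq_zero]
      · rfl
      · intro x hx
        rw [image_eq_zero_of_notMem_tsupport fun h => hx (hs h), zero_mul])
  refine Measure.eqOn_open_of_ae_eq (μ := volume) ?_ hV hf continuousOn_const
  rw [Filter.EventuallyEq, ae_restrict_iff' hV.measurableSet]
  exact hae

end TestFunctions

/-! ## Green's formula for linear differential operators -/

section Green

open MeasureTheory

variable {n m : ℕ} {V K : Set (Fin n → ℝ)}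

/-- The integral of `∑ φ^σ P^α_{σν} ∂^α ψ^ν`. -/
def operatorPairing (V : Set (Fin n → ℝ)) (s : ℕ)
    (P : Fin m → Fin m → (Fin n → ℕ) → (Fin n → ℝ) → ℝ)
    (φ ψ : Fin m → (Fin n → ℝ) → ℝ) : ℝ :=
  ∫ u in V, ∑ σ, ∑ ν, ∑ α : MIdx n s, φ σ u * (P σ ν α.1 u * mderiv α.1 (ψ ν) u)

/-- The coefficients of the difference of an operator and its formal adjoint. -/
def skewCoeff (s : ℕ) (P : Fin m → Fin m → (Fin n → ℕ) → (Fin n → ℝ) → ℝ) (σ ν : Fin m)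
    (α : Fin n → ℕ) (u : Fin n → ℝ) : ℝ :=
  P σ ν α u - adjointCoeff s (P ν σ) α u

variable {s : ℕ} {P : Fin m → Fin m → (Fin n → ℕ) → (Fin n → ℝ) → ℝ}

theorem contDiffOn_skewCoeff (hV : IsOpen V) (hP : ∀ σ ν α, ContDiffOn ℝ ∞ (P σ ν α) V)
    (σ ν : Fin m) (α : Fin n → ℕ) : ContDiffOn ℝ ∞ (skewCoeff s P σ ν α) V :=
  (hP σ ν α).sub (contDiffOn_adjointCoeff hV s (hP ν σ) α)

theorem operatorPairing_eq_sum (hV : IsOpen V) (hK : IsCompact K) (hKV : K ⊆ V)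
    (hP : ∀ σ ν α, ContDiffOn ℝ ∞ (P σ ν α) V) {φ ψ : Fin m → (Fin n → ℝ) → ℝ}
    (hφ : ∀ σ, IsTest V K (φ σ)) (hψ : ∀ σ, IsTest V K (ψ σ)) :
    operatorPairing V s P φ ψ = ∑ σ, ∑ ν, ∑ α : MIdx n s,
      ∫ u in V, φ σ u * (P σ ν α.1 u * mderiv α.1 (ψ ν) u) := by
  have ht : ∀ σ ν (α : MIdx n s),
      IsTest V K (fun u => φ σ u * (P σ ν α.1 u * mderiv α.1 (ψ ν) u)) := fun σ ν α =>
    (hφ σ).mul_right ((hP σ ν α).mul (contDiffOn_mderiv hV (hψ ν).contDiffOn _))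
  rw [operatorPairing, integral_finsetSum _ fun σ _ =>
    (IsTest.sum fun ν _ => IsTest.sum fun α _ => ht σ ν α).integrableOn hV hK hKV]
  refine Finset.sum_congr rfl fun σ _ => ?_
  rw [integral_finsetSum _ fun ν _ => (IsTest.sum fun α _ => ht σ ν α).integrableOn hV hK hKV]
  refine Finset.sum_congr rfl fun ν _ => ?_
  rw [integral_finsetSum _ fun α _ => (ht σ ν α).integrableOn hV hK hKV]

/-- Integration by parts moves the derivatives from φ to the products P ψ, and `sum_mderiv_mul`
rewrites the outcome as the formal adjoint applied to ψ. -/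
theorem operatorPairing_swap (hV : IsOpen V) (hK : IsCompact K) (hKV : K ⊆ V)
    (hP : ∀ σ ν α, ContDiffOn ℝ ∞ (P σ ν α) V) {φ ψ : Fin m → (Fin n → ℝ) → ℝ}
    (hφ : ∀ σ, IsTest V K (φ σ)) (hψ : ∀ σ, IsTest V K (ψ σ)) :
    operatorPairing V s P ψ φ =
      operatorPairing V s (fun σ ν α => adjointCoeff s (P ν σ) α) φ ψ := by
  rw [operatorPairing_eq_sum hV hK hKV hP hψ hφ, operatorPairing_eq_sum hV hK hKV
    (fun σ ν α => contDiffOn_adjointCoeff hV s (hP ν σ) α) hφ hψ, Finset.sum_comm]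
  refine Finset.sum_congr rfl fun ν _ => Finset.sum_congr rfl fun σ _ => ?_
  have h1 : ∀ α : MIdx n s, ∫ u in V, ψ σ u * (P σ ν α.1 u * mderiv α.1 (φ ν) u) =
      ∫ u in V, φ ν u * ((-1) ^ (∑ i, α.1 i) * mderiv α.1 (fun v => P σ ν α.1 v * ψ σ v) u) := by
    intro α
    have := (hφ ν).integral_mul_mderiv hV hK hKV ((hP σ ν α).mul (hψ σ).contDiffOn) α.1
    rw [← integral_const_mul] at this
    calc _ = ∫ u in V, P σ ν α.1 u * ψ σ u * mderiv α.1 (φ ν) u := by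
          congr 1; funext u; ring
      _ = _ := this
      _ = _ := by congr 1; funext u; ring
  simp only [h1]
  rw [← integral_finsetSum _ fun (α : MIdx n s) _ =>
      ((hφ ν).mul_right (contDiffOn_const.mul (contDiffOn_mderiv hV
        ((hP σ ν α).mul (hψ σ).contDiffOn) _))).integrableOn hV hK hKV,
    ← integral_finsetSum _ fun (α : MIdx n s) _ =>
      ((hφ ν).mul_right ((contDiffOn_adjointCoeff hV s (hP σ ν) α.1).mul (contDiffOn_mderiv hV
        (hψ σ).contDiffOn _))).integrableOn hV hK hKV]
  refine setIntegral_congr_fun hV.measurableSet fun u hu => ?_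
  simp only [← Finset.mul_sum]
  rw [sum_mderiv_mul hV s (hP σ ν) (hψ σ).contDiffOn hu]

/-- Green's formula has no boundary term for compactly supported arguments. Together with
`coeff_eq_zero_of_operatorPairing` it makes the symmetry of the pairing on all test functions
equivalent to P = P*, coefficient by coefficient. -/
theorem operatorPairing_sub_swap (hV : IsOpen V) (hK : IsCompact K) (hKV : K ⊆ V)
    (hP : ∀ σ ν α, ContDiffOn ℝ ∞ (P σ ν α) V) {φ ψ : Fin m → (Fin n → ℝ) → ℝ}
    (hφ : ∀ σ, IsTest V K (φ σ)) (hψ : ∀ σ, IsTest V K (ψ σ)) :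
    operatorPairing V s P φ ψ - operatorPairing V s P ψ φ =
      operatorPairing V s (skewCoeff s P) φ ψ := by
  rw [operatorPairing_swap hV hK hKV hP hφ hψ, operatorPairing_eq_sum hV hK hKV hP hφ hψ,
    operatorPairing_eq_sum hV hK hKV
      (fun σ ν α => contDiffOn_adjointCoeff hV s (hP ν σ) α) hφ hψ,
    operatorPairing_eq_sum hV hK hKV (contDiffOn_skewCoeff hV hP) hφ hψ]
  simp only [← Finset.sum_sub_distrib]
  refine Finset.sum_congr rfl fun σ _ => Finset.sum_congr rfl fun ν _ =>
    Finset.sum_congr rfl fun α _ => ?_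
  rw [← integral_sub
    (((hφ σ).mul_right ((hP σ ν α).mul (contDiffOn_mderiv hV (hψ ν).contDiffOn _))).integrableOn
      hV hK hKV)
    (((hφ σ).mul_right ((contDiffOn_adjointCoeff hV s (hP ν σ) α.1).mul
      (contDiffOn_mderiv hV (hψ ν).contDiffOn _))).integrableOn hV hK hKV)]
  congr 1; funext u; rw [skewCoeff]; ring

theorem isTest_single {w : (Fin n → ℝ) → ℝ} (hw : IsTest V K w) (σ ν : Fin m) :
    IsTest V K ((Pi.single σ w : Fin m → (Fin n → ℝ) → ℝ) ν) := by
  by_cases h : ν = σ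
  · subst h; simpa using hw
  · rw [Pi.single_eq_of_ne h]; exact IsTest.zero

theorem IsTest.mono {K' : Set (Fin n → ℝ)} {w : (Fin n → ℝ) → ℝ} (hw : IsTest V K w)
    (h : K ⊆ K') : IsTest V K' w :=
  ⟨hw.contDiffOn, fun u hu hk => hw.eq_zero u hu fun h' => hk (h h')⟩

/-- If the pairing with an operator vanishes on all test functions, the coefficients vanish. -/
theorem coeff_eq_zero_of_operatorPairing (hV : IsOpen V)
    (hP : ∀ σ ν α, ContDiffOn ℝ ∞ (P σ ν α) V)
    (h : ∀ (K : Set (Fin n → ℝ)) (φ ψ : Fin m → (Fin n → ℝ) → ℝ), IsCompact K → K ⊆ V →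
      (∀ σ, IsTest V K (φ σ)) → (∀ σ, IsTest V K (ψ σ)) → operatorPairing V s P φ ψ = 0)
    {x : Fin n → ℝ} (hx : x ∈ V) (σ ν : Fin m) (α : MIdx n s) : P σ ν α.1 x = 0 := by
  classical
  obtain ⟨K, χ, hK, hKV, -, hχ, hχ1⟩ := exists_isTest_eventuallyEq_one hV hx
  have hψ0 : IsTest V K (fun u => χ u * monomialAt x α.1 u) :=
    hχ.mul_right (contDiff_monomialAt x α.1).contDiffOn
  set ψ : Fin m → (Fin n → ℝ) → ℝ := Pi.single ν (fun u => χ u * monomialAt x α.1 u) with hψd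
  have hψ : ∀ κ, IsTest V K (ψ κ) := isTest_single hψ0 ν
  -- The first argument of the pairing is an arbitrary test function in the component σ, so the
  -- fundamental lemma gives a pointwise equation for the fixed `ψ`. At `x` the cut-off is 1 nearby
  -- and the derivatives of the monomial single out the coefficient P^α_{σν}(x).
  have key : Set.EqOn (fun u => ∑ κ, ∑ β : MIdx n s, P σ κ β.1 u * mderiv β.1 (ψ κ) u)
      (fun _ => 0) V := by
    refine eqOn_zero_of_integral_mul_test hV (ContDiffOn.continuousOn (n := ∞)
      (ContDiffOn.sum fun κ _ => ContDiffOn.sum fun β _ =>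
        (hP _ _ _).mul (contDiffOn_mderiv hV (hψ κ).contDiffOn _))) fun K' w hK' hK'V hw => ?_
    rw [← h (K ∪ K') (Pi.single σ w) ψ (hK.union hK') (Set.union_subset hKV hK'V)
      (fun κ => (isTest_single hw σ κ).mono Set.subset_union_right)
      (fun κ => (hψ κ).mono Set.subset_union_left), operatorPairing]
    congr 1; funext u
    simp only [Finset.mul_sum]
    symm
    rw [Finset.sum_eq_single σ]
    · simp
    · intro κ _ hκ; simp [hκ]
    · simp
  have h2 := key hx
  simp only at h2
  have hg : ∀ β : MIdx n s, mderiv β.1 (ψ ν) x = if β = α then 1 else 0 := by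
    intro β
    obtain ⟨O, hO, hOo, hxO⟩ := mem_nhds_iff.1 hχ1
    have : Set.EqOn (ψ ν) (monomialAt x α.1) O := fun u hu => by
      have : χ u = 1 := hO hu
      simp [hψd, this]
    rw [mderiv_congr hOo this _ hxO, mderiv_monomialAt_self]
    simp [Subtype.ext_iff]
  rw [Finset.sum_eq_single ν, Finset.sum_eq_single α] at h2
  · simpa [hg] using h2
  · intro β _ hβ; simp [hg, hβ]
  · simp
  · intro κ _ hκ
    refine Finset.sum_eq_zero fun β _ => ?_
    rw [hψd, Pi.single_eq_of_ne hκ]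
    have := mderiv_fun_zero β.1 x
    simp only [Pi.zero_def, this, mul_zero]
  · simp

/-- If an operator differs from its formal adjoint by a symmetric operator of order zero, then it is
self-adjoint. -/
theorem skewCoeff_eq_zero_of_symm (hV : IsOpen V) (hP : ∀ σ ν α, ContDiffOn ℝ ∞ (P σ ν α) V)
    (h1 : ∀ u ∈ V, ∀ σ ν (α : MIdx n s), α.1 ≠ 0 → skewCoeff s P σ ν α.1 u = 0)
    (h2 : ∀ u ∈ V, ∀ σ ν, skewCoeff s P σ ν 0 u = skewCoeff s P ν σ 0 u)
    {x : Fin n → ℝ} (hx : x ∈ V) (σ ν : Fin m) (α : MIdx n s) : skewCoeff s P σ ν α.1 x = 0 := by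
  refine coeff_eq_zero_of_operatorPairing hV (contDiffOn_skewCoeff hV hP)
    (fun K φ ψ hK hKV hφ hψ => ?_) hx σ ν α
  -- The pairing with P - P* changes sign when φ and ψ are exchanged, by Green's formula. A
  -- symmetric matrix of order zero gives a pairing that does not change. Having both properties, it
  -- is zero.
  have e1 := operatorPairing_sub_swap (s := s) hV hK hKV hP hφ hψ
  have e2 := operatorPairing_sub_swap (s := s) hV hK hKV hP hψ hφ
  have e3 : operatorPairing V s (skewCoeff s P) φ ψ = operatorPairing V s (skewCoeff s P) ψ φ := by
    refine setIntegral_congr_fun hV.measurableSet fun u hu => ?_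
    rw [Finset.sum_comm]
    refine Finset.sum_congr rfl fun σ _ => Finset.sum_congr rfl fun ν _ =>
      Finset.sum_congr rfl fun α _ => ?_
    by_cases hα : α.1 = 0
    · rw [hα, mderiv_zero, mderiv_zero, h2 u hu]; ring
    · rw [h1 u hu _ _ _ hα, h1 u hu _ _ _ hα]; ring
  linarith

end Green

/-! ## Prolongations and total derivatives -/

section Prolongation

variable {n m : ℕ}

/-- The coordinates of the `r`-jet at `u` of the function `g`. -/
def prolong (r : ℕ) (g : (Fin n → ℝ) → Fin m → ℝ) (u : Fin n → ℝ) : JSpace n m r :=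
  (u, fun σ α => mderiv α.1 (fun v => g v σ) u)

/-- The coordinate expression of the target projection. -/
def targetPoint (r : ℕ) : JSpace n m r →L[ℝ] (Fin n → ℝ) × (Fin m → ℝ) :=
  (ContinuousLinearMap.fst ℝ (Fin n → ℝ) (Fin m → MIdx n r → ℝ)).prod
    (ContinuousLinearMap.pi fun σ => coordY r σ 0)

/-- The jets whose target lies in `W`. -/
def jetsOver (r : ℕ) (W : Set ((Fin n → ℝ) × (Fin m → ℝ))) : Set (JSpace n m r) :=
  targetPoint r ⁻¹' W

theorem isOpen_jetsOver (r : ℕ) {W : Set ((Fin n → ℝ) × (Fin m → ℝ))} (hW : IsOpen W) :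
    IsOpen (jetsOver r W) :=
  hW.preimage (targetPoint r).continuous

theorem coordY_apply {t : ℕ} (σ : Fin m) {α : Fin n → ℕ} (h : ∑ i, α i ≤ t) (z : JSpace n m t) :
    coordY t σ α z = z.2 σ ⟨α, h⟩ := by
  rw [coordY, dif_pos h]; rfl

theorem vecY_eq {t : ℕ} (σ : Fin m) {α : Fin n → ℕ} (h : ∑ i, α i ≤ t) :
    vecY t σ α = (0, Pi.single σ (Pi.single ⟨α, h⟩ 1)) := by rw [vecY, dif_pos h]

theorem vecY_eq_zero {t : ℕ} (σ : Fin m) {α : Fin n → ℕ} (h : ¬ ∑ i, α i ≤ t) :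
    vecY t σ α = 0 := dif_neg h

@[simp] theorem jproj_fst (t r : ℕ) (z : JSpace n m t) : (jproj t r z).1 = z.1 := rfl

theorem jproj_snd (t r : ℕ) (z : JSpace n m t) (σ : Fin m) (α : MIdx n r) :
    (jproj t r z).2 σ α = coordY t σ α.1 z := rfl

theorem coordY_jproj {t r : ℕ} (σ : Fin m) {α : Fin n → ℕ} (h : ∑ i, α i ≤ r) (z : JSpace n m t) :
    coordY r σ α (jproj t r z) = coordY t σ α z := by
  rw [coordY_apply σ h]; rfl

theorem coordY_prolong {t : ℕ} (σ : Fin m) {α : Fin n → ℕ} (h : ∑ i, α i ≤ t)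
    (g : (Fin n → ℝ) → Fin m → ℝ) (u : Fin n → ℝ) :
    coordY t σ α (prolong t g u) = mderiv α (fun v => g v σ) u := by
  rw [coordY_apply σ h]; rfl

theorem jproj_prolong {t r : ℕ} (h : r ≤ t) (g : (Fin n → ℝ) → Fin m → ℝ) (u : Fin n → ℝ) :
    jproj t r (prolong t g u) = prolong r g u := by
  refine Prod.ext rfl ?_
  funext σ α
  rw [jproj_snd, coordY_prolong σ (α.2.trans h)]
  rfl

@[simp] theorem targetPoint_fst (r : ℕ) (z : JSpace n m r) : (targetPoint r z).1 = z.1 := rfl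

theorem targetPoint_prolong (r : ℕ) (g : (Fin n → ℝ) → Fin m → ℝ) (u : Fin n → ℝ) :
    targetPoint r (prolong r g u) = (u, g u) := by
  refine Prod.ext rfl ?_
  funext σ
  change coordY r σ 0 (prolong r g u) = _
  rw [coordY_prolong σ (by simp), mderiv_zero]

theorem targetPoint_jproj (t r : ℕ) (z : JSpace n m t) :
    targetPoint r (jproj t r z) = targetPoint t z := by
  refine Prod.ext rfl ?_
  funext σ
  exact coordY_jproj σ (by simp) z

theorem jproj_vecY {t r : ℕ} (h : r ≤ t) (σ : Fin m) (α : Fin n → ℕ) :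
    jproj t r (vecY t σ α) = vecY r σ α := by
  classical
  by_cases hα : ∑ i, α i ≤ t
  · refine Prod.ext ?_ ?_
    · rw [vecY_eq σ hα]
      by_cases hr : ∑ i, α i ≤ r
      · rw [vecY_eq σ hr]; rfl
      · rw [vecY_eq_zero σ hr]; rfl
    · funext ν β
      rw [jproj_snd, coordY_apply ν (β.2.trans h), vecY_eq σ hα]
      by_cases hr : ∑ i, α i ≤ r
      · rw [vecY_eq σ hr]
        by_cases hν : ν = σ
        · subst hν
          simp only [Pi.single_eq_same, Pi.single_apply, Subtype.ext_iff]
        · simp [hν]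
      · rw [vecY_eq_zero σ hr]
        by_cases hν : ν = σ
        · subst hν
          simp only [Pi.single_eq_same]
          rw [Pi.single_eq_of_ne]
          · rfl
          · intro hh
            have e : β.1 = α := congrArg Subtype.val hh
            exact hr (e ▸ β.2)
        · simp [hν]
  · rw [vecY_eq_zero σ hα, vecY_eq_zero σ fun hr => hα (hr.trans h), map_zero]

theorem contDiffOn_prolong {U : Set (Fin n → ℝ)} (hU : IsOpen U) {g : (Fin n → ℝ) → Fin m → ℝ}
    (hg : ContDiffOn ℝ ∞ g U) (t : ℕ) : ContDiffOn ℝ ∞ (prolong t g) U := by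
  refine contDiffOn_id.prodMk ?_
  rw [contDiffOn_pi]
  intro σ
  rw [contDiffOn_pi]
  intro α
  exact contDiffOn_mderiv hU (contDiffOn_pi.1 hg σ) α.1

theorem contDiffOn_prolong_param {P : Type*} [NormedAddCommGroup P] [NormedSpace ℝ P]
    {Ω : Set (P × (Fin n → ℝ))} (hΩ : IsOpen Ω) {G : P × (Fin n → ℝ) → Fin m → ℝ}
    (hG : ContDiffOn ℝ ∞ G Ω) (t : ℕ) :
    ContDiffOn ℝ ∞ (fun q : P × (Fin n → ℝ) => prolong t (fun v => G (q.1, v)) q.2) Ω := by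
  refine contDiffOn_snd.prodMk ?_
  rw [contDiffOn_pi]
  intro σ
  rw [contDiffOn_pi]
  intro α
  exact contDiffOn_mderiv_param hΩ (G := fun q => G q σ) (contDiffOn_pi.1 hG σ) α.1

theorem prolong_congr {U : Set (Fin n → ℝ)} (hU : IsOpen U) {g g' : (Fin n → ℝ) → Fin m → ℝ}
    (h : Set.EqOn g g' U) (t : ℕ) : Set.EqOn (prolong t g) (prolong t g') U := by
  intro u hu
  refine Prod.ext rfl ?_
  funext σ α
  exact mderiv_congr hU (fun v hv => by rw [h hv]) α.1 hu

/-- The polynomial function with a given jet. -/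
def polyWithJet {r : ℕ} (z : JSpace n m r) (u : Fin n → ℝ) (σ : Fin m) : ℝ :=
  ∑ α : MIdx n r, z.2 σ α * monomialAt z.1 α.1 u

theorem contDiff_polyWithJet {r : ℕ} (z : JSpace n m r) : ContDiff ℝ ∞ (polyWithJet z) := by
  rw [contDiff_pi]
  intro σ
  exact ContDiff.sum fun α _ => contDiff_const.mul (contDiff_monomialAt _ _)

/-- Taylor polynomials have arbitrary jets, because the monomials are dual to the partial
derivatives. An identity between functions of jets can therefore be checked along prolonged
sections. -/
theorem prolong_polyWithJet {r : ℕ} (z : JSpace n m r) :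
    prolong r (polyWithJet z) z.1 = z := by
  classical
  refine Prod.ext rfl ?_
  funext σ α
  change mderiv α.1 (fun v => ∑ β : MIdx n r, z.2 σ β * monomialAt z.1 β.1 v) z.1 = _
  rw [mderiv_fun_sum isOpen_univ Finset.univ (fun β _ =>
    (contDiff_const.mul (contDiff_monomialAt z.1 β.1)).contDiffOn) α.1 (Set.mem_univ _)]
  have h : ∀ β : MIdx n r, mderiv α.1 (fun v => z.2 σ β * monomialAt z.1 β.1 v) z.1 =
      z.2 σ β * if α = β then 1 else 0 := by
    intro β
    rw [mderiv_const_mul isOpen_univ (contDiff_monomialAt z.1 β.1).contDiffOn _ _ (Set.mem_univ _)]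
    simp only
    rw [mderiv_monomialAt_self]
    simp [Subtype.ext_iff]
  simp [h]

/-! ### Functions of bounded jet order -/

variable {W : Set ((Fin n → ℝ) × (Fin m → ℝ))}

/-- Smooth functions of the `t`-jets over `W` that depend only on the `k`-jet. -/
structure HasJetOrder (t k : ℕ) (W : Set ((Fin n → ℝ) × (Fin m → ℝ)))
    (f : JSpace n m t → ℝ) : Prop where
  contDiffOn : ContDiffOn ℝ ∞ f (jetsOver t W)
  eq_of_jproj_eq : ∀ z ∈ jetsOver t W, ∀ z' ∈ jetsOver t W, jproj t k z = jproj t k z' → f z = f z'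

namespace HasJetOrder

variable {t k : ℕ} {f f' : JSpace n m t → ℝ}

theorem mem_of_jproj_eq {z z' : JSpace n m t} (hz : z ∈ jetsOver t W)
    (h : jproj t k z = jproj t k z') : z' ∈ jetsOver t W := by
  have : targetPoint t z = targetPoint t z' := by
    rw [← targetPoint_jproj t k, h, targetPoint_jproj]
  rw [jetsOver, Set.mem_preimage] at hz ⊢
  rwa [← this]

theorem mul (h : HasJetOrder t k W f) (h' : HasJetOrder t k W f') :
    HasJetOrder t k W (fun z => f z * f' z) :=
  ⟨h.contDiffOn.mul h'.contDiffOn, fun z hz z' hz' e => by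
    rw [h.eq_of_jproj_eq z hz z' hz' e, h'.eq_of_jproj_eq z hz z' hz' e]⟩

theorem sum {κ : Type*} {s : Finset κ} {f : κ → JSpace n m t → ℝ}
    (h : ∀ j ∈ s, HasJetOrder t k W (f j)) : HasJetOrder t k W (fun z => ∑ j ∈ s, f j z) :=
  ⟨ContDiffOn.sum fun j hj => (h j hj).contDiffOn, fun z hz z' hz' e =>
    Finset.sum_congr rfl fun j hj => (h j hj).eq_of_jproj_eq z hz z' hz' e⟩

theorem of_targetPoint {h : (Fin n → ℝ) × (Fin m → ℝ) → ℝ} (hh : ContDiffOn ℝ ∞ h W) (t k : ℕ) :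
    HasJetOrder t k W (fun z => h (targetPoint t z)) :=
  ⟨hh.comp (targetPoint t).contDiff.contDiffOn fun _ hz => hz, fun z _ z' _ e => by
    rw [← targetPoint_jproj t k, e, targetPoint_jproj]⟩

theorem comp_jproj {r : ℕ} {f : JSpace n m r → ℝ} (hf : ContDiffOn ℝ ∞ f (jetsOver r W)) (t : ℕ) :
    HasJetOrder t r W (f ∘ jproj t r) := by
  refine ⟨hf.comp (jproj t r).contDiff.contDiffOn fun z hz => ?_, fun z _ z' _ e => ?_⟩
  · rw [jetsOver, Set.mem_preimage, targetPoint_jproj]; exact hz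
  · simp only [Function.comp, e]

/-- Translation by z' - z does not change the k-jet when z and z' have the same one. So f is
invariant under it near z, and the derivatives at z and z' agree. -/
theorem dirDeriv (hW : IsOpen W) (h : HasJetOrder t k W f) (v : JSpace n m t) :
    HasJetOrder t k W (dirDeriv v f) := by
  refine ⟨contDiffOn_dirDeriv (isOpen_jetsOver t hW) h.contDiffOn v, fun z hz z' hz' e => ?_⟩
  have : (fun w => f (w + (z' - z))) =ᶠ[𝓝 z] f := by
    filter_upwards [(isOpen_jetsOver t hW).mem_nhds hz] with w hw
    have e2 : jproj t k w = jproj t k (w + (z' - z)) := by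
      rw [map_add, map_sub, e, sub_self, add_zero]
    exact (h.eq_of_jproj_eq w hw _ (mem_of_jproj_eq hw e2) e2).symm
  simp only [JetVar.dirDeriv]
  rw [← this.fderiv_eq, fderiv_comp_add_right, add_sub_cancel]

theorem dirDeriv_eq_zero (hW : IsOpen W) (h : HasJetOrder t k W f) {v : JSpace n m t}
    (hv : jproj t k v = 0) {z : JSpace n m t} (hz : z ∈ jetsOver t W) :
    JetVar.dirDeriv v f z = 0 := by
  have hd := h.contDiffOn.differentiableAt_of_isOpen (isOpen_jetsOver t hW) hz
  rw [JetVar.dirDeriv, ← hd.lineDeriv_eq_fderiv, lineDeriv]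
  have : (fun a : ℝ => f (z + a • v)) = fun _ => f z := by
    funext a
    have e : jproj t k z = jproj t k (z + a • v) := by
      rw [map_add, map_smul, hv, smul_zero, add_zero]
    exact (h.eq_of_jproj_eq z hz _ (mem_of_jproj_eq hz e) e).symm
  rw [this, deriv_const]

theorem jproj_vecY_eq_zero (σ : Fin m) {α : Fin n → ℕ} (hk : k ≤ t) (hα : ¬ ∑ i, α i ≤ k) :
    jproj t k (vecY t σ α) = 0 := by
  rw [jproj_vecY hk, vecY_eq_zero σ hα]

/-- The order has to be tracked because y^σ_{α+e_i} is zero by convention for |α| = t: `totalDeriv`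
is the formal derivative only on functions that do not depend on the coordinates of order t. Each
application raises the order by at most one. -/
theorem totalDeriv (hW : IsOpen W) (h : HasJetOrder t k W f) (hk : k + 1 ≤ t) (i : Fin n) :
    HasJetOrder t (k + 1) W (totalDeriv i f) := by
  have lift : ∀ {z z' : JSpace n m t}, jproj t (k + 1) z = jproj t (k + 1) z' →
      jproj t k z = jproj t k z' := by
    intro z z' e
    have e1 : z.1 = z'.1 := by simpa using congrArg Prod.fst e
    refine Prod.ext e1 ?_
    funext σ α
    have := congrArg (fun q => coordY (k + 1) σ α.1 q) e
    simp only [coordY_jproj σ (α.2.trans (Nat.le_succ k))] at this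
    exact this
  refine ⟨(h.dirDeriv hW _).contDiffOn.add (ContDiffOn.sum fun σ _ => ContDiffOn.sum fun α _ =>
    (coordY t σ _).contDiff.contDiffOn.mul (h.dirDeriv hW _).contDiffOn),
    fun z hz z' hz' e => ?_⟩
  refine congrArg₂ (· + ·) ((h.dirDeriv hW _).eq_of_jproj_eq z hz z' hz' (lift e))
    (Finset.sum_congr rfl fun σ _ => Finset.sum_congr rfl fun α _ => ?_)
  by_cases hα : ∑ j, α.1 j ≤ k
  · have h1 : ∑ j, (α.1 + Pi.single i 1 : Fin n → ℕ) j ≤ k + 1 := by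
      rw [sum_add_single]; omega
    rw [← coordY_jproj σ h1 z, ← coordY_jproj σ h1 z', e]
    exact congrArg _ ((h.dirDeriv hW (vecY t σ α.1)).eq_of_jproj_eq z hz z' hz' (lift e))
  · have h0 := jproj_vecY_eq_zero (t := t) σ (Nat.le_of_succ_le hk) hα
    change _ * JetVar.dirDeriv (vecY t σ α.1) f z = _ * JetVar.dirDeriv (vecY t σ α.1) f z'
    rw [h.dirDeriv_eq_zero hW h0 hz, h.dirDeriv_eq_zero hW h0 hz', mul_zero, mul_zero]

end HasJetOrder

theorem jspace_vertical_eq_sum {t : ℕ} (a : Fin m → MIdx n t → ℝ) :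
    ((0, a) : JSpace n m t) = ∑ σ, ∑ α : MIdx n t, a σ α • vecY t σ α.1 := by
  classical
  have h : ∀ σ (α : MIdx n t), a σ α • vecY t σ α.1 =
      ((0, Pi.single σ (Pi.single α (a σ α))) : JSpace n m t) := by
    intro σ α
    rw [vecY_eq σ α.2, Prod.smul_mk, smul_zero, ← Pi.single_smul, ← Pi.single_smul, smul_eq_mul,
      mul_one]
  refine Prod.ext ?_ ?_
  · simp [h, Prod.fst_sum]
  · funext ν β
    simp only [h, Prod.snd_sum, Finset.sum_apply]
    rw [Finset.sum_eq_single ν, Finset.sum_eq_single β]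
    · simp
    · intro γ _ hγ; simp [Pi.single_eq_of_ne hγ.symm]
    · simp
    · intro κ _ hκ; simp [Pi.single_eq_of_ne hκ.symm]
    · simp

theorem jspace_eq_sum {t : ℕ} (i : Fin n) (a : Fin m → MIdx n t → ℝ) :
    ((unitVec i, a) : JSpace n m t) = vecX t i + ∑ σ, ∑ α : MIdx n t, a σ α • vecY t σ α.1 := by
  rw [← jspace_vertical_eq_sum]
  simp [vecX, unitVec]

variable {U : Set (Fin n → ℝ)} {g : (Fin n → ℝ) → Fin m → ℝ}

theorem prolong_mem_jetsOver (hgW : ∀ u ∈ U, (u, g u) ∈ W) (t : ℕ) {u : Fin n → ℝ} (hu : u ∈ U) :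
    prolong t g u ∈ jetsOver t W := by
  rw [jetsOver, Set.mem_preimage, targetPoint_prolong]; exact hgW u hu

theorem fderiv_prolong (hU : IsOpen U) (hg : ContDiffOn ℝ ∞ g U) (t : ℕ) {u : Fin n → ℝ}
    (hu : u ∈ U) (i : Fin n) :
    HasFDerivAt (prolong t g) (fderiv ℝ (prolong t g) u) u ∧
    fderiv ℝ (prolong t g) u (unitVec i) =
      (unitVec i, fun σ α => mderiv (α.1 + Pi.single i 1) (fun v => g v σ) u) := by
  have hgσ : ∀ σ, ContDiffOn ℝ ∞ (fun v => g v σ) U := contDiffOn_pi.1 hg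
  have hd : DifferentiableAt ℝ (prolong t g) u :=
    ((contDiffOn_prolong hU hg t).contDiffAt (hU.mem_nhds hu)).differentiableAt (by simp)
  refine ⟨hd.hasFDerivAt, Prod.ext ?_ ?_⟩
  · have := (hd.hasFDerivAt.fst).unique (hasFDerivAt_id u)
    exact DFunLike.congr_fun this (unitVec i)
  · funext σ α
    have h1 := hasFDerivAt_pi'.1 (hasFDerivAt_pi'.1 hd.hasFDerivAt.snd σ) α
    have h2 := h1.fderiv
    simp only
    rw [mderiv_add_single hU (hgσ σ) α.1 i hu]
    change _ = fderiv ℝ (fun v => (prolong t g v).2 σ α) u (unitVec i)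
    rw [h2]
    rfl

/-- Total derivatives are the partial derivatives along prolongations. -/
theorem pderiv_comp_prolong (hW : IsOpen W) (hU : IsOpen U) (hg : ContDiffOn ℝ ∞ g U)
    (hgW : ∀ u ∈ U, (u, g u) ∈ W) {t k : ℕ} (hk : k + 1 ≤ t) {f : JSpace n m t → ℝ}
    (hf : HasJetOrder t k W f) (i : Fin n) {u : Fin n → ℝ} (hu : u ∈ U) :
    pderiv i (fun v => f (prolong t g v)) u = totalDeriv i f (prolong t g u) := by
  have hz := prolong_mem_jetsOver hgW t hu
  have hd := hf.contDiffOn.differentiableAt_of_isOpen (isOpen_jetsOver t hW) hz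
  obtain ⟨hp, hp2⟩ := fderiv_prolong hU hg t hu i
  have hc := hd.hasFDerivAt.comp u hp
  change fderiv ℝ (f ∘ prolong t g) u (unitVec i) = _
  rw [hc.fderiv, ContinuousLinearMap.comp_apply, hp2, jspace_eq_sum, map_add, map_sum, totalDeriv]
  congr 1
  refine Finset.sum_congr rfl fun σ _ => ?_
  rw [map_sum]
  refine Finset.sum_congr rfl fun α _ => ?_
  rw [map_smul, smul_eq_mul]
  -- For |α| ≤ k the coordinate y^σ_{α+e_i} exists, as k + 1 ≤ t. For larger α the function does not
  -- depend on y^σ_α, so the conventional value of the missing coordinate is harmless.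
  by_cases hα : ∑ j, α.1 j ≤ k
  · rw [coordY_prolong σ (by rw [sum_add_single]; omega)]
    rfl
  · have h0 := HasJetOrder.jproj_vecY_eq_zero (t := t) σ (Nat.le_of_succ_le hk) hα
    have h1 := hf.dirDeriv_eq_zero hW h0 hz
    simp only [dirDeriv] at h1
    simp only [partialY, h1, mul_zero]

theorem foldr_totalDeriv (hW : IsOpen W) {t k : ℕ} {f : JSpace n m t → ℝ}
    (hf : HasJetOrder t k W f) (l : List (Fin n)) (hk : k + l.length ≤ t) :
    HasJetOrder t (k + l.length) W (l.foldr totalDeriv f) := by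
  induction l with
  | nil => exact hf
  | cons i l ih =>
    simp only [List.length_cons] at hk
    exact (ih (by omega)).totalDeriv hW (by omega) i

theorem mtotalDeriv_prolong (hW : IsOpen W) (hU : IsOpen U) (hg : ContDiffOn ℝ ∞ g U)
    (hgW : ∀ u ∈ U, (u, g u) ∈ W) {t k : ℕ} {f : JSpace n m t → ℝ} (hf : HasJetOrder t k W f)
    (β : Fin n → ℕ) (hk : k + ∑ i, β i ≤ t) {u : Fin n → ℝ} (hu : u ∈ U) :
    mtotalDeriv β f (prolong t g u) = mderiv β (fun v => f (prolong t g v)) u := by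
  rw [mtotalDeriv, iter_eq_foldr, mderiv_eq]
  rw [← length_idxList] at hk
  suffices h : Set.EqOn (fun v => (idxList β).foldr totalDeriv f (prolong t g v))
    (dirDerivs unitVec (idxList β) (fun v => f (prolong t g v))) U from h hu
  generalize idxList β = l at hk
  induction l with
  | nil => exact fun _ _ => rfl
  | cons i l ih =>
    simp only [List.length_cons] at hk
    intro v hv
    rw [dirDerivs_cons, ← dirDeriv_congr hU (ih (by omega)) _ hv, ← pderiv_eq,
      pderiv_comp_prolong hW hU hg hgW _ (foldr_totalDeriv hW hf l (by omega)) i hv]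
    · rfl
    · omega

theorem partialY_comp_jproj (hW : IsOpen W) {t r : ℕ} (hr : r ≤ t) {f : JSpace n m r → ℝ}
    (hf : ContDiffOn ℝ ∞ f (jetsOver r W)) (σ : Fin m) (α : Fin n → ℕ)
    {z : JSpace n m t} (hz : z ∈ jetsOver t W) :
    partialY σ α (f ∘ jproj t r) z = partialY σ α f (jproj t r z) := by
  have hz' : jproj t r z ∈ jetsOver r W := by
    rw [jetsOver, Set.mem_preimage, targetPoint_jproj]; exact hz
  have hd := hf.differentiableAt_of_isOpen (isOpen_jetsOver r hW) hz'
  rw [partialY, (hd.hasFDerivAt.comp z (jproj t r).hasFDerivAt).fderiv,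
    ContinuousLinearMap.comp_apply, jproj_vecY hr]
  rfl

/-- The pullback to t-jets still has jet order r, so |β| total derivatives stay within order r + |β|
≤ t. In the Euler-Lagrange and Helmholtz expressions |β| is at most the order r, which explains the
bound 2 r ≤ t there. -/
theorem mtotalDeriv_partialY_prolong (hW : IsOpen W) (hU : IsOpen U) (hg : ContDiffOn ℝ ∞ g U)
    (hgW : ∀ u ∈ U, (u, g u) ∈ W) {t r : ℕ} {f : JSpace n m r → ℝ}
    (hf : ContDiffOn ℝ ∞ f (jetsOver r W)) (σ : Fin m) (α β : Fin n → ℕ)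
    (ht : r + ∑ i, β i ≤ t) {u : Fin n → ℝ} (hu : u ∈ U) :
    mtotalDeriv β (partialY σ α (f ∘ jproj t r)) (prolong t g u) =
      mderiv β (fun v => partialY σ α f (prolong r g v)) u := by
  have hrt : r ≤ t := by omega
  have h1 : HasJetOrder t r W (partialY σ α (f ∘ jproj t r)) :=
    (HasJetOrder.comp_jproj hf t).dirDeriv hW (vecY t σ α)
  rw [mtotalDeriv_prolong hW hU hg hgW h1 β ht hu]
  refine mderiv_congr hU (fun v hv => ?_) β hu
  have := partialY_comp_jproj hW hrt hf σ α (prolong_mem_jetsOver hgW t hv)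
  rw [jproj_prolong hrt] at this
  exact this

theorem eulerLagrange_prolong (hW : IsOpen W) (hU : IsOpen U) (hg : ContDiffOn ℝ ∞ g U)
    (hgW : ∀ u ∈ U, (u, g u) ∈ W) {t r : ℕ} (ht : 2 * r ≤ t) {L : JSpace n m r → ℝ}
    (hL : ContDiffOn ℝ ∞ L (jetsOver r W)) (σ : Fin m) {u : Fin n → ℝ} (hu : u ∈ U) :
    eulerLagrange r t σ L (prolong t g u) = ∑ β : MIdx n r, (-1 : ℝ) ^ (∑ i, β.1 i) *
      mderiv β.1 (fun v => partialY σ β.1 L (prolong r g v)) u := by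
  refine Finset.sum_congr rfl fun β _ => ?_
  rw [mtotalDeriv_partialY_prolong hW hU hg hgW hL σ _ _ (by have := β.2; omega) hu]

/-- The coefficients of the linearization of `T` along `g`. -/
def linCoeff (s : ℕ) (T : Fin m → JSpace n m s → ℝ) (g : (Fin n → ℝ) → Fin m → ℝ)
    (σ ν : Fin m) (α : Fin n → ℕ) (u : Fin n → ℝ) : ℝ :=
  partialY ν α (T σ) (prolong s g u)

theorem contDiffOn_linCoeff (hW : IsOpen W) (hU : IsOpen U) (hg : ContDiffOn ℝ ∞ g U)
    (hgW : ∀ u ∈ U, (u, g u) ∈ W) {s : ℕ} {T : Fin m → JSpace n m s → ℝ}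
    (hT : ∀ σ, ContDiffOn ℝ ∞ (T σ) (jetsOver s W)) (σ ν : Fin m) (α : Fin n → ℕ) :
    ContDiffOn ℝ ∞ (linCoeff s T g σ ν α) U :=
  (contDiffOn_dirDeriv (isOpen_jetsOver s hW) (hT σ) _).comp (contDiffOn_prolong hU hg s)
    fun _ hu => prolong_mem_jetsOver hgW s hu

/-- Along g, the Lie-Euler expression of T_ν with its sign is the coefficient of the formal adjoint
of the linearization of T. The Helmholtz expressions thus measure how far the linearization is from
being self-adjoint. -/
theorem helmholtz_prolong (hW : IsOpen W) (hU : IsOpen U) (hg : ContDiffOn ℝ ∞ g U)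
    (hgW : ∀ u ∈ U, (u, g u) ∈ W) {t s : ℕ} (ht : 2 * s ≤ t) {T : Fin m → JSpace n m s → ℝ}
    (hT : ∀ σ, ContDiffOn ℝ ∞ (T σ) (jetsOver s W)) (σ ν : Fin m) (α : MIdx n s) {u : Fin n → ℝ}
    (hu : u ∈ U) :
    helmholtz s t T σ ν α (prolong t g u) = skewCoeff s (linCoeff s T g) σ ν α.1 u := by
  have hst : s ≤ t := by omega
  have h1 := partialY_comp_jproj hW hst (hT σ) ν α.1 (prolong_mem_jetsOver hgW t hu)
  rw [jproj_prolong hst] at h1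
  rw [helmholtz, skewCoeff, adjointCoeff, h1, lieEuler]
  congr 2
  refine Finset.sum_congr rfl fun β _ => ?_
  rw [mtotalDeriv_partialY_prolong hW hU hg hgW (hT ν) σ _ _ (by have := β.2; omega) hu]
  rfl

end Prolongation

/-! ## Adapted charts and local sections -/

section Charts

variable {n m : ℕ}
  {X : Type*} [TopologicalSpace X] [ChartedSpace (Fin n → ℝ) X]
  {Y : Type*} [TopologicalSpace Y] [ChartedSpace ((Fin n → ℝ) × (Fin m → ℝ)) Y]
  {π : Y → X}

namespace AdaptedChart

variable (c c' : AdaptedChart n m π)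

theorem proj_mem {y : Y} (hy : y ∈ c.chart.source) : π y ∈ c.base.source := by
  rw [c.base_source]; exact Set.mem_image_of_mem _ hy

theorem fst_mem {p : (Fin n → ℝ) × (Fin m → ℝ)} (hp : p ∈ c.chart.target) :
    p.1 ∈ c.base.target := by
  have h := c.proj_eq _ (c.chart.map_target hp)
  rw [c.chart.right_inv hp] at h
  rw [h]
  exact c.base.map_source (c.proj_mem (c.chart.map_target hp))

theorem base_symm_fst {p : (Fin n → ℝ) × (Fin m → ℝ)} (hp : p ∈ c.chart.target) :
    c.base.symm p.1 = π (c.chart.symm p) := by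
  have h := c.proj_eq _ (c.chart.map_target hp)
  rw [c.chart.right_inv hp] at h
  rw [h, c.base.left_inv (c.proj_mem (c.chart.map_target hp))]

/-- The local section with the expression `g` in an adapted chart. -/
def sectionOf {U : Set (Fin n → ℝ)} (hU : IsOpen U) {g : (Fin n → ℝ) → Fin m → ℝ}
    (hg : ContDiffOn ℝ ∞ g U) (hgW : ∀ u ∈ U, (u, g u) ∈ c.chart.target) {u : Fin n → ℝ}
    (hu : u ∈ U) : LocalSection n m π (c.base.symm u) where
  toFun x := c.chart.symm (c.base x, g (c.base x))
  exists_nhds := by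
    refine ⟨c.base.source ∩ c.base ⁻¹' U, c.base.isOpen_inter_preimage hU, ⟨?_, ?_⟩, ?_, ?_⟩
    · exact c.base.map_target (c.fst_mem (hgW u hu))
    · rw [Set.mem_preimage, c.base.right_inv (c.fst_mem (hgW u hu))]; exact hu
    · have h1 : ContMDiffOn 𝓘(ℝ, Fin n → ℝ) 𝓘(ℝ, (Fin n → ℝ) × (Fin m → ℝ)) ∞
          (fun x => (c.base x, g (c.base x))) (c.base.source ∩ c.base ⁻¹' U) := by
        have h2 : ContDiffOn ℝ ∞ (fun v => (v, g v)) U := contDiffOn_id.prodMk hg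
        exact h2.contMDiffOn.comp
          ((contMDiffOn_of_mem_maximalAtlas c.base_mem).mono Set.inter_subset_left) fun x hx => hx.2
      exact (contMDiffOn_symm_of_mem_maximalAtlas c.chart_mem).comp h1 fun x hx => hgW _ hx.2
    · intro x hx
      have hp := hgW _ hx.2
      rw [← c.base_symm_fst hp, c.base.left_inv hx.1]

theorem sectionOf_apply {U : Set (Fin n → ℝ)} (hU : IsOpen U) {g : (Fin n → ℝ) → Fin m → ℝ}
    (hg : ContDiffOn ℝ ∞ g U) (hgW : ∀ u ∈ U, (u, g u) ∈ c.chart.target) {u : Fin n → ℝ}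
    (hu : u ∈ U) {v : Fin n → ℝ} (hv : v ∈ U) :
    (c.sectionOf hU hg hgW hu).toFun (c.base.symm v) = c.chart.symm (v, g v) := by
  change c.chart.symm (c.base (c.base.symm v), g (c.base (c.base.symm v))) = _
  rw [c.base.right_inv (c.fst_mem (hgW v hv))]

/-- The expression of a local section in an adapted chart. -/
def localRep {x : X} (γ : LocalSection n m π x) (u : Fin n → ℝ) : Fin m → ℝ :=
  (c.chart (γ.toFun (c.base.symm u))).2

theorem sectionCoord_eq (r : ℕ) {x : X} (γ : LocalSection n m π x) :
    c.sectionCoord r γ = prolong r (c.localRep γ) (c.base x) := rfl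

theorem _root_.JetVar.LocalSection.proj_apply {x : X} (γ : LocalSection n m π x) :
    π (γ.toFun x) = x := by
  obtain ⟨U, _, hx, _, h⟩ := γ.exists_nhds
  exact h x hx

theorem exists_localRep {x : X} (γ : LocalSection n m π x) (hγ : γ.toFun x ∈ c.chart.source) :
    ∃ U : Set (Fin n → ℝ), IsOpen U ∧ c.base x ∈ U ∧ ContDiffOn ℝ ∞ (c.localRep γ) U ∧
      ∀ u ∈ U, (u, c.localRep γ u) ∈ c.chart.target ∧
        γ.toFun (c.base.symm u) = c.chart.symm (u, c.localRep γ u) := by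
  obtain ⟨O, hO, hxO, hs, hπ⟩ := γ.exists_nhds
  have hx : x ∈ c.base.source := by rw [← γ.proj_apply]; exact c.proj_mem hγ
  have hO' : IsOpen (O ∩ γ.toFun ⁻¹' c.chart.source) :=
    hs.continuousOn.isOpen_inter_preimage hO c.chart.open_source
  refine ⟨c.base.target ∩ c.base.symm ⁻¹' (O ∩ γ.toFun ⁻¹' c.chart.source),
    c.base.symm.isOpen_inter_preimage hO', ⟨c.base.map_source hx, ?_⟩, ?_, ?_⟩
  · rw [Set.mem_preimage, c.base.left_inv hx]; exact ⟨hxO, hγ⟩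
  · have h1 : ContMDiffOn 𝓘(ℝ, Fin n → ℝ) 𝓘(ℝ, (Fin n → ℝ) × (Fin m → ℝ)) ∞
        (fun u => c.chart (γ.toFun (c.base.symm u)))
        (c.base.target ∩ c.base.symm ⁻¹' (O ∩ γ.toFun ⁻¹' c.chart.source)) :=
      (contMDiffOn_of_mem_maximalAtlas c.chart_mem).comp (hs.comp
        ((contMDiffOn_symm_of_mem_maximalAtlas c.base_mem).mono Set.inter_subset_left)
        fun u hu => hu.2.1) fun u hu => hu.2.2
    exact contDiff_snd.comp_contDiffOn h1.contDiffOn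
  · intro u hu
    have h1 : (c.chart (γ.toFun (c.base.symm u))).1 = u := by
      rw [c.proj_eq _ hu.2.2, hπ _ hu.2.1, c.base.right_inv hu.1]
    have h2 : (u, c.localRep γ u) = c.chart (γ.toFun (c.base.symm u)) := Prod.ext h1.symm rfl
    rw [h2]
    exact ⟨c.chart.map_source hu.2.2, (c.chart.left_inv hu.2.2).symm⟩

theorem sectionCoord_sectionOf {U : Set (Fin n → ℝ)} (hU : IsOpen U)
    {g : (Fin n → ℝ) → Fin m → ℝ} (hg : ContDiffOn ℝ ∞ g U)
    (hgW : ∀ u ∈ U, (u, g u) ∈ c.chart.target) {u : Fin n → ℝ} (hu : u ∈ U) (r : ℕ) :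
    c.sectionCoord r (c.sectionOf hU hg hgW hu) = prolong r g u := by
  rw [sectionCoord_eq, c.base.right_inv (c.fst_mem (hgW u hu))]
  refine prolong_congr hU (fun v hv => ?_) r hu
  rw [localRep, c.sectionOf_apply hU hg hgW hu hv, c.chart.right_inv (hgW v hv)]

/-- The `r`-jet of a local section. -/
def _root_.JetVar.LocalSection.jet (r : ℕ) {x : X} (γ : LocalSection n m π x) : Jet n m π r :=
  ⟨x, Quotient.mk _ γ⟩

theorem _root_.JetVar.Jet.exists_section {r : ℕ} (j : Jet n m π r) :
    ∃ (x : X) (γ : LocalSection n m π x), j = γ.jet r := by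
  obtain ⟨x, q⟩ := j
  obtain ⟨γ, rfl⟩ := Quotient.exists_rep q
  exact ⟨x, γ, rfl⟩

theorem jet_mem_jetSource {r : ℕ} {x : X} {γ : LocalSection n m π x} :
    γ.jet r ∈ c.jetSource r ↔ γ.toFun x ∈ c.chart.source := Iff.rfl

theorem jetCoord_jet {r : ℕ} {x : X} {γ : LocalSection n m π x}
    (h : γ.toFun x ∈ c.chart.source) : c.jetCoord r (γ.jet r) = c.sectionCoord r γ := by
  exact if_pos h

theorem jetCoord_jet_of_notMem {r : ℕ} {x : X} {γ : LocalSection n m π x}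
    (h : γ.toFun x ∉ c.chart.source) : c.jetCoord r (γ.jet r) = 0 := by
  exact if_neg h

theorem targetPoint_sectionCoord (r : ℕ) {x : X} {γ : LocalSection n m π x}
    (h : γ.toFun x ∈ c.chart.source) :
    targetPoint r (c.sectionCoord r γ) = c.chart (γ.toFun x) := by
  have hx : x ∈ c.base.source := by rw [← γ.proj_apply]; exact c.proj_mem h
  rw [sectionCoord_eq, targetPoint_prolong, localRep, c.base.left_inv hx]
  refine Prod.ext ?_ rfl
  rw [c.proj_eq _ h, γ.proj_apply]

/-- A jet over the image of the chart is realized near its base point by its Taylor polynomial,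
whose graph lies in the open image there. The lemma makes the image of an associated chart an
explicit open set. -/
theorem jetDomain_eq (r : ℕ) : c.jetDomain r = jetsOver r c.chart.target := by
  ext z
  constructor
  · rintro ⟨j, hj, rfl⟩
    obtain ⟨x, γ, rfl⟩ := j.exists_section
    rw [jet_mem_jetSource] at hj
    rw [c.jetCoord_jet hj, jetsOver, Set.mem_preimage, c.targetPoint_sectionCoord r hj]
    exact c.chart.map_source hj
  · intro hz
    have hsm := (contDiff_polyWithJet z).contDiffOn (s := {u | (u, polyWithJet z u) ∈ c.chart.target})
    have hU : IsOpen {u | (u, polyWithJet z u) ∈ c.chart.target} :=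
      c.chart.open_target.preimage (continuous_id.prodMk (contDiff_polyWithJet z).continuous)
    have hu : z.1 ∈ {u | (u, polyWithJet z u) ∈ c.chart.target} := by
      have : targetPoint r z ∈ c.chart.target := hz
      rw [← prolong_polyWithJet z, targetPoint_prolong] at this
      exact this
    have hsrc : (c.sectionOf hU hsm (fun _ h => h) hu).toFun (c.base.symm z.1) ∈ c.chart.source := by
      rw [c.sectionOf_apply hU hsm (fun _ h => h) hu hu]
      exact c.chart.map_target hu
    refine ⟨(c.sectionOf hU hsm (fun _ h => h) hu).jet r, hsrc, ?_⟩
    rw [c.jetCoord_jet hsrc, c.sectionCoord_sectionOf, prolong_polyWithJet]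

/-! ### Changes of coordinates -/

/-- The part of the image of `c` in which the change of coordinates to `c'` is defined. -/
def overlap : Set ((Fin n → ℝ) × (Fin m → ℝ)) := (c.chart.symm.trans c'.chart).source

/-- The change of coordinates from `c` to `c'`. -/
def transition (p : (Fin n → ℝ) × (Fin m → ℝ)) : (Fin n → ℝ) × (Fin m → ℝ) :=
  c'.chart (c.chart.symm p)

/-- The part of the image of the base chart of `c` in which the change of base coordinates to `c'`
is defined. -/
def baseOverlap : Set (Fin n → ℝ) := (c.base.symm.trans c'.base).source

/-- The change of base coordinates from `c` to `c'`. -/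
def baseTransition (u : Fin n → ℝ) : Fin n → ℝ := c'.base (c.base.symm u)

theorem isOpen_overlap : IsOpen (c.overlap c') := (c.chart.symm.trans c'.chart).open_source

theorem isOpen_baseOverlap : IsOpen (c.baseOverlap c') := (c.base.symm.trans c'.base).open_source

theorem mem_overlap {p : (Fin n → ℝ) × (Fin m → ℝ)} :
    p ∈ c.overlap c' ↔ p ∈ c.chart.target ∧ c.chart.symm p ∈ c'.chart.source := by
  simp [overlap]

theorem mem_baseOverlap {u : Fin n → ℝ} :
    u ∈ c.baseOverlap c' ↔ u ∈ c.base.target ∧ c.base.symm u ∈ c'.base.source := by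
  simp [baseOverlap]

theorem contDiffOn_transition : ContDiffOn ℝ ∞ (c.transition c') (c.overlap c') :=
  ContMDiffOn.contDiffOn <| (contMDiffOn_of_mem_maximalAtlas c'.chart_mem).comp
    ((contMDiffOn_symm_of_mem_maximalAtlas c.chart_mem).mono
      fun _ hp => ((c.mem_overlap c').1 hp).1) fun _ hp => ((c.mem_overlap c').1 hp).2

theorem contDiffOn_baseTransition : ContDiffOn ℝ ∞ (c.baseTransition c') (c.baseOverlap c') :=
  ContMDiffOn.contDiffOn <| (contMDiffOn_of_mem_maximalAtlas c'.base_mem).comp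
    ((contMDiffOn_symm_of_mem_maximalAtlas c.base_mem).mono
      fun _ hp => ((c.mem_baseOverlap c').1 hp).1) fun _ hp => ((c.mem_baseOverlap c').1 hp).2

theorem fst_mem_baseOverlap {p : (Fin n → ℝ) × (Fin m → ℝ)} (hp : p ∈ c.overlap c') :
    p.1 ∈ c.baseOverlap c' := by
  rw [mem_overlap] at hp
  rw [mem_baseOverlap, c.base_symm_fst hp.1]
  exact ⟨c.fst_mem hp.1, c'.proj_mem hp.2⟩

theorem transition_fst {p : (Fin n → ℝ) × (Fin m → ℝ)} (hp : p ∈ c.overlap c') :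
    (c.transition c' p).1 = c.baseTransition c' p.1 := by
  rw [mem_overlap] at hp
  rw [transition, c'.proj_eq _ hp.2, baseTransition, c.base_symm_fst hp.1]

theorem transition_mem {p : (Fin n → ℝ) × (Fin m → ℝ)} (hp : p ∈ c.overlap c') :
    c.transition c' p ∈ c'.overlap c := by
  rw [mem_overlap] at hp ⊢
  rw [transition, c'.chart.left_inv hp.2]
  exact ⟨c'.chart.map_source hp.2, c.chart.map_target hp.1⟩

theorem baseTransition_mem {u : Fin n → ℝ} (hu : u ∈ c.baseOverlap c') :
    c.baseTransition c' u ∈ c'.baseOverlap c := by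
  rw [mem_baseOverlap] at hu ⊢
  rw [baseTransition, c'.base.left_inv hu.2]
  exact ⟨c'.base.map_source hu.2, c.base.map_target hu.1⟩

theorem baseTransition_baseTransition {u : Fin n → ℝ} (hu : u ∈ c.baseOverlap c') :
    c'.baseTransition c (c.baseTransition c' u) = u := by
  rw [mem_baseOverlap] at hu
  rw [baseTransition, baseTransition, c'.base.left_inv hu.2, c.base.right_inv hu.1]

/-- The expression in the chart `c'` of the section with the expression `g` in the chart `c`. -/
def transform (g : (Fin n → ℝ) → Fin m → ℝ) (u : Fin n → ℝ) : Fin m → ℝ :=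
  (c.transition c' (c'.baseTransition c u, g (c'.baseTransition c u))).2

/-- The coefficients of the derivatives `∂/∂x'^i` with respect to the derivatives `∂/∂x^k`. -/
def baseJacobian (i k : Fin n) (u : Fin n → ℝ) : ℝ :=
  pderiv i (fun v => c'.baseTransition c v k) (c.baseTransition c' u)

/-- The total derivative with respect to the base coordinates of `c'`, in the coordinates of `c`. -/
def totalDeriv' {r : ℕ} (i : Fin n) (f : JSpace n m r → ℝ) (z : JSpace n m r) : ℝ :=
  ∑ k, c.baseJacobian c' i k z.1 * totalDeriv k f z

/-- The change of coordinates from `c` to `c'` on the jets, in terms of total derivatives. -/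
def jetTrans (r : ℕ) (z : JSpace n m r) : JSpace n m r :=
  (c.baseTransition c' z.1, fun σ α => (idxList α.1).foldr (c.totalDeriv' c')
    (fun w => (c.transition c' (targetPoint r w)).2 σ) z)

theorem contDiffOn_baseJacobian (i k : Fin n) :
    ContDiffOn ℝ ∞ (c.baseJacobian c' i k) (c.baseOverlap c') := by
  have h1 : ContDiffOn ℝ ∞ (fun v => c'.baseTransition c v k) (c'.baseOverlap c) :=
    contDiffOn_pi.1 (c'.contDiffOn_baseTransition c) k
  exact (contDiffOn_dirDeriv (c'.isOpen_baseOverlap c) h1 _).comp (c.contDiffOn_baseTransition c')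
    fun u hu => c.baseTransition_mem c' hu

theorem hasJetOrder_totalDeriv' {r k : ℕ} {f : JSpace n m r → ℝ}
    (hf : HasJetOrder r k (c.overlap c') f) (hk : k + 1 ≤ r) (i : Fin n) :
    HasJetOrder r (k + 1) (c.overlap c') (c.totalDeriv' c' i f) := by
  refine HasJetOrder.sum fun l _ => HasJetOrder.mul ?_
    (hf.totalDeriv (c.isOpen_overlap c') hk l)
  exact HasJetOrder.of_targetPoint (h := fun p => c.baseJacobian c' i l p.1)
    ((c.contDiffOn_baseJacobian c' i l).comp contDiff_fst.contDiffOn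
      fun p hp => c.fst_mem_baseOverlap c' hp) r (k + 1)

theorem hasJetOrder_foldr_totalDeriv' {r : ℕ} {f : JSpace n m r → ℝ}
    (hf : HasJetOrder r 0 (c.overlap c') f) (l : List (Fin n)) (hl : l.length ≤ r) :
    HasJetOrder r l.length (c.overlap c') (l.foldr (c.totalDeriv' c') f) := by
  induction l with
  | nil => exact hf
  | cons i l ih =>
    simp only [List.length_cons] at hl
    exact c.hasJetOrder_totalDeriv' c' (ih (by omega)) (by omega) i

theorem hasJetOrder_transition (r : ℕ) (σ : Fin m) :
    HasJetOrder r 0 (c.overlap c') (fun w => (c.transition c' (targetPoint r w)).2 σ) :=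
  HasJetOrder.of_targetPoint (h := fun p => (c.transition c' p).2 σ)
    (contDiffOn_pi.1 (contDiff_snd.comp_contDiffOn (c.contDiffOn_transition c')) σ) r 0

theorem contDiffOn_jetTrans (r : ℕ) :
    ContDiffOn ℝ ∞ (c.jetTrans c' r) (jetsOver r (c.overlap c')) := by
  refine ContDiffOn.prodMk ((c.contDiffOn_baseTransition c').comp contDiff_fst.contDiffOn
    fun z hz => c.fst_mem_baseOverlap c' (p := targetPoint r z) hz) ?_
  rw [contDiffOn_pi]
  intro σ
  rw [contDiffOn_pi]
  intro α
  exact (c.hasJetOrder_foldr_totalDeriv' c' (c.hasJetOrder_transition c' r σ) (idxList α.1)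
    (by rw [length_idxList]; exact α.2)).contDiffOn

/-- The points of the image of the base chart of `c'` that correspond to points of `U`. -/
def transformDomain (U : Set (Fin n → ℝ)) : Set (Fin n → ℝ) :=
  c'.baseOverlap c ∩ c'.baseTransition c ⁻¹' U

theorem isOpen_transformDomain {U : Set (Fin n → ℝ)} (hU : IsOpen U) :
    IsOpen (c.transformDomain c' U) :=
  (c'.contDiffOn_baseTransition c).continuousOn.isOpen_inter_preimage (c'.isOpen_baseOverlap c) hU

end AdaptedChart

end Charts

/-! ### Changes of associated charts on jet bundles -/

section Transitions

variable {n m : ℕ}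
  {X : Type*} [TopologicalSpace X] [ChartedSpace (Fin n → ℝ) X]
  {Y : Type*} [TopologicalSpace Y] [ChartedSpace ((Fin n → ℝ) × (Fin m → ℝ)) Y]
  {π : Y → X}

namespace AdaptedChart

variable (c c' : AdaptedChart n m π) {U : Set (Fin n → ℝ)} {g : (Fin n → ℝ) → Fin m → ℝ}

theorem transform_eq (hgW : ∀ u ∈ U, (u, g u) ∈ c.overlap c') {u : Fin n → ℝ}
    (hu : u ∈ c.transformDomain c' U) :
    (u, c.transform c' g u) =
      c.transition c' (c'.baseTransition c u, g (c'.baseTransition c u)) := by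
  refine Prod.ext ?_ rfl
  rw [c.transition_fst c' (hgW _ hu.2), c'.baseTransition_baseTransition c hu.1]

theorem transform_mem (hgW : ∀ u ∈ U, (u, g u) ∈ c.overlap c') {u : Fin n → ℝ}
    (hu : u ∈ c.transformDomain c' U) : (u, c.transform c' g u) ∈ c'.overlap c := by
  rw [c.transform_eq c' hgW hu]
  exact c.transition_mem c' (hgW _ hu.2)

theorem baseTransition_mem_transformDomain (hgW : ∀ u ∈ U, (u, g u) ∈ c.overlap c')
    {u : Fin n → ℝ} (hu : u ∈ U) : c.baseTransition c' u ∈ c.transformDomain c' U := by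
  have h := c.fst_mem_baseOverlap c' (hgW u hu)
  refine ⟨c.baseTransition_mem c' h, ?_⟩
  rw [Set.mem_preimage, c.baseTransition_baseTransition c' h]
  exact hu

/-- The chain rule on the base, ∂/∂x'^i = ∑_k (∂x^k/∂x'^i) ∂/∂x^k, combined with the fact that each
∂/∂x^k along a prolongation is a total derivative. -/
theorem pderiv_comp_prolong_baseTransition (hU : IsOpen U) (hg : ContDiffOn ℝ ∞ g U)
    (hgW : ∀ u ∈ U, (u, g u) ∈ c.overlap c') {r k : ℕ} (hk : k + 1 ≤ r) {f : JSpace n m r → ℝ}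
    (hf : HasJetOrder r k (c.overlap c') f) (i : Fin n) {u : Fin n → ℝ}
    (hu : u ∈ c.transformDomain c' U) :
    pderiv i (fun v => f (prolong r g (c'.baseTransition c v))) u =
      c.totalDeriv' c' i f (prolong r g (c'.baseTransition c u)) := by
  have hF : ContDiffOn ℝ ∞ (fun v => f (prolong r g v)) U :=
    hf.contDiffOn.comp (contDiffOn_prolong hU hg r) fun v hv => prolong_mem_jetsOver hgW r hv
  have hFd := hF.differentiableAt_of_isOpen hU hu.2
  have hρ : DifferentiableAt ℝ (c'.baseTransition c) u :=
    ((c'.contDiffOn_baseTransition c).contDiffAt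
      ((c'.isOpen_baseOverlap c).mem_nhds hu.1)).differentiableAt (by simp)
  have hc := hFd.hasFDerivAt.comp u hρ.hasFDerivAt
  change fderiv ℝ ((fun v => f (prolong r g v)) ∘ c'.baseTransition c) u (unitVec i) = _
  rw [hc.fderiv, ContinuousLinearMap.comp_apply]
  have hs : fderiv ℝ (c'.baseTransition c) u (unitVec i) =
      ∑ k, c.baseJacobian c' i k (c'.baseTransition c u) • unitVec k := by
    funext k
    have h1 := (hasFDerivAt_pi'.1 hρ.hasFDerivAt k).fderiv
    rw [Finset.sum_apply, Finset.sum_eq_single k]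
    · simp only [Pi.smul_apply, unitVec, Pi.single_eq_same, smul_eq_mul, mul_one]
      rw [baseJacobian, c'.baseTransition_baseTransition c hu.1, pderiv, h1]
      rfl
    · intro j _ hj; simp [unitVec, hj.symm]
    · simp
  rw [hs, map_sum, totalDeriv']
  refine Finset.sum_congr rfl fun k _ => ?_
  rw [map_smul, smul_eq_mul, ← pderiv_comp_prolong (c.isOpen_overlap c') hU hg hgW hk hf k hu.2]
  rfl

/-- Each further derivative in the new base coordinates costs one `totalDeriv'` in the old jet
coordinates. Hence the jet of the transformed section is a function of the old jet alone, and a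
smooth one by `contDiffOn_jetTrans`. -/
theorem prolong_transform (hU : IsOpen U) (hg : ContDiffOn ℝ ∞ g U)
    (hgW : ∀ u ∈ U, (u, g u) ∈ c.overlap c') (r : ℕ) {u : Fin n → ℝ}
    (hu : u ∈ c.transformDomain c' U) :
    prolong r (c.transform c' g) u = c.jetTrans c' r (prolong r g (c'.baseTransition c u)) := by
  have hU' := c.isOpen_transformDomain c' hU
  refine Prod.ext (c'.baseTransition_baseTransition c hu.1).symm ?_
  funext σ α
  change mderiv α.1 (fun v => c.transform c' g v σ) u = (idxList α.1).foldr (c.totalDeriv' c')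
    (fun w => (c.transition c' (targetPoint r w)).2 σ) (prolong r g (c'.baseTransition c u))
  rw [mderiv_eq]
  have hl : (idxList α.1).length ≤ r := by rw [length_idxList]; exact α.2
  generalize idxList α.1 = l at hl
  suffices h : Set.EqOn (dirDerivs unitVec l (fun v => c.transform c' g v σ))
      (fun v => l.foldr (c.totalDeriv' c') (fun w => (c.transition c' (targetPoint r w)).2 σ)
        (prolong r g (c'.baseTransition c v))) (c.transformDomain c' U) from h hu
  induction l with
  | nil =>
    intro v hv
    simp only [dirDerivs_nil, List.foldr_nil, targetPoint_prolong]
    rfl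
  | cons i l ih =>
    simp only [List.length_cons] at hl
    intro v hv
    rw [dirDerivs_cons, dirDeriv_congr hU' (ih (by omega)) _ hv, ← pderiv_eq,
      c.pderiv_comp_prolong_baseTransition c' hU hg hgW hl
        (c.hasJetOrder_foldr_totalDeriv' c' (c.hasJetOrder_transition c' r σ) l (by omega)) i hv]
    rfl

theorem jetCoord_eq_jetTrans {r : ℕ} {j : Jet n m π r} (h : j ∈ c.jetSource r)
    (h' : j ∈ c'.jetSource r) : c'.jetCoord r j = c.jetTrans c' r (c.jetCoord r j) := by
  obtain ⟨x, γ, rfl⟩ := j.exists_section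
  rw [jet_mem_jetSource] at h h'
  rw [c.jetCoord_jet h, c'.jetCoord_jet h']
  obtain ⟨U, hU, hxU, hg, hγ⟩ := c.exists_localRep γ h
  obtain ⟨U', hU', hxU', hg', hγ'⟩ := c'.exists_localRep γ h'
  have hx : x ∈ c.base.source := by rw [← γ.proj_apply]; exact c.proj_mem h
  have hx' : x ∈ c'.base.source := by rw [← γ.proj_apply]; exact c'.proj_mem h'
  have hO : IsOpen (U ∩ (fun u => (u, c.localRep γ u)) ⁻¹' c.overlap c') :=
    (continuousOn_id.prodMk hg.continuousOn).isOpen_inter_preimage hU (c.isOpen_overlap c')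
  have hxO : c.base x ∈ U ∩ (fun u => (u, c.localRep γ u)) ⁻¹' c.overlap c' := by
    refine ⟨hxU, ?_⟩
    rw [Set.mem_preimage, mem_overlap, ← (hγ _ hxU).2, c.base.left_inv hx]
    exact ⟨(hγ _ hxU).1, h'⟩
  have hgW : ∀ u ∈ U ∩ (fun u => (u, c.localRep γ u)) ⁻¹' c.overlap c',
    (u, c.localRep γ u) ∈ c.overlap c' := fun u hu => hu.2
  have e1 : c.baseTransition c' (c.base x) = c'.base x := by
    rw [baseTransition, c.base.left_inv hx]
  have hm := c.baseTransition_mem_transformDomain c' hgW hxO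
  have e2 : c'.baseTransition c (c'.base x) = c.base x := by
    rw [baseTransition, c'.base.left_inv hx']
  rw [e1] at hm
  rw [sectionCoord_eq, sectionCoord_eq]
  have key := c.prolong_transform c' hO (hg.mono Set.inter_subset_left) hgW r hm
  rw [e2] at key
  rw [← key]
  refine prolong_congr (c.isOpen_transformDomain c' hO) (fun u hu => ?_) r hm
  have hu2 := (c'.mem_baseOverlap c).1 hu.1
  have e3 : c.base.symm (c'.baseTransition c u) = c'.base.symm u := by
    rw [baseTransition, c.base.left_inv hu2.2]
  rw [transform, transition, ← (hγ _ hu.2.1).2, e3]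
  rfl

theorem exists_jet_of_mem {r : ℕ} {z : JSpace n m r} (hz : z ∈ jetsOver r (c.overlap c')) :
    ∃ j ∈ c.jetSource r, j ∈ c'.jetSource r ∧ c.jetCoord r j = z := by
  have hz' : z ∈ c.jetDomain r := by
    rw [jetDomain_eq]
    exact ((c.mem_overlap c').1 hz).1
  obtain ⟨j, hj, rfl⟩ := hz'
  refine ⟨j, hj, ?_, rfl⟩
  obtain ⟨x, γ, rfl⟩ := j.exists_section
  rw [jet_mem_jetSource] at hj ⊢
  have := ((c.mem_overlap c').1 hz).2
  rwa [c.jetCoord_jet hj, c.targetPoint_sectionCoord r hj, c.chart.left_inv hj] at this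

theorem jetTransition_eqOn (r : ℕ) :
    Set.EqOn (c.jetTransition c' r) (c.jetTrans c' r) (jetsOver r (c.overlap c')) := by
  intro z hz
  obtain ⟨j, hj, hj', rfl⟩ := c.exists_jet_of_mem c' hz
  -- `Function.extend` takes the expected values only if the new coordinates factor through the old
  -- ones. Jets with equal coordinates in `c` have equal targets, so either both lie over the domain
  -- of `c'` and `jetTrans` applies, or both get the default value 0.
  have hfac : Function.FactorsThrough (fun j : c.jetSource r => c'.jetCoord r j.1)
      (fun j : c.jetSource r => c.jetCoord r j.1) := by
    rintro ⟨j₁, h₁⟩ ⟨j₂, h₂⟩ e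
    simp only at e ⊢
    obtain ⟨x₁, γ₁, rfl⟩ := j₁.exists_section
    obtain ⟨x₂, γ₂, rfl⟩ := j₂.exists_section
    rw [jet_mem_jetSource] at h₁ h₂
    have ht : γ₁.toFun x₁ = γ₂.toFun x₂ := by
      refine c.chart.injOn h₁ h₂ ?_
      rw [← c.targetPoint_sectionCoord r h₁, ← c.targetPoint_sectionCoord r h₂,
        ← c.jetCoord_jet h₁, ← c.jetCoord_jet h₂, e]
    by_cases h' : γ₁.toFun x₁ ∈ c'.chart.source
    · rw [c.jetCoord_eq_jetTrans c' (j := γ₁.jet r) h₁ h',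
        c.jetCoord_eq_jetTrans c' (j := γ₂.jet r) h₂ (by rw [jet_mem_jetSource, ← ht]; exact h'), e]
    · rw [c'.jetCoord_jet_of_notMem h', c'.jetCoord_jet_of_notMem (by rwa [← ht])]
  rw [← c.jetCoord_eq_jetTrans c' hj hj']
  exact hfac.extend_apply 0 (⟨j, hj⟩ : c.jetSource r)

theorem fderiv_jetTransition {r : ℕ} {z : JSpace n m r} (hz : z ∈ jetsOver r (c.overlap c')) :
    fderiv ℝ (c.jetTransition c' r) z = fderiv ℝ (c.jetTrans c' r) z := by
  refine Filter.EventuallyEq.fderiv_eq ?_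
  filter_upwards [(isOpen_jetsOver r (c.isOpen_overlap c')).mem_nhds hz] with w hw
    using c.jetTransition_eqOn c' r hw

theorem targetPoint_jetTrans {r : ℕ} {z : JSpace n m r} (hz : z ∈ jetsOver r (c.overlap c')) :
    targetPoint r (c.jetTrans c' r z) = c.transition c' (targetPoint r z) := by
  refine Prod.ext ?_ ?_
  · rw [c.transition_fst c' hz]; rfl
  · funext σ
    change coordY r σ 0 (c.jetTrans c' r z) = _
    rw [coordY_apply σ (by simp)]
    change (idxList (0 : Fin n → ℕ)).foldr (c.totalDeriv' c')
      (fun w => (c.transition c' (targetPoint r w)).2 σ) z = _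
    rw [idxList_zero]
    rfl

/-- The changes of coordinates on the jets cover the change of coordinates. -/
theorem targetPoint_fderiv_jetTrans {r : ℕ} {z : JSpace n m r}
    (hz : z ∈ jetsOver r (c.overlap c')) (v : JSpace n m r) :
    targetPoint r (fderiv ℝ (c.jetTrans c' r) z v) =
      fderiv ℝ (c.transition c') (targetPoint r z) (targetPoint r v) := by
  have hO := isOpen_jetsOver r (c.isOpen_overlap c')
  have h1 : DifferentiableAt ℝ (c.jetTrans c' r) z :=
    ((c.contDiffOn_jetTrans c' r).contDiffAt (hO.mem_nhds hz)).differentiableAt (by simp)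
  have h2 : DifferentiableAt ℝ (c.transition c') (targetPoint r z) :=
    ((c.contDiffOn_transition c').contDiffAt ((c.isOpen_overlap c').mem_nhds hz)).differentiableAt
      (by simp)
  have e1 := ((targetPoint r).hasFDerivAt.comp z h1.hasFDerivAt)
  have e2 := (h2.hasFDerivAt.comp z (targetPoint r).hasFDerivAt)
  have e3 : (targetPoint r) ∘ (c.jetTrans c' r) =ᶠ[𝓝 z] c.transition c' ∘ targetPoint r := by
    filter_upwards [hO.mem_nhds hz] with w hw using c.targetPoint_jetTrans c' hw
  have e4 := (e1.congr_of_eventuallyEq e3.symm).unique e2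
  exact DFunLike.congr_fun e4 v

theorem fderiv_transition_fst {p : (Fin n → ℝ) × (Fin m → ℝ)} (hp : p ∈ c.overlap c')
    (v : (Fin n → ℝ) × (Fin m → ℝ)) :
    (fderiv ℝ (c.transition c') p v).1 = fderiv ℝ (c.baseTransition c') p.1 v.1 := by
  have hO := c.isOpen_overlap c'
  have h1 : DifferentiableAt ℝ (c.transition c') p :=
    ((c.contDiffOn_transition c').contDiffAt (hO.mem_nhds hp)).differentiableAt (by simp)
  have h2 : DifferentiableAt ℝ (c.baseTransition c') p.1 :=
    ((c.contDiffOn_baseTransition c').contDiffAt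
      ((c.isOpen_baseOverlap c').mem_nhds (c.fst_mem_baseOverlap c' hp))).differentiableAt (by simp)
  have e1 := h1.hasFDerivAt.fst
  have e2 := h2.hasFDerivAt.comp p hasFDerivAt_fst
  have e3 : (fun q => (c.transition c' q).1) =ᶠ[𝓝 p] c.baseTransition c' ∘ Prod.fst := by
    filter_upwards [hO.mem_nhds hp] with w hw using c.transition_fst c' hw
  have e4 := (e1.congr_of_eventuallyEq e3.symm).unique e2
  exact DFunLike.congr_fun e4 v

end AdaptedChart

end Transitions

/-! ## Forms of the type of a differential equation -/

section SourceForms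

variable {n m s : ℕ}

theorem coordY_vecY {t : ℕ} (σ ν : Fin m) {α β : Fin n → ℕ} (hα : ∑ i, α i ≤ t)
    (hβ : ∑ i, β i ≤ t) [Decidable (σ = ν ∧ α = β)] :
    coordY t σ α (vecY t ν β) = if σ = ν ∧ α = β then 1 else 0 := by
  classical
  rw [coordY_apply σ hα, vecY_eq ν hβ]
  by_cases h1 : σ = ν
  · subst h1
    by_cases h2 : α = β
    · subst h2; simp
    · simp [h2]
  · simp [h1]

@[simp] theorem vecY_fst (t : ℕ) (σ : Fin m) (α : Fin n → ℕ) :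
    (vecY t σ α : JSpace n m t).1 = 0 := by
  rw [vecY]; split_ifs <;> rfl

@[simp] theorem coordY_vecX (t : ℕ) (σ : Fin m) (α : Fin n → ℕ) (i : Fin n) :
    coordY t σ α (vecX t i) = 0 := by
  rw [coordY]; split_ifs <;> rfl

/-- An `(n+1)`-form that is horizontal in the sense of a differential equation is determined by its
values on the vectors `∂/∂y^σ, ∂/∂x^1, ..., ∂/∂x^n`. -/
theorem apply_cons_of_horizontal (η : JSpace n m s [⋀^Fin (n + 1)]→L[ℝ] ℝ)
    (hor : ∀ (v : Fin (n + 1) → JSpace n m s) (a b : Fin (n + 1)), a ≠ b →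
      (v a).1 = 0 → (v b).1 = 0 → η v = 0)
    (ver : ∀ (v : Fin (n + 1) → JSpace n m s) (a : Fin (n + 1)),
      (v a).1 = 0 → (∀ σ : Fin m, coordY s σ 0 (v a) = 0) → η v = 0)
    (w : JSpace n m s) (hw : w.1 = 0) (v : Fin n → JSpace n m s) :
    η (Fin.cons w v) = (∑ σ, coordY s σ 0 w * η (Fin.cons (vecY s σ 0) fun i => vecX s i)) *
      Matrix.det (Matrix.of fun i j => (v i).1 j) := by
  classical
  have hlin : ∀ (v : Fin n → JSpace n m s) (w₁ w₂ : JSpace n m s),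
      η (Fin.cons (w₁ + w₂) v) = η (Fin.cons w₁ v) + η (Fin.cons w₂ v) := by
    intro v w₁ w₂
    exact (η.toAlternatingMap.toMultilinearMap).cons_add v w₁ w₂
  have hsmul : ∀ (v : Fin n → JSpace n m s) (a : ℝ) (w : JSpace n m s),
      η (Fin.cons (a • w) v) = a * η (Fin.cons w v) := by
    intro v a w
    exact (η.toAlternatingMap.toMultilinearMap).cons_smul v a w
  let inc : (Fin n → ℝ) →ₗ[ℝ] JSpace n m s := LinearMap.inl ℝ _ _
  let η' : (Fin n → ℝ) [⋀^Fin n]→ₗ[ℝ] ℝ := (η.toAlternatingMap.curryLeft w).compLinearMap inc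
  have e1 : η (Fin.cons w v) = η' fun i => (v i).1 := by
    -- The vectors `v i` are replaced one at a time by their base parts. The error has a second
    -- vertical vector besides `w`, so `hor` kills it.
    have key : ∀ S : Finset (Fin n), η (Fin.cons w v) =
        η (Fin.cons w fun i => if i ∈ S then ((v i).1, 0) else v i) := by
      intro S
      induction S using Finset.induction_on with
      | empty => simp
      | insert i S hi ih =>
        rw [ih]
        set v' : Fin n → JSpace n m s := fun j => if j ∈ S then ((v j).1, 0) else v j with hv'
        have h1 : (fun j => if j ∈ insert i S then (((v j).1, 0) : JSpace n m s) else v j) =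
            Function.update v' i ((v i).1, 0) := by
          funext j
          by_cases hj : j = i
          · subst hj; simp
          · simp [hj, hv']
        have h2 : v' = Function.update v' i (((v i).1, 0) + (0, (v i).2)) := by
          rw [Prod.mk_add_mk, add_zero, zero_add]
          have : v' i = v i := by simp [hv', hi]
          rw [Prod.mk.eta, ← this, Function.update_eq_self]
        rw [h1]
        conv_lhs => rw [h2]
        rw [Fin.cons_update, Fin.cons_update]
        rw [ContinuousAlternatingMap.map_update_add]
        rw [add_eq_left]
        refine hor _ 0 i.succ (Fin.succ_ne_zero i).symm ?_ ?_
        · rw [Function.update_of_ne (Fin.succ_ne_zero i).symm]; exact hw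
        · rw [Function.update_self]
    have := key Finset.univ
    simp only [Finset.mem_univ, if_true] at this
    rw [this]
    rfl
  -- What remains is an alternating n-form on ℝⁿ, hence a multiple of the determinant.
  have e2 := η'.eq_smul_basis_det (Pi.basisFun ℝ (Fin n))
  have e3 : η' (Pi.basisFun ℝ (Fin n)) = η (Fin.cons w fun i => vecX s i) := by
    change η (Matrix.vecCons w _) = η (Matrix.vecCons w _)
    congr 2
    funext i
    simp [inc, vecX]
  have e4 : η (Fin.cons w fun i => vecX s i) =
      ∑ σ, coordY s σ 0 w * η (Fin.cons (vecY s σ 0) fun i => vecX s i) := by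
    have hsum : ∀ S : Finset (Fin m), η (Fin.cons (∑ σ ∈ S, coordY s σ 0 w • vecY s σ 0)
        fun i => vecX s i) =
        ∑ σ ∈ S, coordY s σ 0 w * η (Fin.cons (vecY s σ 0) fun i => vecX s i) := by
      intro S
      induction S using Finset.induction_on with
      | empty =>
        rw [Finset.sum_empty, Finset.sum_empty]
        have := hsmul (fun i => vecX s i) 0 0
        simpa using this
      | insert σ S hσ ih => rw [Finset.sum_insert hσ, Finset.sum_insert hσ, hlin, hsmul, ih]
    -- After removal of its components along ∂/∂y^σ, the vector `w` is vertical over Y, and `ver`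
    -- applies to the rest.
    have hsplit : w = ∑ σ, coordY s σ 0 w • vecY s σ 0 +
        (w - ∑ σ, coordY s σ 0 w • vecY s σ 0) := by abel
    conv_lhs => rw [hsplit]
    rw [hlin, hsum, add_eq_left]
    refine ver _ 0 ?_ ?_
    · simp [Prod.fst_sum, hw]
    · intro σ
      simp only [Fin.cons_zero, map_sub, map_sum, map_smul, smul_eq_mul]
      have : ∀ ν : Fin m, coordY s ν 0 w * coordY s σ 0 (vecY s ν (0 : Fin n → ℕ)) =
          if σ = ν then coordY s ν 0 w else 0 := by
        intro ν
        rw [coordY_vecY σ ν (by simp) (by simp)]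
        simp
      simp [this]
  rw [e1, e2, AlternatingMap.smul_apply, Pi.basisFun_det_apply, smul_eq_mul, e3, e4]

end SourceForms

/-! ## Evaluation of forms -/

section Forms

variable {n m t : ℕ}

theorem wedge_apply {E : Type*} [NormedAddCommGroup E] [NormedSpace ℝ E] {q : ℕ}
    (l : Fin q → (E →L[ℝ] ℝ)) (v : Fin q → E) :
    wedge l v = Matrix.det (Matrix.of fun a b => l a (v b)) := by
  rw [← Matrix.det_transpose, Matrix.det_apply', wedge,
    ContinuousMultilinearMap.alternatization_apply_apply]
  refine Finset.sum_congr rfl fun τ _ => ?_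
  simp [Units.smul_def, Matrix.transpose_apply]

theorem det_cons_vertical (l : JSpace n m t →L[ℝ] ℝ) (w : JSpace n m t) (hw : w.1 = 0)
    (u : Fin n → JSpace n m t) :
    Matrix.det (Matrix.of fun a b : Fin (n + 1) =>
      (Fin.cons l (fun i : Fin n => coordX t i) : Fin (n + 1) → (JSpace n m t →L[ℝ] ℝ)) a
        ((Fin.cons w u : Fin (n + 1) → JSpace n m t) b)) =
      l w * Matrix.det (Matrix.of fun a b => (u b).1 a) := by
  rw [Matrix.det_succ_column_zero, Fin.sum_univ_succ, Finset.sum_eq_zero, add_zero]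
  · simp only [Matrix.of_apply, Fin.val_zero, pow_zero, Fin.cons_zero, one_mul]
    congr 1
  · intro i _
    simp only [Matrix.of_apply, Fin.cons_zero, Fin.cons_succ]
    have : coordX t i w = w.1 i := rfl
    rw [this, hw]
    simp

theorem wedge_cons_vertical (l : JSpace n m t →L[ℝ] ℝ) (w : JSpace n m t) (hw : w.1 = 0)
    (u : Fin n → JSpace n m t) :
    wedge (Fin.cons l (fun i : Fin n => coordX t i)) (Fin.cons w u) =
      l w * Matrix.det (Matrix.of fun a b => (u b).1 a) := by
  rw [wedge_apply, det_cons_vertical l w hw u]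

theorem det_vecX : (Matrix.det (Matrix.of fun a b : Fin n => (vecX (m := m) t b).1 a)) = 1 := by
  classical
  have : (Matrix.of fun a b : Fin n => (vecX (m := m) t b).1 a) = (1 : Matrix (Fin n) (Fin n) ℝ) := by
    funext a b
    simp [vecX, Matrix.one_apply, Pi.single_apply]
  rw [this, Matrix.det_one]

theorem wedge_cons_cons_vertical (l₁ l₂ : JSpace n m t →L[ℝ] ℝ) (w₁ w₂ : JSpace n m t)
    (h₁ : w₁.1 = 0) (h₂ : w₂.1 = 0) :
    wedge (Fin.cons l₁ (Fin.cons l₂ (fun i : Fin n => coordX t i)))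
      (Fin.cons w₁ (Fin.cons w₂ (fun i : Fin n => vecX t i))) = l₁ w₁ * l₂ w₂ - l₂ w₁ * l₁ w₂ := by
  have h3 : ∀ i, coordX t i w₁ = 0 := fun i => congrFun h₁ i
  rw [wedge_apply, Matrix.det_succ_column_zero, Fin.sum_univ_succ, Fin.sum_univ_succ,
    Finset.sum_eq_zero, add_zero]
  · have e1 := det_cons_vertical l₂ w₂ h₂ (fun i : Fin n => vecX t i)
    have e2 := det_cons_vertical l₁ w₂ h₂ (fun i : Fin n => vecX t i)
    rw [det_vecX, mul_one] at e1 e2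
    simp only [Matrix.of_apply, Fin.val_zero, pow_zero, Fin.cons_zero, one_mul, Fin.succ_zero_eq_one, Fin.cons_one,
      Fin.val_one, pow_one, neg_mul]
    rw [sub_eq_add_neg]
    congr 2
    congr 1
    rw [← e2]
    congr 1
    funext a b
    refine Fin.cases ?_ (fun a => ?_) a
    · simp [Matrix.submatrix]
    · simp only [Matrix.submatrix_apply, Matrix.of_apply, Fin.cons_succ]
      rw [← Fin.succ_zero_eq_one, Fin.succ_succAbove_succ]
      simp
  · intro i _
    simp [h3]

theorem contact_vertical {α : Fin n → ℕ} (σ : Fin m) (z w : JSpace n m t) (hw : w.1 = 0) :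
    contact σ α z w = coordY t σ α w := by
  have h3 : ∀ i, coordX t i w = 0 := fun i => congrFun hw i
  simp [contact, h3]

theorem sourceForm_cons_vertical (A : Fin m → ℝ) (z w : JSpace n m t) (hw : w.1 = 0)
    (u : Fin n → JSpace n m t) :
    sourceForm A z (Fin.cons w u) =
      (∑ σ, coordY t σ 0 w * A σ) * Matrix.det (Matrix.of fun i j => (u i).1 j) := by
  have hdet : (Matrix.det (Matrix.of fun i j => (u i).1 j)) = Matrix.det (Matrix.of fun a b => (u b).1 a) :=
    (Matrix.det_transpose _)
  rw [sourceForm, ContinuousAlternatingMap.sum_apply, Finset.sum_mul, hdet]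
  refine Finset.sum_congr rfl fun σ _ => ?_
  rw [ContinuousAlternatingMap.smul_apply, wedge_cons_vertical _ _ hw, contact_vertical _ _ _ hw,
    smul_eq_mul]
  ring

theorem sum_coordY_vecY (A : Fin m → ℝ) (σ : Fin m) :
    ∑ ν, coordY t ν (0 : Fin n → ℕ) (vecY t σ 0) * A ν = A σ := by
  classical
  have : ∀ ν : Fin m, coordY t ν (0 : Fin n → ℕ) (vecY t σ 0) * A ν =
      if ν = σ then A ν else 0 := by
    intro ν
    rw [coordY_vecY ν σ (by simp) (by simp)]
    simp
  simp [this]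

theorem sourceForm_apply_basis (A : Fin m → ℝ) (z : JSpace n m t) (σ : Fin m) :
    sourceForm A z (Fin.cons (vecY t σ 0) fun i => vecX t i) = A σ := by
  rw [sourceForm_cons_vertical _ _ _ (vecY_fst t σ 0), sum_coordY_vecY]
  have : (Matrix.det (Matrix.of fun i j : Fin n => (vecX (m := m) t i).1 j)) = 1 := by
    rw [← det_vecX (n := n) (m := m) (t := t)]
    exact (Matrix.det_transpose _)
  rw [this, mul_one]

/-- `(n+1)`-forms that agree as soon as the first vector is vertical over the base agree. -/
theorem form_ext_of_vertical {η η' : JSpace n m t [⋀^Fin (n + 1)]→L[ℝ] ℝ}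
    (h : ∀ (w : JSpace n m t) (u : Fin n → JSpace n m t), w.1 = 0 →
      η (Fin.cons w u) = η' (Fin.cons w u)) : η = η' := by
  classical
  ext v
  -- The n + 1 base components in ℝⁿ satisfy a linear relation. Using it to replace `v k`, with `a k
  -- ≠ 0`, by a vertical vector multiplies the value of any form by `a k`, and a transposition moves
  -- that vector to the first place.
  have hdep : ¬ LinearIndependent ℝ fun i => (v i).1 := by
    intro hl
    have := hl.fintype_card_le_finrank
    simp at this
  rw [Fintype.not_linearIndependent_iff] at hdep
  obtain ⟨a, ha, k, hk⟩ := hdep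
  set w := ∑ i, a i • v i with hw
  have hw0 : w.1 = 0 := by
    rw [hw, Prod.fst_sum]
    exact ha
  have h0 : ∀ ζ : JSpace n m t [⋀^Fin (n + 1)]→L[ℝ] ℝ, ζ (Function.update v k w) = a k * ζ v := by
    intro ζ
    have h1 := ζ.toAlternatingMap.map_update_sum Finset.univ k (fun i => a i • v i) v
    have h2 : ∀ i, ζ.toAlternatingMap (Function.update v k (a i • v i)) =
        if i = k then a k * ζ v else 0 := by
      intro i
      rw [AlternatingMap.map_update_smul]
      by_cases hi : i = k
      · subst hi; simp
      · rw [if_neg hi, AlternatingMap.map_update_self _ _ (Ne.symm hi), smul_zero]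
    simp only [h2] at h1
    simpa using h1
  have h1 : ∀ ζ : JSpace n m t [⋀^Fin (n + 1)]→L[ℝ] ℝ, ζ (Function.update v k w) =
      Equiv.Perm.sign (Equiv.swap 0 k) • ζ (Fin.cons w
        (Fin.tail (Function.update v k w ∘ Equiv.swap 0 k))) := by
    intro ζ
    have h2 := ζ.toAlternatingMap.map_perm (Function.update v k w ∘ Equiv.swap 0 k) (Equiv.swap 0 k)
    have h3 : (Function.update v k w ∘ Equiv.swap 0 k) ∘ Equiv.swap 0 k =
        Function.update v k w := by
      funext i; simp
    have h4 : Function.update v k w ∘ Equiv.swap 0 k = Fin.cons w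
        (Fin.tail (Function.update v k w ∘ Equiv.swap 0 k)) := by
      conv_lhs => rw [← Fin.cons_self_tail (Function.update v k w ∘ Equiv.swap 0 k)]
      congr 1
      simp
    rw [h3] at h2
    rw [← h4]
    exact h2
  have h2 := (h0 η).symm.trans ((h1 η).trans ((congrArg _ (h w _ hw0)).trans
    ((h1 η').symm.trans (h0 η'))))
  exact mul_left_cancel₀ hk h2

theorem helmholtzForm_eq_zero {s : ℕ} {T : Fin m → JSpace n m s → ℝ} {z : JSpace n m t}
    (h : ∀ σ ν (α : MIdx n s), helmholtz s t T σ ν α z = 0) : helmholtzForm s t T z = 0 := by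
  simp [helmholtzForm, h]

/-- Both ω^ν ∧ ω^σ and ω^σ ∧ ω^ν contribute when α = 0. So the form determines the coefficients of
positive order, but of those of order zero only the part antisymmetric in σ, ν. -/
theorem helmholtzForm_apply {s : ℕ} (hst : s ≤ t) (T : Fin m → JSpace n m s → ℝ)
    (z : JSpace n m t) (σ ν : Fin m) (α : MIdx n s) :
    helmholtzForm s t T z (Fin.cons (vecY t ν α.1) (Fin.cons (vecY t σ 0) fun i => vecX t i)) =
      helmholtz s t T σ ν α z - if α.1 = 0 then helmholtz s t T ν σ α z else 0 := by
  classical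
  have hle : ∀ β : MIdx n s, ∑ i, β.1 i ≤ t := fun β => β.2.trans hst
  have h0 : ∑ i, (0 : Fin n → ℕ) i ≤ t := by simp
  have hterm : ∀ (β : MIdx n s) (σ' ν' : Fin m),
      (helmholtz s t T σ' ν' β z • wedge (Fin.cons (contact ν' β.1 z)
        (Fin.cons (contact σ' 0 z) (fun i : Fin n => coordX t i))))
        (Fin.cons (vecY t ν α.1) (Fin.cons (vecY t σ 0) fun i => vecX t i)) =
      (if β = α then if σ' = σ then if ν' = ν then helmholtz s t T σ' ν' β z else 0 else 0 else 0) -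
      (if β = α then if σ' = ν then if ν' = σ then
        (if α.1 = 0 then helmholtz s t T σ' ν' β z else 0) else 0 else 0 else 0) := by
    intro β σ' ν'
    rw [ContinuousAlternatingMap.smul_apply, wedge_cons_cons_vertical _ _ _ _ (vecY_fst t ν α.1)
      (vecY_fst t σ 0), contact_vertical _ _ _ (vecY_fst t ν α.1),
      contact_vertical _ _ _ (vecY_fst t σ 0), contact_vertical _ _ _ (vecY_fst t ν α.1),
      contact_vertical _ _ _ (vecY_fst t σ 0), coordY_vecY ν' ν (hle β) (hle α),
      coordY_vecY σ' σ h0 h0, coordY_vecY σ' ν h0 (hle α), coordY_vecY ν' σ (hle β) h0, smul_eq_mul,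
      mul_sub]
    congr 1
    · simp only [← Subtype.ext_iff]
      split_ifs <;> simp_all
    · by_cases h1 : σ' = ν <;> by_cases h2 : ν' = σ <;> by_cases h3 : β = α <;>
        by_cases h4 : α.1 = 0
      all_goals first
        | (subst h3; simp [h1, h2, h4, eq_comm])
        | (simp only [h1, h2, h4, eq_comm]; simp; done)
        | skip
      all_goals
        have h5 : ¬ (β.1 = 0 ∧ α.1 = 0) := fun h => h3 (Subtype.ext (h.1.trans h.2.symm))
        simp_all
  rw [helmholtzForm]
  simp only [ContinuousAlternatingMap.sum_apply, hterm, Finset.sum_sub_distrib]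
  rw [Finset.sum_eq_single α (by intro β _ hβ; simp [hβ]) (by simp),
    Finset.sum_eq_single α (by intro β _ hβ; simp [hβ]) (by simp)]
  simp

end Forms

/-! ## Components of differential equations -/

section Components

variable {n m : ℕ}
  {X : Type*} [TopologicalSpace X] [ChartedSpace (Fin n → ℝ) X]
  {Y : Type*} [TopologicalSpace Y] [ChartedSpace ((Fin n → ℝ) × (Fin m → ℝ)) Y]
  {π : Y → X} {s : ℕ} (T : DifferentialEquation n m π s)

namespace DifferentialEquation

theorem expr_cons_vertical (c : AdaptedChart n m π) {z : JSpace n m s} (hz : z ∈ c.jetDomain s)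
    (w : JSpace n m s) (hw : w.1 = 0) (v : Fin n → JSpace n m s) :
    T.expr c z (Fin.cons w v) = (∑ σ, coordY s σ 0 w * T.comp c σ z) *
      Matrix.det (Matrix.of fun i j => (v i).1 j) :=
  apply_cons_of_horizontal _ (T.horizontal c z hz) (T.vertical c z hz) w hw v

theorem contDiffOn_comp (c : AdaptedChart n m π) (σ : Fin m) :
    ContDiffOn ℝ ∞ (T.comp c σ) (jetsOver s c.chart.target) := by
  rw [← c.jetDomain_eq]
  have h := T.smooth c
  exact ((ContinuousAlternatingMap.apply ℝ (JSpace n m s) ℝ (ι := Fin (n + 1))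
    (Fin.cons (vecY s σ 0) (fun i : Fin n => vecX s i))).contDiff).comp_contDiffOn h

/-- By `form_ext_of_vertical` it suffices to take a first vector that is vertical over X, and on
such a vector ω^σ reduces to dy^σ. -/
theorem expr_compContinuousLinearMap (c : AdaptedChart n m π) {t : ℕ}
    {z : JSpace n m t} (hz : z ∈ c.jetDomain t) :
    (T.expr c (jproj t s z)).compContinuousLinearMap (jproj t s) =
      sourceForm (fun σ => T.comp c σ (jproj t s z)) z := by
  have hz' : jproj t s z ∈ c.jetDomain s := by
    rw [c.jetDomain_eq] at hz ⊢
    rw [jetsOver, Set.mem_preimage, targetPoint_jproj]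
    exact hz
  refine form_ext_of_vertical fun w u hw => ?_
  rw [sourceForm_cons_vertical _ _ _ hw]
  have h1 := T.expr_cons_vertical c hz' (jproj t s w) hw (fun i => jproj t s (u i))
  have h2 : (T.expr c (jproj t s z)).compContinuousLinearMap (jproj t s) (Fin.cons w u) =
      T.expr c (jproj t s z) (Fin.cons (jproj t s w) (fun i => jproj t s (u i))) := by
    rw [ContinuousAlternatingMap.compContinuousLinearMap_apply]
    congr 1
    funext i
    refine Fin.cases ?_ (fun i => ?_) i <;> simp
  rw [h2, h1]
  congr 1
  exact Finset.sum_congr rfl fun σ _ => by rw [coordY_jproj σ (by simp)]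

theorem eqEulerLagrange_iff {c : AdaptedChart n m π} {r : ℕ} (l : LocalLagrangeForm c r) :
    T.EqEulerLagrange l ↔ ∀ t : ℕ, s ≤ t → 2 * r ≤ t → ∀ z ∈ c.jetDomain t, ∀ σ,
      T.comp c σ (jproj t s z) = eulerLagrange r t σ l.density z := by
  refine forall_congr' fun t => forall_congr' fun h1 => forall_congr' fun h2 =>
    forall_congr' fun z => forall_congr' fun hz => ?_
  rw [T.expr_compContinuousLinearMap c hz, LocalLagrangeForm.eulerLagrangeForm]
  constructor
  · intro h σ
    have := DFunLike.congr_fun h (Fin.cons (vecY t σ 0) fun i => vecX t i)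
    rwa [sourceForm_apply_basis, sourceForm_apply_basis] at this
  · intro h
    congr 1
    funext σ
    exact h σ

/-- The transformation law of the components of a differential equation. -/
theorem comp_transform (c c' : AdaptedChart n m π) (ν : Fin m) {z : JSpace n m s}
    (hz : z ∈ jetsOver s (c.overlap c')) :
    T.comp c ν z = (∑ σ, (fderiv ℝ (c.transition c') (targetPoint s z) (0, Pi.single ν 1)).2 σ *
      T.comp c' σ (c.jetTrans c' s z)) * (fderiv ℝ (c.baseTransition c') z.1).det := by
  obtain ⟨j, hj, hj', rfl⟩ := c.exists_jet_of_mem c' hz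
  have h1 := T.compat c c' j hj hj'
  have h2 : T.comp c ν (c.jetCoord s j) = T.expr c' (c'.jetCoord s j)
      (Fin.cons (fderiv ℝ (c.jetTrans c' s) (c.jetCoord s j) (vecY s ν 0))
        (fun i => fderiv ℝ (c.jetTrans c' s) (c.jetCoord s j) (vecX s i))) := by
    rw [comp, h1, ContinuousAlternatingMap.compContinuousLinearMap_apply,
      c.fderiv_jetTransition c' hz]
    congr 1
    funext i
    refine Fin.cases ?_ (fun i => ?_) i <;> simp
  have htX : ∀ i : Fin n, targetPoint s (vecX (m := m) s i) = (unitVec i, 0) := by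
    intro i
    refine Prod.ext rfl ?_
    funext σ
    exact coordY_vecX s σ 0 i
  have htY : targetPoint s (vecY (n := n) s ν 0) = (0, Pi.single ν 1) := by
    refine Prod.ext (vecY_fst s ν 0) ?_
    funext σ
    change coordY s σ (0 : Fin n → ℕ) (vecY s ν 0) = _
    classical
    rw [coordY_vecY σ ν (by simp) (by simp)]
    simp [Pi.single_apply]
  have hfst : ∀ v, (fderiv ℝ (c.jetTrans c' s) (c.jetCoord s j) v).1 =
      fderiv ℝ (c.baseTransition c') (c.jetCoord s j).1 (targetPoint s v).1 := by
    intro v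
    rw [← targetPoint_fst, c.targetPoint_fderiv_jetTrans c' hz, c.fderiv_transition_fst c' hz]
    rfl
  have hcY : ∀ σ v, coordY s σ 0 (fderiv ℝ (c.jetTrans c' s) (c.jetCoord s j) v) =
      (fderiv ℝ (c.transition c') (targetPoint s (c.jetCoord s j)) (targetPoint s v)).2 σ := by
    intro σ v
    rw [← c.targetPoint_fderiv_jetTrans c' hz]
    rfl
  have hdom : c'.jetCoord s j ∈ c'.jetDomain s := ⟨j, hj', rfl⟩
  -- The image of ∂/∂y^ν is again vertical over X, so the images of the ∂/∂x^i matter only through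
  -- their base components, which form the Jacobian matrix.
  rw [h2, T.expr_cons_vertical c' hdom _ (by rw [hfst, htY]; simp)]
  congr 1
  · refine Finset.sum_congr rfl fun σ _ => ?_
    rw [hcY, htY, c.jetCoord_eq_jetTrans c' hj hj']
  · simp only [hfst, htX]
    have := (Pi.basisFun ℝ (Fin n)).det_comp
      (fderiv ℝ (c.baseTransition c') (c.jetCoord s j).1 : (Fin n → ℝ) →ₗ[ℝ] (Fin n → ℝ))
      (Pi.basisFun ℝ (Fin n))
    rw [Module.Basis.det_self, mul_one, Pi.basisFun_det_apply] at this
    rw [ContinuousLinearMap.det, ← this]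
    congr 1
    funext i j
    simp [unitVec]

end DifferentialEquation

end Components

/-! ## The first variation -/

section FirstVariation

open MeasureTheory

variable {n m : ℕ} {P : Type*} [NormedAddCommGroup P] [NormedSpace ℝ P]

theorem dirDeriv_left {V : Type*} [NormedAddCommGroup V] [NormedSpace ℝ V] {f : P × V → ℝ} {a : P}
    {u : V} (hf : DifferentiableAt ℝ f (a, u)) (p : P) :
    dirDeriv (p, (0 : V)) f (a, u) = dirDeriv p (fun b => f (b, u)) a := by
  have h := HasFDerivAt.comp (f := fun b : P => (b, u)) a hf.hasFDerivAt
    (hasFDerivAt_prodMk_left a u)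
  have h2 : fderiv ℝ (fun b => f (b, u)) a = _ := h.fderiv
  simp [dirDeriv, h2]

theorem hasDerivAt_line {V : Type*} [NormedAddCommGroup V] [NormedSpace ℝ V] {f : P × V → ℝ} {p : P}
    {u : V} {τ : ℝ} (hf : DifferentiableAt ℝ f (τ • p, u)) :
    HasDerivAt (fun τ : ℝ => f (τ • p, u)) (dirDeriv (p, (0 : V)) f (τ • p, u)) τ := by
  have h1 : HasDerivAt (fun τ : ℝ => ((τ • p, u) : P × V)) (p, 0) τ := by
    have := ((hasDerivAt_id τ).smul_const p).prodMk (hasDerivAt_const τ u)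
    simpa using this
  exact hf.hasFDerivAt.comp_hasDerivAt τ h1

variable {Ω : Set (P × (Fin n → ℝ))} {W : Set ((Fin n → ℝ) × (Fin m → ℝ))}

/-- The derivative of a function of the jets of a family of functions with respect to the
parameter. -/
theorem dirDeriv_comp_prolong_param (hΩ : IsOpen Ω) {G : P × (Fin n → ℝ) → Fin m → ℝ}
    (hG : ContDiffOn ℝ ∞ G Ω) (hW : IsOpen W) (hGW : ∀ q ∈ Ω, (q.2, G q) ∈ W) {r : ℕ}
    {L : JSpace n m r → ℝ} (hL : ContDiffOn ℝ ∞ L (jetsOver r W)) (p : P) {a : P} {u : Fin n → ℝ}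
    (hu : (a, u) ∈ Ω) :
    dirDeriv (p, (0 : Fin n → ℝ))
      (fun q : P × (Fin n → ℝ) => L (prolong r (fun v => G (q.1, v)) q.2)) (a, u) =
      ∑ σ, ∑ β : MIdx n r, partialY σ β.1 L (prolong r (fun v => G (a, v)) u) *
        mderiv β.1 (fun v => dirDeriv (p, (0 : Fin n → ℝ)) (fun q => G q σ) (a, v)) u := by
  have hz : prolong r (fun v => G (a, v)) u ∈ jetsOver r W := by
    rw [jetsOver, Set.mem_preimage, targetPoint_prolong]
    exact hGW _ hu
  have hLd := hL.differentiableAt_of_isOpen (isOpen_jetsOver r hW) hz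
  have hΦ : DifferentiableAt ℝ
      (fun q : P × (Fin n → ℝ) => prolong r (fun v => G (q.1, v)) q.2) (a, u) :=
    ((contDiffOn_prolong_param hΩ hG r).contDiffAt (hΩ.mem_nhds hu)).differentiableAt (by simp)
  have hc := hLd.hasFDerivAt.comp (a, u) hΦ.hasFDerivAt
  have hc2 : fderiv ℝ (fun q : P × (Fin n → ℝ) => L (prolong r (fun v => G (q.1, v)) q.2)) (a, u) =
    _ := hc.fderiv
  have hv : fderiv ℝ (fun q : P × (Fin n → ℝ) => prolong r (fun v => G (q.1, v)) q.2) (a, u) (p, 0) =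
      ((0, fun σ β => mderiv β.1
        (fun v => dirDeriv (p, (0 : Fin n → ℝ)) (fun q => G q σ) (a, v)) u) : JSpace n m r) := by
    refine Prod.ext ?_ ?_
    · exact DFunLike.congr_fun (hΦ.hasFDerivAt.fst.unique hasFDerivAt_snd) (p, 0)
    · funext σ β
      have h1 := (hasFDerivAt_pi'.1 (hasFDerivAt_pi'.1 hΦ.hasFDerivAt.snd σ) β).fderiv
      have h2 := dirDeriv_param_mderiv hΩ (G := fun q => G q σ) (contDiffOn_pi.1 hG σ) β.1 p hu
      simp only
      rw [← h2, dirDeriv]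
      change _ = fderiv ℝ (fun q : P × (Fin n → ℝ) =>
        (prolong r (fun v => G (q.1, v)) q.2).2 σ β) (a, u) (p, 0)
      rw [h1]
      rfl
  rw [dirDeriv, hc2, ContinuousLinearMap.comp_apply, hv, jspace_vertical_eq_sum, map_sum]
  refine Finset.sum_congr rfl fun σ _ => ?_
  rw [map_sum]
  refine Finset.sum_congr rfl fun β _ => ?_
  rw [map_smul, smul_eq_mul, mul_comm]
  rfl

/-- The first variation formula: the variation field is a test function, so its derivatives move to
∂L/∂y^σ_β by integration by parts, without boundary terms. -/
theorem integral_dirDeriv_comp_prolong (hΩ : IsOpen Ω) {G : P × (Fin n → ℝ) → Fin m → ℝ}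
    (hG : ContDiffOn ℝ ∞ G Ω) (hW : IsOpen W) (hGW : ∀ q ∈ Ω, (q.2, G q) ∈ W) {r : ℕ}
    {L : JSpace n m r → ℝ} (hL : ContDiffOn ℝ ∞ L (jetsOver r W)) (p : P) {a : P}
    {V K : Set (Fin n → ℝ)} (hV : IsOpen V) (hK : IsCompact K) (hKV : K ⊆ V)
    (haV : ∀ u ∈ V, (a, u) ∈ Ω)
    (htest : ∀ σ, IsTest V K (fun v => dirDeriv (p, (0 : Fin n → ℝ)) (fun q => G q σ) (a, v))) :
    ∫ u in V, dirDeriv (p, (0 : Fin n → ℝ))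
      (fun q : P × (Fin n → ℝ) => L (prolong r (fun v => G (q.1, v)) q.2)) (a, u) =
    ∫ u in V, ∑ σ, (∑ β : MIdx n r, (-1 : ℝ) ^ (∑ i, β.1 i) *
        mderiv β.1 (fun v => partialY σ β.1 L (prolong r (fun v => G (a, v)) v)) u) *
      dirDeriv (p, (0 : Fin n → ℝ)) (fun q => G q σ) (a, u) := by
  have hg : ContDiffOn ℝ ∞ (fun v => G (a, v)) V :=
    hG.comp (contDiff_const.prodMk contDiff_id).contDiffOn haV
  have hP : ∀ σ (β : Fin n → ℕ),
      ContDiffOn ℝ ∞ (fun v => partialY σ β L (prolong r (fun v => G (a, v)) v)) V := fun σ β =>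
    (contDiffOn_dirDeriv (isOpen_jetsOver r hW) hL _).comp (contDiffOn_prolong hV hg r)
      fun u hu => prolong_mem_jetsOver (U := V) (fun v hv => hGW _ (haV v hv)) r hu
  have h1 := fun (σ : Fin m) (β : MIdx n r) =>
    (((htest σ).mderiv hV hK β.1).mul_left (hP σ β.1)).integrableOn hV hK hKV
  have h2 := fun (σ : Fin m) (β : MIdx n r) =>
    ((htest σ).mul_left (contDiffOn_mderiv hV (hP σ β.1) β.1)).integrableOn hV hK hKV
  rw [setIntegral_congr_fun hV.measurableSet fun u hu =>
    dirDeriv_comp_prolong_param hΩ hG hW hGW hL p (haV u hu)]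
  rw [integral_finsetSum _ fun σ _ => integrable_finsetSum _ fun β _ => h1 σ β]
  simp only [Finset.sum_mul]
  have h3 := fun (σ : Fin m) (β : MIdx n r) => (h2 σ β).const_mul ((-1 : ℝ) ^ (∑ i, β.1 i))
  simp only [← mul_assoc] at h3
  rw [integral_finsetSum _ fun σ _ => integrable_finsetSum _ fun β _ => h3 σ β]
  refine Finset.sum_congr rfl fun σ _ => ?_
  rw [integral_finsetSum _ fun β _ => h1 σ β, integral_finsetSum _ fun β _ => h3 σ β]
  refine Finset.sum_congr rfl fun β _ => ?_
  rw [(htest σ).integral_mul_mderiv hV hK hKV (hP σ β.1) β.1, ← integral_const_mul]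
  simp only [mul_assoc]

/-- If integrals depending on parameters vanish, so do the integrals of the derivatives. -/
theorem integral_dirDeriv_param_eq_zero {B : Set P} (hB : IsOpen B) (h0 : (0 : P) ∈ B)
    {V K : Set (Fin n → ℝ)} (hV : IsOpen V) (hK : IsCompact K) (hKV : K ⊆ V)
    {g : P × (Fin n → ℝ) → ℝ} (hg : ContDiffOn ℝ ∞ g (B ×ˢ V))
    (hz : ∀ a ∈ B, ∀ u ∈ V, u ∉ K → g (a, u) = 0)
    (hint : ∀ a ∈ B, ∫ u in V, g (a, u) = 0) (p : P) :
    ∫ u in V, dirDeriv (p, (0 : Fin n → ℝ)) g (0, u) = 0 := by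
  have hO : IsOpen (B ×ˢ V) := hB.prod hV
  have hline : Continuous fun τ : ℝ => τ • p := continuous_id.smul continuous_const
  -- Only a compact interval of the line through 0 in the direction `p` is needed. On its product
  -- with `K` the derivative is bounded, and off `K` it vanishes, which gives the dominating
  -- function.
  obtain ⟨δ, hδ, hδB⟩ := Metric.nhds_basis_closedBall.mem_iff.1
    ((hB.preimage hline).mem_nhds (by simpa using h0 : (0 : ℝ) ∈ _))
  have hmem : ∀ τ ∈ Metric.closedBall (0 : ℝ) δ, τ • p ∈ B := fun τ hτ => hδB hτ
  set F' : ℝ → (Fin n → ℝ) → ℝ := fun τ u => dirDeriv (p, (0 : Fin n → ℝ)) g (τ • p, u) with hF'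
  have hd := contDiffOn_dirDeriv hO hg (p, (0 : Fin n → ℝ))
  have hF'0 : ∀ τ ∈ Metric.closedBall (0 : ℝ) δ, ∀ u ∈ V, u ∉ K → F' τ u = 0 := by
    intro τ hτ u hu hk
    have he : Set.EqOn g (fun _ => 0) (B ×ˢ (V ∩ Kᶜ)) := fun q hq => hz q.1 hq.1 q.2 hq.2.1 hq.2.2
    have := dirDeriv_congr (hB.prod (hV.inter hK.isClosed.isOpen_compl)) he (p, (0 : Fin n → ℝ))
      (x := (τ • p, u)) ⟨hmem τ hτ, hu, hk⟩
    simpa [dirDeriv, hF'] using this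
  have hcont : ContinuousOn (fun q : ℝ × (Fin n → ℝ) => F' q.1 q.2)
      (Metric.closedBall (0 : ℝ) δ ×ˢ K) :=
    hd.continuousOn.comp ((hline.comp continuous_fst).prodMk continuous_snd).continuousOn
      fun q hq => ⟨hmem q.1 hq.1, hKV hq.2⟩
  obtain ⟨C, hC⟩ := ((isCompact_closedBall (0 : ℝ) δ).prod hK).exists_bound_of_continuousOn hcont
  have hslice : ∀ τ ∈ Metric.closedBall (0 : ℝ) δ, ContinuousOn (fun u => g (τ • p, u)) V :=
    fun τ hτ => hg.continuousOn.comp (continuous_const.prodMk continuous_id).continuousOn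
      fun u hu => ⟨hmem τ hτ, hu⟩
  have h00 : (0 : ℝ) ∈ Metric.closedBall (0 : ℝ) δ := by simp [hδ.le]
  have key := hasDerivAt_integral_of_dominated_loc_of_deriv_le (μ := volume.restrict V)
    (F := fun (τ : ℝ) u => g (τ • p, u)) (F' := F') (x₀ := (0 : ℝ)) (bound := K.indicator fun _ => C)
    (Metric.closedBall_mem_nhds (0 : ℝ) hδ)
    (by
      filter_upwards [Metric.closedBall_mem_nhds (0 : ℝ) hδ] with τ hτ
      exact (hslice τ hτ).aestronglyMeasurable hV.measurableSet)
    (by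
      refine IsTest.integrableOn (K := K) ⟨?_, fun u hu hk => hz _ (hmem 0 h00) u hu hk⟩ hV hK hKV
      exact hg.comp (contDiff_const.prodMk contDiff_id).contDiffOn fun u hu => ⟨hmem 0 h00, hu⟩)
    (by
      refine ContinuousOn.aestronglyMeasurable ?_ hV.measurableSet
      exact hd.continuousOn.comp (continuous_const.prodMk continuous_id).continuousOn
        fun u hu => ⟨hmem 0 h00, hu⟩)
    (by
      refine (ae_restrict_iff' hV.measurableSet).2 (Filter.Eventually.of_forall fun u hu τ hτ => ?_)
      by_cases hk : u ∈ K
      · rw [Set.indicator_of_mem hk]; exact hC (τ, u) ⟨hτ, hk⟩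
      · rw [Set.indicator_of_notMem hk, hF'0 τ hτ u hu hk, norm_zero])
    (by
      refine Integrable.restrict ?_
      rw [integrable_indicator_iff hK.measurableSet]
      exact integrableOn_const hK.measure_lt_top.ne)
    (by
      refine (ae_restrict_iff' hV.measurableSet).2 (Filter.Eventually.of_forall fun u hu τ hτ => ?_)
      exact hasDerivAt_line (hg.differentiableAt_of_isOpen hO ⟨hmem τ hτ, hu⟩))
  have hzero : (fun τ : ℝ => ∫ u in V, g (τ • p, u)) =ᶠ[𝓝 0] fun _ => 0 := by
    filter_upwards [Metric.closedBall_mem_nhds (0 : ℝ) hδ] with τ hτ using hint _ (hmem τ hτ)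
  have := (key.2.congr_of_eventuallyEq hzero.symm).unique (hasDerivAt_const (0 : ℝ) (0 : ℝ))
  simpa [hF'] using this

end FirstVariation

/-! ## Symmetry of the linearization of a variational source form -/

section Symmetry

open MeasureTheory

variable {n m s : ℕ} {P : Type*} [NormedAddCommGroup P] [NormedSpace ℝ P]

/-- The contraction of the source form with components `S` with the vector field of a family of
functions `G` that corresponds to the direction `p` of the parameter space. -/
def sourcePairing (S : Fin m → JSpace n m s → ℝ) (G : P × (Fin n → ℝ) → Fin m → ℝ) (p : P)
    (q : P × (Fin n → ℝ)) : ℝ :=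
  ∑ σ, S σ (prolong s (fun v => G (q.1, v)) q.2) *
    dirDeriv (p, (0 : Fin n → ℝ)) (fun q' => G q' σ) q

theorem contDiffOn_comp_prolong_param {Ω : Set (P × (Fin n → ℝ))}
    {W : Set ((Fin n → ℝ) × (Fin m → ℝ))} (hΩ : IsOpen Ω) {G : P × (Fin n → ℝ) → Fin m → ℝ}
    (hG : ContDiffOn ℝ ∞ G Ω) (hGW : ∀ q ∈ Ω, (q.2, G q) ∈ W) {r : ℕ} {L : JSpace n m r → ℝ}
    (hL : ContDiffOn ℝ ∞ L (jetsOver r W)) :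
    ContDiffOn ℝ ∞ (fun q : P × (Fin n → ℝ) => L (prolong r (fun v => G (q.1, v)) q.2)) Ω := by
  refine hL.comp (contDiffOn_prolong_param hΩ hG r) fun q hq => ?_
  rw [jetsOver, Set.mem_preimage, targetPoint_prolong]
  exact hGW q hq

theorem contDiffOn_sourcePairing {Ω : Set (P × (Fin n → ℝ))}
    {W : Set ((Fin n → ℝ) × (Fin m → ℝ))} (hΩ : IsOpen Ω) {G : P × (Fin n → ℝ) → Fin m → ℝ}
    (hG : ContDiffOn ℝ ∞ G Ω) (hGW : ∀ q ∈ Ω, (q.2, G q) ∈ W) {S : Fin m → JSpace n m s → ℝ}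
    (hS : ∀ σ, ContDiffOn ℝ ∞ (S σ) (jetsOver s W)) (p : P) :
    ContDiffOn ℝ ∞ (sourcePairing S G p) Ω :=
  ContDiffOn.sum fun σ _ => (contDiffOn_comp_prolong_param hΩ hG hGW (hS σ)).mul
    (contDiffOn_dirDeriv hΩ (contDiffOn_pi.1 hG σ) _)

theorem isTest_dirDeriv_param {B : Set P} (hB : IsOpen B) {a₀ : P}
    {V K : Set (Fin n → ℝ)} (hV : IsOpen V)
    {k : P × (Fin n → ℝ) → ℝ} (hk : ContDiffOn ℝ ∞ k (B ×ˢ V))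
    (hconst : ∀ a ∈ B, ∀ v ∈ V, v ∉ K → k (a, v) = k (a₀, v)) (p : P) {a : P} (ha : a ∈ B) :
    IsTest V K (fun v => dirDeriv (p, (0 : Fin n → ℝ)) k (a, v)) := by
  refine ⟨(contDiffOn_dirDeriv (hB.prod hV) hk _).comp
    (contDiff_const.prodMk contDiff_id).contDiffOn fun v hv => ⟨ha, hv⟩, fun v hv hvK => ?_⟩
  rw [dirDeriv_left (hk.differentiableAt_of_isOpen (hB.prod hV) ⟨ha, hv⟩),
    dirDeriv_congr hB (fun b hb => hconst b hb v hv hvK) p ha]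
  simp [dirDeriv]

/-- Let f be L along the family. By the first variation formula, the difference `k p` of ∂_p f and
the source pairing in the direction p has integral zero for all parameters, hence so has ∂_q (k p).
In ∂_p (k q) - ∂_q (k p) the second derivatives of f cancel, and only source pairings are left. -/
theorem integral_dirDeriv_sourcePairing_symm {B : Set P} (hB : IsOpen B) (h0 : (0 : P) ∈ B)
    {V K : Set (Fin n → ℝ)} (hV : IsOpen V) (hK : IsCompact K) (hKV : K ⊆ V)
    {W : Set ((Fin n → ℝ) × (Fin m → ℝ))} (hW : IsOpen W) {G : P × (Fin n → ℝ) → Fin m → ℝ}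
    (hG : ContDiffOn ℝ ∞ G (B ×ˢ V)) (hGW : ∀ q ∈ B ×ˢ V, (q.2, G q) ∈ W)
    (hconst : ∀ a ∈ B, ∀ v ∈ V, v ∉ K → G (a, v) = G (0, v))
    {S : Fin m → JSpace n m s → ℝ} (hS : ∀ σ, ContDiffOn ℝ ∞ (S σ) (jetsOver s W))
    {r : ℕ} {L : JSpace n m r → ℝ} (hL : ContDiffOn ℝ ∞ L (jetsOver r W))
    (hEL : ∀ g : (Fin n → ℝ) → Fin m → ℝ, ContDiffOn ℝ ∞ g V → (∀ v ∈ V, (v, g v) ∈ W) →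
      ∀ v ∈ V, ∀ σ, S σ (prolong s g v) = ∑ β : MIdx n r, (-1 : ℝ) ^ (∑ i, β.1 i) *
        mderiv β.1 (fun v => partialY σ β.1 L (prolong r g v)) v) (p q : P) :
    ∫ v in V, (dirDeriv (q, (0 : Fin n → ℝ)) (sourcePairing S G p) (0, v) -
      dirDeriv (p, (0 : Fin n → ℝ)) (sourcePairing S G q) (0, v)) = 0 := by
  have hΩ : IsOpen (B ×ˢ V) := hB.prod hV
  set f : P × (Fin n → ℝ) → ℝ := fun q => L (prolong r (fun v => G (q.1, v)) q.2) with hf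
  have hfs : ContDiffOn ℝ ∞ f (B ×ˢ V) := contDiffOn_comp_prolong_param hΩ hG hGW hL
  have htest : ∀ p : P, ∀ a ∈ B, ∀ σ,
      IsTest V K (fun v => dirDeriv (p, (0 : Fin n → ℝ)) (fun q => G q σ) (a, v)) :=
    fun p a ha σ => isTest_dirDeriv_param hB hV (contDiffOn_pi.1 hG σ)
      (fun b hb v hv hvK => by rw [hconst b hb v hv hvK]) p ha
  have hslice : ∀ a ∈ B, ContDiffOn ℝ ∞ (fun v => G (a, v)) V := fun a ha =>
    hG.comp (contDiff_const.prodMk contDiff_id).contDiffOn fun u hu => ⟨ha, hu⟩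
  set k : P → P × (Fin n → ℝ) → ℝ := fun p q =>
    dirDeriv (p, (0 : Fin n → ℝ)) f q - sourcePairing S G p q with hkdef
  have hfd := fun p : P => contDiffOn_dirDeriv hΩ hfs (p, (0 : Fin n → ℝ))
  have hsp := fun p : P => contDiffOn_sourcePairing hΩ hG hGW hS p
  have hks : ∀ p, ContDiffOn ℝ ∞ (k p) (B ×ˢ V) := fun p => (hfd p).sub (hsp p)
  have hf0 : ∀ p : P, ∀ a ∈ B, ∀ v ∈ V, v ∉ K → dirDeriv (p, (0 : Fin n → ℝ)) f (a, v) = 0 := by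
    intro p a ha v hv hvK
    rw [dirDeriv_comp_prolong_param hΩ hG hW hGW hL p ⟨ha, hv⟩]
    refine Finset.sum_eq_zero fun σ _ => Finset.sum_eq_zero fun β _ => ?_
    rw [((htest p a ha σ).mderiv hV hK β.1).eq_zero v hv hvK, mul_zero]
  have hs0 : ∀ p : P, ∀ a ∈ B, ∀ v ∈ V, v ∉ K → sourcePairing S G p (a, v) = 0 := by
    intro p a ha v hv hvK
    refine Finset.sum_eq_zero fun σ _ => ?_
    rw [(htest p a ha σ).eq_zero v hv hvK, mul_zero]
  have hk0 : ∀ p : P, ∀ a ∈ B, ∀ v ∈ V, v ∉ K → k p (a, v) = 0 := by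
    intro p a ha v hv hvK
    simp only [hkdef, hf0 p a ha v hv hvK, hs0 p a ha v hv hvK, sub_zero]
  have hslice2 : ∀ {h : P × (Fin n → ℝ) → ℝ}, ContDiffOn ℝ ∞ h (B ×ˢ V) → ∀ a ∈ B,
      ContDiffOn ℝ ∞ (fun v => h (a, v)) V := fun hh a ha =>
    hh.comp (contDiff_const.prodMk contDiff_id).contDiffOn fun u hu => ⟨ha, hu⟩
  have hkint : ∀ p : P, ∀ a ∈ B, ∫ v in V, k p (a, v) = 0 := by
    intro p a ha
    have i1 : IntegrableOn (fun v => dirDeriv (p, (0 : Fin n → ℝ)) f (a, v)) V :=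
      (IsTest.mk (hslice2 (hfd p) a ha) (hf0 p a ha)).integrableOn hV hK hKV
    have i2 : IntegrableOn (fun v => sourcePairing S G p (a, v)) V :=
      (IsTest.mk (hslice2 (hsp p) a ha) (hs0 p a ha)).integrableOn hV hK hKV
    simp only [hkdef]
    rw [integral_sub i1 i2, integral_dirDeriv_comp_prolong hΩ hG hW hGW hL p hV hK hKV
      (fun u hu => ⟨ha, hu⟩) (htest p a ha), sub_eq_zero]
    refine setIntegral_congr_fun hV.measurableSet fun v hv => ?_
    refine Finset.sum_congr rfl fun σ _ => ?_
    simp only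
    rw [hEL (fun v => G (a, v)) (hslice a ha) (fun v hv => hGW (a, v) ⟨ha, hv⟩) v hv σ]
  have e1 := integral_dirDeriv_param_eq_zero hB h0 hV hK hKV (hks p) (hk0 p) (hkint p) q
  have e2 := integral_dirDeriv_param_eq_zero hB h0 hV hK hKV (hks q) (hk0 q) (hkint q) p
  have i3 : ∀ p q : P, IntegrableOn (fun v => dirDeriv (q, (0 : Fin n → ℝ)) (k p) (0, v)) V :=
    fun p q => (isTest_dirDeriv_param hB (a₀ := 0) hV (hks p) (fun a ha v hv hvK => by
      rw [hk0 p a ha v hv hvK, hk0 p 0 h0 v hv hvK]) q h0).integrableOn hV hK hKV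
  have e3 : ∫ v in V, (dirDeriv (p, (0 : Fin n → ℝ)) (k q) (0, v) -
      dirDeriv (q, (0 : Fin n → ℝ)) (k p) (0, v)) = 0 := by
    rw [integral_sub (i3 q p) (i3 p q), e1, e2, sub_zero]
  rw [← e3]
  refine setIntegral_congr_fun hV.measurableSet fun v hv => ?_
  have hmem : ((0 : P), v) ∈ B ×ˢ V := ⟨h0, hv⟩
  have hd : ∀ p q : P, dirDeriv (q, (0 : Fin n → ℝ)) (k p) (0, v) =
      dirDeriv (q, (0 : Fin n → ℝ)) (dirDeriv (p, (0 : Fin n → ℝ)) f) (0, v) -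
        dirDeriv (q, (0 : Fin n → ℝ)) (sourcePairing S G p) (0, v) := by
    intro p q
    have := fderiv_fun_sub ((hfd p).differentiableAt_of_isOpen hΩ hmem)
      ((hsp p).differentiableAt_of_isOpen hΩ hmem)
    simp only [hkdef, dirDeriv] at this ⊢
    rw [this]
    rfl
  simp only [hd]
  rw [dirDeriv_comm hΩ hfs (p, (0 : Fin n → ℝ)) (q, (0 : Fin n → ℝ)) hmem]
  ring

end Symmetry

/-! ## Families of sections in two charts -/

section Families

open MeasureTheory

variable {n m s : ℕ}
  {X : Type*} [TopologicalSpace X] [ChartedSpace (Fin n → ℝ) X]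
  {Y : Type*} [TopologicalSpace Y] [ChartedSpace ((Fin n → ℝ) × (Fin m → ℝ)) Y]
  {π : Y → X} {P : Type*} [NormedAddCommGroup P] [NormedSpace ℝ P]

namespace AdaptedChart

variable (d c : AdaptedChart n m π) {B : Set P} {U : Set (Fin n → ℝ)}
  {G : P × (Fin n → ℝ) → Fin m → ℝ}

/-- The expression in the chart `c` of a family of sections with the expressions `G` in the
chart `d`. -/
def transformFamily {P : Type*} (G : P × (Fin n → ℝ) → Fin m → ℝ) (q : P × (Fin n → ℝ)) : Fin m → ℝ :=
  d.transform c (fun v => G (q.1, v)) q.2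

theorem contDiffOn_transformFamily (hG : ContDiffOn ℝ ∞ G (B ×ˢ U))
    (hGW : ∀ q ∈ B ×ˢ U, (q.2, G q) ∈ d.overlap c) :
    ContDiffOn ℝ ∞ (d.transformFamily c G) (B ×ˢ d.transformDomain c U) := by
  have h1 : ContDiffOn ℝ ∞ (fun q : P × (Fin n → ℝ) => c.baseTransition d q.2)
      (B ×ˢ d.transformDomain c U) :=
    (c.contDiffOn_baseTransition d).comp contDiff_snd.contDiffOn fun q hq => hq.2.1
  have h2 : ContDiffOn ℝ ∞ (fun q : P × (Fin n → ℝ) => G (q.1, c.baseTransition d q.2))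
      (B ×ˢ d.transformDomain c U) :=
    hG.comp (contDiff_fst.contDiffOn.prodMk h1) fun q hq => ⟨hq.1, hq.2.2⟩
  exact contDiff_snd.comp_contDiffOn ((d.contDiffOn_transition c).comp
    (h1.prodMk h2) fun q hq => hGW (q.1, c.baseTransition d q.2) ⟨hq.1, hq.2.2⟩)

theorem transformFamily_mem {P : Type*} {B : Set P} {G : P × (Fin n → ℝ) → Fin m → ℝ}
    (hGW : ∀ q ∈ B ×ˢ U, (q.2, G q) ∈ d.overlap c)
    {q : P × (Fin n → ℝ)} (hq : q ∈ B ×ˢ d.transformDomain c U) :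
    (q.2, d.transformFamily c G q) ∈ c.overlap d :=
  d.transform_mem c (g := fun v => G (q.1, v)) (fun u hu => hGW (q.1, u) ⟨hq.1, hu⟩) hq.2

/-- The base point does not move with the parameter, so a variation is carried over by the vertical
part of the differential of the coordinate change. -/
theorem dirDeriv_transformFamily (hB : IsOpen B) (hU : IsOpen U) (hG : ContDiffOn ℝ ∞ G (B ×ˢ U))
    (hGW : ∀ q ∈ B ×ˢ U, (q.2, G q) ∈ d.overlap c) (p : P) {a : P} (ha : a ∈ B)
    {v : Fin n → ℝ} (hv : v ∈ d.transformDomain c U) (σ : Fin m) :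
    dirDeriv (p, (0 : Fin n → ℝ)) (fun q => d.transformFamily c G q σ) (a, v) =
      (fderiv ℝ (d.transition c) (c.baseTransition d v, G (a, c.baseTransition d v))
        (0, fun ν => dirDeriv (p, (0 : Fin n → ℝ)) (fun q => G q ν)
          (a, c.baseTransition d v))).2 σ := by
  have hV := d.isOpen_transformDomain c hU
  have hu := hv.2
  have hmem : ((a, c.baseTransition d v) : P × (Fin n → ℝ)) ∈ B ×ˢ U := ⟨ha, hu⟩
  have hΓ := contDiffOn_pi.1 (d.contDiffOn_transformFamily c hG hGW) σ
  rw [dirDeriv_left (hΓ.differentiableAt_of_isOpen (hB.prod hV) ⟨ha, hv⟩)]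
  have hGd : DifferentiableAt ℝ G (a, c.baseTransition d v) :=
    (hG.contDiffAt ((hB.prod hU).mem_nhds hmem)).differentiableAt (by simp)
  have hslice : HasFDerivAt (fun b => G (b, c.baseTransition d v)) _ a :=
    HasFDerivAt.comp (f := fun b : P => (b, c.baseTransition d v)) a hGd.hasFDerivAt
      (hasFDerivAt_prodMk_left a _)
  have htr : DifferentiableAt ℝ (d.transition c)
      (c.baseTransition d v, G (a, c.baseTransition d v)) :=
    ((d.contDiffOn_transition c).contDiffAt ((d.isOpen_overlap c).mem_nhds
      (hGW _ hmem))).differentiableAt (by simp)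
  have hcomp := HasFDerivAt.comp (f := fun b : P => (c.baseTransition d v,
    G (b, c.baseTransition d v))) a htr.hasFDerivAt ((hasFDerivAt_const _ a).prodMk hslice)
  have h1 := (hasFDerivAt_pi'.1 hcomp.snd σ).fderiv
  change fderiv ℝ (fun b => (d.transition c (c.baseTransition d v,
    G (b, c.baseTransition d v))).2 σ) a p = _
  rw [show fderiv ℝ (fun b => (d.transition c (c.baseTransition d v,
    G (b, c.baseTransition d v))).2 σ) a = _ from h1]
  have h2 : (fun ν => dirDeriv (p, (0 : Fin n → ℝ)) (fun q => G q ν) (a, c.baseTransition d v)) =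
      fderiv ℝ G (a, c.baseTransition d v) (p, 0) := by
    funext ν
    rw [dirDeriv, (hasFDerivAt_pi'.1 hGd.hasFDerivAt ν).fderiv]
    rfl
  rw [h2]
  simp

/-- Contracting T with a variation gives an n-form on the base. The factors ∂y'^σ/∂y^ν in the law
for T_ν are the ones in the law for variations, so only the Jacobian of the base coordinates
remains. No transformation law for Euler-Lagrange expressions is then needed. -/
theorem sourcePairing_transform (T : DifferentialEquation n m π s) (hB : IsOpen B) (hU : IsOpen U)
    (hG : ContDiffOn ℝ ∞ G (B ×ˢ U)) (hGW : ∀ q ∈ B ×ˢ U, (q.2, G q) ∈ d.overlap c) (p : P)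
    {a : P} (ha : a ∈ B) {u : Fin n → ℝ} (hu : u ∈ U) :
    sourcePairing (T.comp d) G p (a, u) =
      sourcePairing (T.comp c) (d.transformFamily c G) p (a, d.baseTransition c u) *
        (fderiv ℝ (d.baseTransition c) u).det := by
  have hgW : ∀ v ∈ U, (v, G (a, v)) ∈ d.overlap c := fun v hv => hGW (a, v) ⟨ha, hv⟩
  have hg : ContDiffOn ℝ ∞ (fun v => G (a, v)) U :=
    hG.comp (contDiff_const.prodMk contDiff_id).contDiffOn fun u hu => ⟨ha, hu⟩
  have hv := d.baseTransition_mem_transformDomain c hgW hu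
  have hback : c.baseTransition d (d.baseTransition c u) = u :=
    d.baseTransition_baseTransition c (d.fst_mem_baseOverlap c (hgW u hu))
  have hz : prolong s (fun v => G (a, v)) u ∈ jetsOver s (d.overlap c) :=
    prolong_mem_jetsOver hgW s hu
  have hpr := d.prolong_transform c hU hg hgW s hv
  rw [hback] at hpr
  have htp : targetPoint s (prolong s (fun v => G (a, v)) u) = (u, G (a, u)) :=
    targetPoint_prolong s _ u
  simp only [sourcePairing]
  have hlin : ∀ w : Fin m → ℝ, ∀ σ, (fderiv ℝ (d.transition c) (u, G (a, u)) (0, w)).2 σ =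
      ∑ ν, w ν * (fderiv ℝ (d.transition c) (u, G (a, u)) (0, Pi.single ν 1)).2 σ := by
    intro w σ
    have : ((0, w) : (Fin n → ℝ) × (Fin m → ℝ)) = ∑ ν, w ν • (0, Pi.single ν 1) := by
      refine Prod.ext (by simp [Prod.fst_sum]) ?_
      funext κ
      simp [Prod.snd_sum, Finset.sum_apply, Pi.single_apply]
    rw [this, map_sum, Prod.snd_sum, Finset.sum_apply]
    refine Finset.sum_congr rfl fun ν _ => ?_
    rw [map_smul]
    rfl
  have hd : ∀ σ, dirDeriv (p, (0 : Fin n → ℝ)) (fun q => d.transformFamily c G q σ)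
      (a, d.baseTransition c u) = ∑ ν, dirDeriv (p, (0 : Fin n → ℝ)) (fun q => G q ν) (a, u) *
        (fderiv ℝ (d.transition c) (u, G (a, u)) (0, Pi.single ν 1)).2 σ := by
    intro σ
    rw [d.dirDeriv_transformFamily c hB hU hG hGW p ha hv σ, hback, hlin]
  have hT : ∀ ν, T.comp d ν (prolong s (fun v => G (a, v)) u) = (∑ σ,
      (fderiv ℝ (d.transition c) (u, G (a, u)) (0, Pi.single ν 1)).2 σ *
        T.comp c σ (prolong s (fun v => d.transformFamily c G (a, v)) (d.baseTransition c u))) *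
      (fderiv ℝ (d.baseTransition c) u).det := by
    intro ν
    rw [T.comp_transform d c ν hz, htp]
    change _ = (∑ σ, _ * T.comp c σ (prolong s (d.transform c fun v => G (a, v))
      (d.baseTransition c u))) * _
    rw [hpr]
    rfl
  simp only [hd, hT, Finset.sum_mul, Finset.mul_sum]
  rw [Finset.sum_comm]
  refine Finset.sum_congr rfl fun σ _ => Finset.sum_congr rfl fun ν _ => ?_
  ring

end AdaptedChart

end Families

/-! ### Locally variational equations satisfy the Helmholtz conditions -/

section VariationalImpliesHelmholtz

open MeasureTheory

variable {n m s : ℕ}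
  {X : Type*} [TopologicalSpace X] [ChartedSpace (Fin n → ℝ) X]
  {Y : Type*} [TopologicalSpace Y] [ChartedSpace ((Fin n → ℝ) × (Fin m → ℝ)) Y]
  {π : Y → X}

theorem LocalLagrangeForm.contDiffOn_density {c : AdaptedChart n m π} {r : ℕ}
    (l : LocalLagrangeForm c r) : ContDiffOn ℝ ∞ l.density (jetsOver r c.chart.target) := by
  rw [← c.jetDomain_eq]
  exact ((ContinuousAlternatingMap.apply ℝ (JSpace n m r) ℝ (ι := Fin n)
    (fun i : Fin n => vecX r i)).contDiff).comp_contDiffOn l.smooth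

theorem DifferentialEquation.EqEulerLagrange.comp_prolong {T : DifferentialEquation n m π s}
    {c : AdaptedChart n m π} {r : ℕ} {l : LocalLagrangeForm c r} (hl : T.EqEulerLagrange l)
    {V : Set (Fin n → ℝ)} (hV : IsOpen V) {g : (Fin n → ℝ) → Fin m → ℝ}
    (hg : ContDiffOn ℝ ∞ g V) (hgW : ∀ v ∈ V, (v, g v) ∈ c.chart.target) {v : Fin n → ℝ}
    (hv : v ∈ V) (σ : Fin m) :
    T.comp c σ (prolong s g v) = ∑ β : MIdx n r, (-1 : ℝ) ^ (∑ i, β.1 i) *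
      mderiv β.1 (fun v => partialY σ β.1 l.density (prolong r g v)) v := by
  -- The smallest jet order on which both sides of T = E(λ) are defined.
  have hs : s ≤ max s (2 * r) := le_max_left _ _
  have hr : 2 * r ≤ max s (2 * r) := le_max_right _ _
  have h := (T.eqEulerLagrange_iff l).1 hl _ hs hr (prolong (max s (2 * r)) g v)
    (by rw [c.jetDomain_eq]; exact prolong_mem_jetsOver hgW _ hv) σ
  rwa [jproj_prolong hs, eulerLagrange_prolong c.chart.open_target hV hg hgW hr
    l.contDiffOn_density σ hv] at h

variable {P : Type*} [NormedAddCommGroup P] [NormedSpace ℝ P]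

/-- The Lagrangian lives in the chart c, while the symmetry is wanted in d. The family is carried to
c, and the resulting integrals are brought back by a change of variables. This produces |det|,
whereas the pairing transforms with det; the constant ratio `ε` can be divided out. -/
theorem integral_dirDeriv_sourcePairing_symm_of_eqEulerLagrange
    {T : DifferentialEquation n m π s} (d c : AdaptedChart n m π) {r : ℕ}
    {l : LocalLagrangeForm c r} (hl : T.EqEulerLagrange l)
    {B : Set P} (hB : IsOpen B) (h0 : (0 : P) ∈ B)
    {U K : Set (Fin n → ℝ)} (hU : IsOpen U) (hK : IsCompact K) (hKU : K ⊆ U)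
    {G : P × (Fin n → ℝ) → Fin m → ℝ} (hG : ContDiffOn ℝ ∞ G (B ×ˢ U))
    (hGW : ∀ q ∈ B ×ˢ U, (q.2, G q) ∈ d.overlap c)
    (hconst : ∀ a ∈ B, ∀ v ∈ U, v ∉ K → G (a, v) = G (0, v))
    {ε : ℝ} (hε : ε ≠ 0) (hdet : ∀ u ∈ U, |(fderiv ℝ (d.baseTransition c) u).det| =
      ε * (fderiv ℝ (d.baseTransition c) u).det) (p q : P) :
    ∫ u in U, (dirDeriv (q, (0 : Fin n → ℝ)) (sourcePairing (T.comp d) G p) (0, u) -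
      dirDeriv (p, (0 : Fin n → ℝ)) (sourcePairing (T.comp d) G q) (0, u)) = 0 := by
  set V := d.transformDomain c U with hVdef
  have hV : IsOpen V := d.isOpen_transformDomain c hU
  have hgW : ∀ v ∈ U, (v, G (0, v)) ∈ d.overlap c := fun v hv => hGW (0, v) ⟨h0, hv⟩
  have hUo : U ⊆ d.baseOverlap c := fun v hv => d.fst_mem_baseOverlap c (hgW v hv)
  have hback : ∀ u ∈ U, c.baseTransition d (d.baseTransition c u) = u := fun u hu =>
    d.baseTransition_baseTransition c (hUo hu)
  have himage : d.baseTransition c '' U = V := by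
    ext v
    constructor
    · rintro ⟨u, hu, rfl⟩
      exact d.baseTransition_mem_transformDomain c hgW hu
    · intro hv
      exact ⟨c.baseTransition d v, hv.2, c.baseTransition_baseTransition d hv.1⟩
  set K' := d.baseTransition c '' K with hK'def
  have hτ := (d.contDiffOn_baseTransition c).mono hUo
  have hK' : IsCompact K' := hK.image_of_continuousOn (hτ.continuousOn.mono hKU)
  have hK'V : K' ⊆ V := by rw [← himage]; exact Set.image_mono hKU
  set Γ := d.transformFamily c G with hΓdef
  have hΓ : ContDiffOn ℝ ∞ Γ (B ×ˢ V) := d.contDiffOn_transformFamily c hG hGW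
  have hΓW : ∀ q ∈ B ×ˢ V, (q.2, Γ q) ∈ c.chart.target := fun q hq =>
    ((c.mem_overlap d).1 (d.transformFamily_mem c hGW hq)).1
  have hΓconst : ∀ a ∈ B, ∀ v ∈ V, v ∉ K' → Γ (a, v) = Γ (0, v) := by
    intro a ha v hv hvK
    have : c.baseTransition d v ∉ K := fun h =>
      hvK ⟨_, h, c.baseTransition_baseTransition d hv.1⟩
    simp only [hΓdef, AdaptedChart.transformFamily, AdaptedChart.transform]
    rw [hconst a ha _ hv.2 this]
  have key := integral_dirDeriv_sourcePairing_symm hB h0 hV hK' hK'V c.chart.open_target hΓ hΓW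
    hΓconst (T.contDiffOn_comp c) l.contDiffOn_density
    (fun g hg hgW v hv σ => hl.comp_prolong hV hg hgW hv σ) p q
  have hτd : ∀ u ∈ U, HasFDerivWithinAt (d.baseTransition c)
      (fderiv ℝ (d.baseTransition c) u) U u := fun u hu =>
    ((hτ.contDiffAt (hU.mem_nhds hu)).differentiableAt (by simp)).hasFDerivAt.hasFDerivWithinAt
  have hinj : Set.InjOn (d.baseTransition c) U := fun u hu u' hu' h => by
    rw [← hback u hu, h, hback u' hu']
  rw [← himage, integral_image_eq_integral_abs_det_fderiv_smul volume hU.measurableSet hτd hinj]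
    at key
  have hSG : ∀ p, ContDiffOn ℝ ∞ (sourcePairing (T.comp d) G p) (B ×ˢ U) := fun p =>
    contDiffOn_sourcePairing (hB.prod hU) hG
      (fun q hq => ((d.mem_overlap c).1 (hGW q hq)).1) (T.contDiffOn_comp d) p
  have hSΓ : ∀ p, ContDiffOn ℝ ∞ (sourcePairing (T.comp c) Γ p) (B ×ˢ V) := fun p =>
    contDiffOn_sourcePairing (hB.prod hV) hΓ hΓW (T.contDiffOn_comp c) p
  have hpt : ∀ p q : P, ∀ u ∈ U,
      dirDeriv (q, (0 : Fin n → ℝ)) (sourcePairing (T.comp d) G p) (0, u) =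
        (fderiv ℝ (d.baseTransition c) u).det *
          dirDeriv (q, (0 : Fin n → ℝ)) (sourcePairing (T.comp c) Γ p)
            (0, d.baseTransition c u) := by
    intro p q u hu
    have hv : d.baseTransition c u ∈ V := himage ▸ Set.mem_image_of_mem _ hu
    have hsl : ContDiffOn ℝ ∞ (fun b => sourcePairing (T.comp c) Γ p (b, d.baseTransition c u)) B :=
      (hSΓ p).comp (contDiff_id.prodMk contDiff_const).contDiffOn fun b hb => ⟨hb, hv⟩
    have e : Set.EqOn (fun b => sourcePairing (T.comp d) G p (b, u))
        (fun b => (fderiv ℝ (d.baseTransition c) u).det *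
          sourcePairing (T.comp c) Γ p (b, d.baseTransition c u)) B := fun b hb => by
      simp only
      rw [d.sourcePairing_transform c T hB hU hG hGW p hb hu, mul_comm]
    rw [dirDeriv_left ((hSG p).differentiableAt_of_isOpen (hB.prod hU) ⟨h0, hu⟩),
      dirDeriv_congr hB e q h0, dirDeriv_const_mul hB hsl _ q h0]
    have hmv : ((0 : P), d.baseTransition c u) ∈ B ×ˢ V := ⟨h0, hv⟩
    rw [dirDeriv_left (u := d.baseTransition c u) (a := 0)
      ((hSΓ p).differentiableAt_of_isOpen (hB.prod hV) hmv) q]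
  have h2 : ∫ u in U, ε * (dirDeriv (q, (0 : Fin n → ℝ)) (sourcePairing (T.comp d) G p) (0, u) -
      dirDeriv (p, (0 : Fin n → ℝ)) (sourcePairing (T.comp d) G q) (0, u)) = 0 := by
    rw [← key]
    refine setIntegral_congr_fun hU.measurableSet fun u hu => ?_
    rw [hpt p q u hu, hpt q p u hu, hdet u hu, smul_eq_mul]
    ring
  rw [integral_const_mul] at h2
  exact (mul_eq_zero.1 h2).resolve_left hε

/-- The two-parameter family `g + a₁ φ + a₂ ψ`. -/
def linearFamily (g : (Fin n → ℝ) → Fin m → ℝ) (φ ψ : Fin m → (Fin n → ℝ) → ℝ)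
    (q : (ℝ × ℝ) × (Fin n → ℝ)) : Fin m → ℝ :=
  fun σ => g q.2 σ + (q.1.1 * φ σ q.2 + q.1.2 * ψ σ q.2)

section LinearFamily

variable {U K : Set (Fin n → ℝ)} {g : (Fin n → ℝ) → Fin m → ℝ} {φ ψ : Fin m → (Fin n → ℝ) → ℝ}

theorem linearFamily_zero : (fun v => linearFamily g φ ψ ((0 : ℝ × ℝ), v)) = g := by
  funext v σ; simp [linearFamily]

theorem contDiffOn_linearFamily (hg : ContDiffOn ℝ ∞ g U) (hφ : ∀ σ, IsTest U K (φ σ))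
    (hψ : ∀ σ, IsTest U K (ψ σ)) (B : Set (ℝ × ℝ)) :
    ContDiffOn ℝ ∞ (linearFamily g φ ψ) (B ×ˢ U) := by
  have h2 : ContDiffOn ℝ ∞ (fun q : (ℝ × ℝ) × (Fin n → ℝ) => q.2) (B ×ˢ U) := contDiffOn_snd
  have hm : Set.MapsTo (fun q : (ℝ × ℝ) × (Fin n → ℝ) => q.2) (B ×ˢ U) U := fun q hq => hq.2
  rw [contDiffOn_pi]
  intro σ
  refine ((contDiffOn_pi.1 hg σ).comp h2 hm).add (ContDiffOn.add
    (ContDiffOn.mul (by fun_prop) ((hφ σ).contDiffOn.comp h2 hm))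
    (ContDiffOn.mul (by fun_prop) ((hψ σ).contDiffOn.comp h2 hm)))

theorem dirDeriv_linearFamily (hg : ContDiffOn ℝ ∞ g U) (hφ : ∀ σ, IsTest U K (φ σ))
    (hψ : ∀ σ, IsTest U K (ψ σ)) (hU : IsOpen U) (p a : ℝ × ℝ) {u : Fin n → ℝ} (hu : u ∈ U)
    (σ : Fin m) :
    dirDeriv (p, (0 : Fin n → ℝ)) (fun q => linearFamily g φ ψ q σ) (a, u) =
      p.1 * φ σ u + p.2 * ψ σ u := by
  have h := contDiffOn_pi.1 (contDiffOn_linearFamily hg hφ hψ Set.univ) σ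
  rw [dirDeriv_left (h.differentiableAt_of_isOpen (isOpen_univ.prod hU) ⟨Set.mem_univ a, hu⟩)]
  have h1 : HasFDerivAt (fun b : ℝ × ℝ => linearFamily g φ ψ (b, u) σ) _ a :=
    (((hasFDerivAt_fst (𝕜 := ℝ) (p := a)).mul_const (φ σ u)).add
      ((hasFDerivAt_snd (𝕜 := ℝ) (p := a)).mul_const (ψ σ u))).const_add (g u σ)
  rw [dirDeriv, h1.fderiv]
  simp [mul_comm]

/-- Over the compact K the tube lemma keeps the graphs in W for small parameters; off K the family
does not depend on the parameters. -/
theorem exists_parameters (hg : ContDiffOn ℝ ∞ g U) (hφ : ∀ σ, IsTest U K (φ σ))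
    (hψ : ∀ σ, IsTest U K (ψ σ)) (hU : IsOpen U) (hK : IsCompact K) (hKU : K ⊆ U)
    {W : Set ((Fin n → ℝ) × (Fin m → ℝ))} (hW : IsOpen W) (hgW : ∀ u ∈ U, (u, g u) ∈ W) :
    ∃ B : Set (ℝ × ℝ), IsOpen B ∧ (0 : ℝ × ℝ) ∈ B ∧
      ∀ q ∈ B ×ˢ U, (q.2, linearFamily g φ ψ q) ∈ W := by
  have hs := contDiffOn_linearFamily hg hφ hψ (Set.univ : Set (ℝ × ℝ))
  have hO : IsOpen ((Set.univ ×ˢ U) ∩ (fun q : (ℝ × ℝ) × (Fin n → ℝ) =>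
      (q.2, linearFamily g φ ψ q)) ⁻¹' W) :=
    (continuousOn_snd.prodMk hs.continuousOn).isOpen_inter_preimage (isOpen_univ.prod hU) hW
  obtain ⟨B, K', hB, -, h0, hK', hBK⟩ := generalized_tube_lemma
    (isCompact_singleton (x := (0 : ℝ × ℝ))) hK hO (by
      rintro ⟨a, u⟩ ⟨ha, hu⟩
      rw [Set.mem_singleton_iff] at ha
      subst ha
      refine ⟨⟨Set.mem_univ _, hKU hu⟩, ?_⟩
      have := congrFun (linearFamily_zero (g := g) (φ := φ) (ψ := ψ)) u
      simp only [Set.mem_preimage, this]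
      exact hgW u (hKU hu))
  refine ⟨B, hB, h0 rfl, ?_⟩
  rintro ⟨a, u⟩ ⟨ha, hu⟩
  by_cases huK : u ∈ K
  · exact (hBK ⟨ha, hK' huK⟩).2
  · have : linearFamily g φ ψ (a, u) = g u := by
      funext σ
      simp [linearFamily, (hφ σ).eq_zero u hu huK, (hψ σ).eq_zero u hu huK]
    simp only [this]
    exact hgW u hu

/-- The family is affine in the parameters, so its variations are constant in them. Only S is
differentiated, which yields its linearization at g. -/
theorem dirDeriv_sourcePairing_linearFamily (hg : ContDiffOn ℝ ∞ g U)
    (hφ : ∀ σ, IsTest U K (φ σ)) (hψ : ∀ σ, IsTest U K (ψ σ)) (hU : IsOpen U)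
    {W : Set ((Fin n → ℝ) × (Fin m → ℝ))} (hW : IsOpen W) {B : Set (ℝ × ℝ)} (hB : IsOpen B)
    (h0 : (0 : ℝ × ℝ) ∈ B) (hGW : ∀ q ∈ B ×ˢ U, (q.2, linearFamily g φ ψ q) ∈ W)
    {S : Fin m → JSpace n m s → ℝ} (hS : ∀ σ, ContDiffOn ℝ ∞ (S σ) (jetsOver s W)) (p q : ℝ × ℝ)
    {u : Fin n → ℝ} (hu : u ∈ U) :
    dirDeriv (q, (0 : Fin n → ℝ)) (sourcePairing S (linearFamily g φ ψ) p) (0, u) =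
      ∑ σ, ∑ ν, ∑ α : MIdx n s, (p.1 * φ σ u + p.2 * ψ σ u) * (linCoeff s S g σ ν α.1 u *
        mderiv α.1 (fun v => q.1 * φ ν v + q.2 * ψ ν v) u) := by
  have hΩ := hB.prod hU
  have hG := contDiffOn_linearFamily hg hφ hψ B
  have hcomp := fun σ => contDiffOn_comp_prolong_param hΩ hG hGW (hS σ)
  have hslice : ∀ σ, ContDiffOn ℝ ∞ (fun b => S σ (prolong s
      (fun v => linearFamily g φ ψ (b, v)) u)) B := fun σ =>
    (hcomp σ).comp (contDiff_id.prodMk contDiff_const).contDiffOn fun b hb => ⟨hb, hu⟩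
  rw [dirDeriv_left ((contDiffOn_sourcePairing hΩ hG hGW hS p).differentiableAt_of_isOpen hΩ
    ⟨h0, hu⟩)]
  have e : Set.EqOn (fun b => sourcePairing S (linearFamily g φ ψ) p (b, u))
      (fun b => ∑ σ, S σ (prolong s (fun v => linearFamily g φ ψ (b, v)) u) *
        (p.1 * φ σ u + p.2 * ψ σ u)) B := fun b _ => by
    refine Finset.sum_congr rfl fun σ _ => ?_
    rw [dirDeriv_linearFamily hg hφ hψ hU p b hu]
  rw [dirDeriv_congr hB e q h0]
  have h1 : HasFDerivAt (fun b => ∑ σ, S σ (prolong s (fun v => linearFamily g φ ψ (b, v)) u) *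
        (p.1 * φ σ u + p.2 * ψ σ u)) _ (0 : ℝ × ℝ) :=
    HasFDerivAt.fun_sum fun σ _ => (((hslice σ).differentiableAt_of_isOpen hB h0).hasFDerivAt.mul_const
      (p.1 * φ σ u + p.2 * ψ σ u))
  rw [dirDeriv, h1.fderiv, sum_apply]
  refine Finset.sum_congr rfl fun σ _ => ?_
  have h2 := dirDeriv_comp_prolong_param hΩ hG hW hGW (hS σ) q (a := 0) (u := u) ⟨h0, hu⟩
  rw [dirDeriv_left ((hcomp σ).differentiableAt_of_isOpen hΩ ⟨h0, hu⟩)] at h2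
  simp only [dirDeriv] at h2
  rw [smul_apply, smul_eq_mul, h2, Finset.mul_sum]
  refine Finset.sum_congr rfl fun ν _ => ?_
  rw [Finset.mul_sum]
  refine Finset.sum_congr rfl fun α _ => ?_
  rw [linearFamily_zero]
  congr 2
  exact mderiv_congr hU (fun v hv => dirDeriv_linearFamily hg hφ hψ hU q 0 hv ν) α.1 hu

end LinearFamily

/-- The linearization of a variational differential equation is symmetric, in every chart. -/
theorem operatorPairing_linCoeff_symm {T : DifferentialEquation n m π s} (d c : AdaptedChart n m π)
    {r : ℕ} {l : LocalLagrangeForm c r} (hl : T.EqEulerLagrange l)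
    {U K : Set (Fin n → ℝ)} (hU : IsOpen U) (hK : IsCompact K) (hKU : K ⊆ U)
    {g : (Fin n → ℝ) → Fin m → ℝ} (hg : ContDiffOn ℝ ∞ g U)
    (hgW : ∀ u ∈ U, (u, g u) ∈ d.overlap c)
    {ε : ℝ} (hε : ε ≠ 0) (hdet : ∀ u ∈ U, |(fderiv ℝ (d.baseTransition c) u).det| =
      ε * (fderiv ℝ (d.baseTransition c) u).det)
    {φ ψ : Fin m → (Fin n → ℝ) → ℝ} (hφ : ∀ σ, IsTest U K (φ σ)) (hψ : ∀ σ, IsTest U K (ψ σ)) :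
    operatorPairing U s (linCoeff s (T.comp d) g) φ ψ =
      operatorPairing U s (linCoeff s (T.comp d) g) ψ φ := by
  obtain ⟨B, hB, h0, hGW⟩ := exists_parameters hg hφ hψ hU hK hKU (d.isOpen_overlap c) hgW
  have hG := contDiffOn_linearFamily hg hφ hψ B
  have hGW' : ∀ q ∈ B ×ˢ U, (q.2, linearFamily g φ ψ q) ∈ d.chart.target := fun q hq =>
    ((d.mem_overlap c).1 (hGW q hq)).1
  have hgW' : ∀ u ∈ U, (u, g u) ∈ d.chart.target := fun u hu =>
    ((d.mem_overlap c).1 (hgW u hu)).1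
  -- The directions (1, 0) and (0, 1) have the variations φ and ψ, so the two mixed terms are the
  -- integrands of the pairings (φ, ψ) and (ψ, φ).
  have key := integral_dirDeriv_sourcePairing_symm_of_eqEulerLagrange d c hl hB h0 hU hK hKU hG
    hGW (fun a _ v hv hvK => by
      funext σ
      simp [linearFamily, (hφ σ).eq_zero v hv hvK, (hψ σ).eq_zero v hv hvK]) hε hdet
    ((1, 0) : ℝ × ℝ) ((0, 1) : ℝ × ℝ)
  have hP := contDiffOn_linCoeff d.chart.open_target hU hg hgW' (T.contDiffOn_comp d)
  have hi : ∀ {φ ψ : Fin m → (Fin n → ℝ) → ℝ}, (∀ σ, IsTest U K (φ σ)) →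
      (∀ σ, IsTest U K (ψ σ)) → IntegrableOn (fun u => ∑ σ, ∑ ν, ∑ α : MIdx n s,
        φ σ u * (linCoeff s (T.comp d) g σ ν α.1 u * mderiv α.1 (ψ ν) u)) U :=
    fun hφ hψ => (IsTest.sum fun σ _ => IsTest.sum fun ν _ => IsTest.sum fun α _ =>
      (hφ σ).mul_right ((hP σ ν α.1).mul
        (contDiffOn_mderiv hU (hψ ν).contDiffOn _))).integrableOn hU hK hKU
  rw [← sub_eq_zero, operatorPairing, operatorPairing, ← integral_sub (hi hφ hψ) (hi hψ hφ), ← key]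
  refine setIntegral_congr_fun hU.measurableSet fun u hu => ?_
  rw [dirDeriv_sourcePairing_linearFamily hg hφ hψ hU d.chart.open_target hB h0 hGW'
      (T.contDiffOn_comp d) _ _ hu,
    dirDeriv_sourcePairing_linearFamily hg hφ hψ hU d.chart.open_target hB h0 hGW'
      (T.contDiffOn_comp d) _ _ hu]
  simp

theorem AdaptedChart.det_baseTransition_ne_zero (d c : AdaptedChart n m π) {u : Fin n → ℝ}
    (hu : u ∈ d.baseOverlap c) : (fderiv ℝ (d.baseTransition c) u).det ≠ 0 := by
  have h1 := ((d.contDiffOn_baseTransition c).contDiffAt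
    ((d.isOpen_baseOverlap c).mem_nhds hu)).differentiableAt (by simp)
  have h2 := ((c.contDiffOn_baseTransition d).contDiffAt
    ((c.isOpen_baseOverlap d).mem_nhds (d.baseTransition_mem c hu))).differentiableAt (by simp)
  have h3 := h2.hasFDerivAt.comp u h1.hasFDerivAt
  have h4 : c.baseTransition d ∘ d.baseTransition c =ᶠ[𝓝 u] id := by
    filter_upwards [(d.isOpen_baseOverlap c).mem_nhds hu] with v hv
      using d.baseTransition_baseTransition c hv
  have h5 := (h3.congr_of_eventuallyEq h4.symm).unique (hasFDerivAt_id u)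
  intro h0
  have h6 : LinearMap.det ((fderiv ℝ (c.baseTransition d) (d.baseTransition c u) :
      (Fin n → ℝ) →ₗ[ℝ] (Fin n → ℝ)) ∘ₗ
        (fderiv ℝ (d.baseTransition c) u : (Fin n → ℝ) →ₗ[ℝ] (Fin n → ℝ))) = 1 := by
    have h7 := congrArg (fun A : (Fin n → ℝ) →L[ℝ] (Fin n → ℝ) =>
      (A : (Fin n → ℝ) →ₗ[ℝ] (Fin n → ℝ))) h5
    exact (congrArg LinearMap.det h7).trans LinearMap.det_id
  rw [LinearMap.det_comp] at h6
  rw [ContinuousLinearMap.det] at h0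
  rw [h0, mul_zero] at h6
  exact zero_ne_one h6

/-- The Helmholtz-Sonin expressions of a locally variational differential equation vanish. -/
theorem helmholtz_eq_zero_of_isLocallyVariational {T : DifferentialEquation n m π s}
    (hT : T.IsLocallyVariational) (d : AdaptedChart n m π) {t : ℕ} (ht : 2 * s ≤ t)
    {z : JSpace n m t} (hz : z ∈ d.jetDomain t) (σ ν : Fin m) (α : MIdx n s) :
    helmholtz s t (T.comp d) σ ν α z = 0 := by
  rw [d.jetDomain_eq] at hz
  obtain ⟨c, hyc, r, l, hl⟩ := hT (d.chart.symm (targetPoint t z))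
  have hov : targetPoint t z ∈ d.overlap c := (d.mem_overlap c).2 ⟨hz, hyc⟩
  have hgs : ContDiff ℝ ∞ (polyWithJet z) := contDiff_polyWithJet z
  have hz2 : targetPoint t z = (z.1, polyWithJet z z.1) := by
    conv_lhs => rw [← prolong_polyWithJet z]
    rw [targetPoint_prolong]
  set O : Set (Fin n → ℝ) := {u | (u, polyWithJet z u) ∈ d.overlap c} with hOdef
  have hO : IsOpen O := (d.isOpen_overlap c).preimage (continuous_id.prodMk hgs.continuous)
  have hzO : z.1 ∈ O := by
    change (z.1, polyWithJet z z.1) ∈ d.overlap c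
    rw [← hz2]; exact hov
  have hObase : O ⊆ d.baseOverlap c := fun u hu => d.fst_mem_baseOverlap c hu
  have hdetc : ContinuousOn (fun u => (fderiv ℝ (d.baseTransition c) u).det *
      (fderiv ℝ (d.baseTransition c) z.1).det) O :=
    (ContinuousLinearMap.continuous_det.comp_continuousOn
      (((d.contDiffOn_baseTransition c).mono hObase).continuousOn_fderiv_of_isOpen hO
        (by simp))).mul continuousOn_const
  set δ := (fderiv ℝ (d.baseTransition c) z.1).det with hδ
  have hδ0 : δ ≠ 0 := d.det_baseTransition_ne_zero c (hObase hzO)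
  -- On `U` the Jacobian keeps the sign it has at the base point of `z`, so |det| is the constant
  -- |δ| / δ = ±1 times det.
  set U := O ∩ (fun u => (fderiv ℝ (d.baseTransition c) u).det * δ) ⁻¹' Set.Ioi 0 with hUdef
  have hU : IsOpen U := hdetc.isOpen_inter_preimage hO isOpen_Ioi
  have hzU : z.1 ∈ U := ⟨hzO, by
    simp only [Set.mem_preimage, Set.mem_Ioi, ← hδ]
    exact mul_self_pos.2 hδ0⟩
  have hdet : ∀ u ∈ U, |(fderiv ℝ (d.baseTransition c) u).det| =
      (|δ| / δ) * (fderiv ℝ (d.baseTransition c) u).det := by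
    intro u hu
    have h : 0 < (fderiv ℝ (d.baseTransition c) u).det * δ := hu.2
    rcases pos_and_pos_or_neg_and_neg_of_mul_pos h with ⟨h1, h2⟩ | ⟨h1, h2⟩
    · rw [abs_of_pos h1, abs_of_pos h2, div_self hδ0, one_mul]
    · rw [abs_of_neg h1, abs_of_neg h2, neg_div, div_self hδ0, neg_one_mul]
  have hgW : ∀ u ∈ U, (u, polyWithJet z u) ∈ d.overlap c := fun u hu => hu.1
  have hgW' : ∀ u ∈ U, (u, polyWithJet z u) ∈ d.chart.target := fun u hu =>
    ((d.mem_overlap c).1 (hgW u hu)).1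
  have hP := contDiffOn_linCoeff d.chart.open_target hU hgs.contDiffOn hgW' (T.contDiffOn_comp d)
  rw [← prolong_polyWithJet z, helmholtz_prolong d.chart.open_target hU hgs.contDiffOn hgW' ht
    (T.contDiffOn_comp d) σ ν α hzU]
  -- The coefficients of P - P* vanish once its pairing does, and by Green's formula that pairing is
  -- the asymmetry of the linearization.
  refine coeff_eq_zero_of_operatorPairing hU (contDiffOn_skewCoeff hU hP)
    (fun K φ ψ hK hKU hφ hψ => ?_) hzU σ ν α
  rw [← operatorPairing_sub_swap hU hK hKU hP hφ hψ, sub_eq_zero]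
  exact operatorPairing_linCoeff_symm d c hl hU hK hKU hgs.contDiffOn hgW
    (div_ne_zero (abs_ne_zero.2 hδ0) hδ0) hdet hφ hψ

end VariationalImpliesHelmholtz

/-! ## Integrals that depend smoothly on a parameter -/

section ParametricIntegral

variable {V : Type*} [NormedAddCommGroup V] [NormedSpace ℝ V]
  {Ω : Set (ℝ × V)} {D : Set V} {G : ℝ × V → ℝ}

theorem continuousOn_slice {E V : Type*} [TopologicalSpace E] [TopologicalSpace V] {Ω : Set (ℝ × V)}
    {H : ℝ × V → E} (hH : ContinuousOn H Ω) {w : V} {I : Set ℝ} (h : ∀ τ ∈ I, (τ, w) ∈ Ω) :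
    ContinuousOn (fun τ => H (τ, w)) I :=
  hH.comp (continuous_id.prodMk continuous_const).continuousOn h

theorem intervalIntegrable_slice {E V : Type*} [NormedAddCommGroup E] [TopologicalSpace V]
    {Ω : Set (ℝ × V)} {H : ℝ × V → E} (hH : ContinuousOn H Ω) {w : V} (h : ∀ τ ∈ Set.Icc (0 : ℝ) 1, (τ, w) ∈ Ω) :
    IntervalIntegrable (fun τ => H (τ, w)) MeasureTheory.volume 0 1 :=
  ContinuousOn.intervalIntegrable (by
    rw [Set.uIcc_of_le zero_le_one]; exact continuousOn_slice hH h)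

variable [FiniteDimensional ℝ V]

/-- The tube lemma around [0, 1] × {z} gives a ball of points w for which the whole segment lies in
Ω. Closed balls are compact in finite dimension, so the derivative is bounded there and the integral
may be differentiated. -/
theorem hasFDerivAt_integral_param (hΩ : IsOpen Ω) (hG : ContDiffOn ℝ ∞ G Ω) {z : V}
    (hz : ∀ τ ∈ Set.Icc (0 : ℝ) 1, (τ, z) ∈ Ω) :
    HasFDerivAt (fun w => ∫ τ in (0 : ℝ)..1, G (τ, w))
      (∫ τ in (0 : ℝ)..1, (fderiv ℝ G (τ, z)).comp (ContinuousLinearMap.inr ℝ ℝ V)) z := by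
  have : ProperSpace V := FiniteDimensional.proper ℝ V
  obtain ⟨A, B, -, hB, hA, hzB, hAB⟩ := generalized_tube_lemma
    (isCompact_Icc (a := (0 : ℝ)) (b := 1)) (isCompact_singleton (x := z)) hΩ (by
      rintro ⟨τ, w⟩ ⟨hτ, hw⟩
      rw [Set.mem_singleton_iff] at hw
      subst hw
      exact hz τ hτ)
  obtain ⟨ε, hε, hεB⟩ := Metric.isOpen_iff.1 hB z (hzB rfl)
  have hball : Metric.closedBall z (ε / 2) ⊆ B :=
    (Metric.closedBall_subset_ball (by linarith)).trans hεB
  have hK : Set.Icc (0 : ℝ) 1 ×ˢ Metric.closedBall z (ε / 2) ⊆ Ω := fun q hq =>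
    hAB ⟨hA hq.1, hball hq.2⟩
  have hd : ContinuousOn (fun q => (fderiv ℝ G q).comp (ContinuousLinearMap.inr ℝ ℝ V)) Ω :=
    (hG.continuousOn_fderiv_of_isOpen hΩ (by simp)).clm_comp continuousOn_const
  obtain ⟨C, hC⟩ := (isCompact_Icc.prod (isCompact_closedBall z (ε / 2))).exists_bound_of_continuousOn
    (hd.mono hK)
  have hI : Set.uIoc (0 : ℝ) 1 ⊆ Set.Icc 0 1 := by
    rw [Set.uIoc_of_le zero_le_one]; exact Set.Ioc_subset_Icc_self
  have hmeas : MeasurableSet (Set.uIoc (0 : ℝ) 1) := measurableSet_uIoc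
  refine intervalIntegral.hasFDerivAt_integral_of_dominated_of_fderiv_le
    (F := fun w τ => G (τ, w))
    (F' := fun w τ => (fderiv ℝ G (τ, w)).comp (ContinuousLinearMap.inr ℝ ℝ V))
    (bound := fun _ => C) (Metric.closedBall_mem_nhds z (half_pos hε)) ?_
    (intervalIntegrable_slice hG.continuousOn hz) ?_ ?_ intervalIntegrable_const ?_
  · filter_upwards [Metric.closedBall_mem_nhds z (half_pos hε)] with w hw
    exact (continuousOn_slice (w := w) hG.continuousOn fun τ hτ =>
      hK (a := (τ, w)) ⟨hI hτ, hw⟩).aestronglyMeasurable hmeas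
  · exact (continuousOn_slice hd fun τ hτ => hz τ (hI hτ)).aestronglyMeasurable hmeas
  · exact Filter.Eventually.of_forall fun τ hτ w hw => hC (τ, w) ⟨hI hτ, hw⟩
  · refine Filter.Eventually.of_forall fun τ hτ w hw => ?_
    have h1 := (hG.differentiableAt_of_isOpen hΩ (hK (a := (τ, w)) ⟨hI hτ, hw⟩)).hasFDerivAt
    exact h1.comp w (hasFDerivAt_prodMk_right τ w)

theorem dirDeriv_integral_param (hΩ : IsOpen Ω) (hG : ContDiffOn ℝ ∞ G Ω) (v : V) {z : V}
    (hz : ∀ τ ∈ Set.Icc (0 : ℝ) 1, (τ, z) ∈ Ω) :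
    dirDeriv v (fun w => ∫ τ in (0 : ℝ)..1, G (τ, w)) z =
      ∫ τ in (0 : ℝ)..1, dirDeriv ((0 : ℝ), v) G (τ, z) := by
  have hd : ContinuousOn (fun q => (fderiv ℝ G q).comp (ContinuousLinearMap.inr ℝ ℝ V)) Ω :=
    (hG.continuousOn_fderiv_of_isOpen hΩ (by simp)).clm_comp continuousOn_const
  rw [dirDeriv, (hasFDerivAt_integral_param hΩ hG hz).fderiv,
    ContinuousLinearMap.intervalIntegral_apply (intervalIntegrable_slice hd hz)]
  rfl

/-- A directional derivative of the integral is an integral of the same kind, and in finite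
dimension directional derivatives control the differential; so the order of differentiability rises
by induction. -/
theorem contDiffOn_integral_param (hΩ : IsOpen Ω) (hG : ContDiffOn ℝ ∞ G Ω) (hD : IsOpen D)
    (hz : ∀ z ∈ D, ∀ τ ∈ Set.Icc (0 : ℝ) 1, (τ, z) ∈ Ω) :
    ContDiffOn ℝ ∞ (fun w => ∫ τ in (0 : ℝ)..1, G (τ, w)) D := by
  rw [contDiffOn_infty]
  intro k
  induction k generalizing G with
  | zero =>
    rw [Nat.cast_zero, contDiffOn_zero]
    exact fun w hw => (hasFDerivAt_integral_param hΩ hG (hz w hw)).continuousAt.continuousWithinAt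
  | succ k ih =>
    rw [Nat.cast_add, Nat.cast_one, contDiffOn_succ_iff_fderiv_of_isOpen hD]
    refine ⟨fun w hw => (hasFDerivAt_integral_param hΩ hG
      (hz w hw)).differentiableAt.differentiableWithinAt, fun h => absurd h (by simp), ?_⟩
    rw [contDiffOn_clm_apply]
    exact fun v => (ih (contDiffOn_dirDeriv hΩ hG ((0 : ℝ), v))).congr fun w hw =>
      dirDeriv_integral_param hΩ hG v (hz w hw)

theorem dirDerivs_integral_param {ι : Type*} (hΩ : IsOpen Ω) (hG : ContDiffOn ℝ ∞ G Ω)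
    (hD : IsOpen D) (hz : ∀ z ∈ D, ∀ τ ∈ Set.Icc (0 : ℝ) 1, (τ, z) ∈ Ω) (vs : ι → V) (l : List ι) :
    Set.EqOn (dirDerivs vs l fun w => ∫ τ in (0 : ℝ)..1, G (τ, w))
      (fun w => ∫ τ in (0 : ℝ)..1, dirDerivs vs l (fun w' => G (τ, w')) w) D := by
  have h : Set.EqOn (dirDerivs vs l fun w => ∫ τ in (0 : ℝ)..1, G (τ, w))
      (fun w => ∫ τ in (0 : ℝ)..1, dirDerivs (fun i => ((0 : ℝ), vs i)) l G (τ, w)) D := by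
    induction l with
    | nil => exact fun w _ => rfl
    | cons i l ih =>
      intro w hw
      exact (dirDeriv_congr hD ih (vs i) hw).trans
        (dirDeriv_integral_param hΩ (contDiffOn_dirDerivs hΩ hG _ l) (vs i) (hz w hw))
  intro w hw
  rw [h hw]
  refine intervalIntegral.integral_congr fun τ hτ => ?_
  rw [Set.uIcc_of_le zero_le_one] at hτ
  exact (dirDerivs_param hΩ hG vs l (hz w hw τ hτ)).symm

theorem mderiv_integral_param {n : ℕ} {Ω : Set (ℝ × (Fin n → ℝ))} {D : Set (Fin n → ℝ)}
    {G : ℝ × (Fin n → ℝ) → ℝ} (hΩ : IsOpen Ω) (hG : ContDiffOn ℝ ∞ G Ω) (hD : IsOpen D)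
    (hz : ∀ z ∈ D, ∀ τ ∈ Set.Icc (0 : ℝ) 1, (τ, z) ∈ Ω) (α : Fin n → ℕ) :
    Set.EqOn (mderiv α fun w => ∫ τ in (0 : ℝ)..1, G (τ, w))
      (fun w => ∫ τ in (0 : ℝ)..1, mderiv α (fun w' => G (τ, w')) w) D := by
  intro w hw
  simp only [mderiv_eq]
  exact dirDerivs_integral_param hΩ hG hD hz unitVec (idxList α) hw

end ParametricIntegral

/-! ## The Tonti-Vainberg Lagrangian -/

section Tonti

variable {n m s : ℕ}

/-- The scaling `χ_τ (x, y) = (x, τ y)` of the jet coordinates. -/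
def fibreScale (r : ℕ) (τ : ℝ) : JSpace n m r →L[ℝ] JSpace n m r :=
  (ContinuousLinearMap.fst ℝ (Fin n → ℝ) (Fin m → MIdx n r → ℝ)).prod
    (τ • ContinuousLinearMap.snd ℝ (Fin n → ℝ) (Fin m → MIdx n r → ℝ))

theorem fibreScale_apply (r : ℕ) (τ : ℝ) (z : JSpace n m r) :
    fibreScale r τ z = (z.1, τ • z.2) := rfl

theorem contDiff_fibreScale (r : ℕ) :
    ContDiff ℝ ∞ (fun q : ℝ × JSpace n m r => fibreScale r q.1 q.2) := by
  simp only [fibreScale_apply]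
  fun_prop

theorem fibreScale_vecY (r : ℕ) (τ : ℝ) (σ : Fin m) (α : Fin n → ℕ) :
    fibreScale (n := n) r τ (vecY r σ α) = τ • vecY r σ α := by
  rw [fibreScale_apply]
  refine Prod.ext ?_ rfl
  simp

theorem fibreScale_mem {W : Set ((Fin n → ℝ) × (Fin m → ℝ))}
    (hstar : ∀ p ∈ W, ∀ τ ∈ Set.Icc (0 : ℝ) 1, (p.1, τ • p.2) ∈ W) {r : ℕ} {z : JSpace n m r}
    (hz : z ∈ jetsOver r W) {τ : ℝ} (hτ : τ ∈ Set.Icc (0 : ℝ) 1) :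
    fibreScale r τ z ∈ jetsOver r W := by
  have h : targetPoint r (fibreScale r τ z) = ((targetPoint r z).1, τ • (targetPoint r z).2) := by
    refine Prod.ext rfl ?_
    funext σ
    change coordY r σ 0 (fibreScale r τ z) = τ • coordY r σ 0 z
    rw [coordY_apply σ (by simp), coordY_apply σ (by simp)]
    rfl
  change targetPoint r (fibreScale r τ z) ∈ W
  rw [h]
  exact hstar _ hz τ hτ

theorem prolong_smul {U : Set (Fin n → ℝ)} (hU : IsOpen U) {g : (Fin n → ℝ) → Fin m → ℝ}
    (hg : ContDiffOn ℝ ∞ g U) (τ : ℝ) {u : Fin n → ℝ} (hu : u ∈ U) :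
    prolong s (fun v => τ • g v) u = fibreScale s τ (prolong s g u) := by
  refine Prod.ext rfl ?_
  funext σ α
  exact mderiv_const_mul hU (contDiffOn_pi.1 hg σ) τ α.1 hu

variable {W : Set ((Fin n → ℝ) × (Fin m → ℝ))} {T : Fin m → JSpace n m s → ℝ}

/-- The pairs `(τ, z)` with `χ_τ z` over `W`. -/
def scaleDomain (s : ℕ) (W : Set ((Fin n → ℝ) × (Fin m → ℝ))) : Set (ℝ × JSpace n m s) :=
  (fun q => fibreScale s q.1 q.2) ⁻¹' jetsOver s W

theorem isOpen_scaleDomain (hW : IsOpen W) : IsOpen (scaleDomain s W) :=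
  (isOpen_jetsOver s hW).preimage (contDiff_fibreScale s).continuous

theorem contDiffOn_tontiIntegrand (hT : ∀ σ, ContDiffOn ℝ ∞ (T σ) (jetsOver s W)) :
    ContDiffOn ℝ ∞ (fun q : ℝ × JSpace n m s =>
      ∑ σ, coordY s σ 0 q.2 * T σ (fibreScale s q.1 q.2)) (scaleDomain s W) :=
  ContDiffOn.sum fun σ _ => ContDiffOn.mul
    ((coordY s σ 0).contDiff.comp contDiff_snd).contDiffOn
    ((hT σ).comp (contDiff_fibreScale s).contDiffOn fun _ hq => hq)

theorem contDiffOn_tonti (hW : IsOpen W)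
    (hstar : ∀ p ∈ W, ∀ τ ∈ Set.Icc (0 : ℝ) 1, (p.1, τ • p.2) ∈ W)
    (hT : ∀ σ, ContDiffOn ℝ ∞ (T σ) (jetsOver s W)) :
    ContDiffOn ℝ ∞ (tonti s T) (jetsOver s W) :=
  contDiffOn_integral_param (isOpen_scaleDomain hW) (contDiffOn_tontiIntegrand hT)
    (isOpen_jetsOver s hW) fun _ hz _ hτ => fibreScale_mem hstar hz hτ

/-- The product rule in y^ν T_ν(χ_τ z): the factor y^ν contributes only for β = 0 and ν = σ, and the
factor τ comes from the differential of χ_τ. -/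
theorem partialY_tonti (hW : IsOpen W)
    (hstar : ∀ p ∈ W, ∀ τ ∈ Set.Icc (0 : ℝ) 1, (p.1, τ • p.2) ∈ W)
    (hT : ∀ σ, ContDiffOn ℝ ∞ (T σ) (jetsOver s W)) (σ : Fin m) (β : MIdx n s)
    {z : JSpace n m s} (hz : z ∈ jetsOver s W) :
    partialY σ β.1 (tonti s T) z = ∫ τ in (0 : ℝ)..1,
      ((if β.1 = 0 then T σ (fibreScale s τ z) else 0) +
        τ * ∑ ν, partialY σ β.1 (T ν) (fibreScale s τ z) * coordY s ν 0 z) := by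
  refine (dirDeriv_integral_param (isOpen_scaleDomain hW) (contDiffOn_tontiIntegrand hT)
    (vecY s σ β.1) fun _ hτ => fibreScale_mem hstar hz hτ).trans ?_
  refine intervalIntegral.integral_congr fun τ hτ => ?_
  rw [Set.uIcc_of_le zero_le_one] at hτ
  have hmem : (τ, z) ∈ scaleDomain s W := fibreScale_mem hstar hz hτ
  -- With a list of one direction, this trades the derivative on the product for the derivative at
  -- fixed `τ`.
  have h1 := dirDerivs_param (isOpen_scaleDomain hW) (contDiffOn_tontiIntegrand hT)
    (fun _ : Unit => vecY s σ β.1) [()] hmem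
  refine h1.symm.trans ?_
  have h2 : HasFDerivAt (fun w => ∑ ν, coordY s ν 0 w * T ν (fibreScale s τ w)) _ z :=
    HasFDerivAt.fun_sum fun ν _ => (coordY s ν 0).hasFDerivAt.mul
      ((((hT ν).differentiableAt_of_isOpen (isOpen_jetsOver s hW)
        (fibreScale_mem hstar hz hτ)).hasFDerivAt).comp z (fibreScale s τ).hasFDerivAt)
  change fderiv ℝ (fun w => ∑ ν, coordY s ν 0 w * T ν (fibreScale s τ w)) z (vecY s σ β.1) = _
  rw [h2.fderiv, sum_apply]
  simp only [add_apply, smul_apply, ContinuousLinearMap.comp_apply, fibreScale_vecY, map_smul,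
    smul_eq_mul]
  classical
  simp only [coordY_vecY _ σ (show ∑ i, (0 : Fin n → ℕ) i ≤ s by simp) β.2]
  rw [Finset.sum_add_distrib, add_comm, Finset.mul_sum]
  congr 1
  · by_cases hβ : β.1 = 0
    · simp [hβ]
    · simp [hβ, Ne.symm hβ]
  · exact Finset.sum_congr rfl fun ν _ => by rw [partialY]; ring

/-- Along a section, `T_σ` is the Euler-Lagrange expression of the Tonti-Vainberg Lagrangian as soon
as the linearizations along the scaled sections are self-adjoint. -/
theorem eulerLagrange_tonti (hW : IsOpen W)
    (hstar : ∀ p ∈ W, ∀ τ ∈ Set.Icc (0 : ℝ) 1, (p.1, τ • p.2) ∈ W)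
    (hT : ∀ σ, ContDiffOn ℝ ∞ (T σ) (jetsOver s W)) {U : Set (Fin n → ℝ)} (hU : IsOpen U)
    {g : (Fin n → ℝ) → Fin m → ℝ} (hg : ContDiffOn ℝ ∞ g U) (hgW : ∀ u ∈ U, (u, g u) ∈ W)
    (hskew : ∀ τ ∈ Set.Icc (0 : ℝ) 1, ∀ u ∈ U, ∀ σ ν (α : MIdx n s),
      skewCoeff s (linCoeff s T fun v => τ • g v) σ ν α.1 u = 0)
    {t : ℕ} (ht : 2 * s ≤ t) (σ : Fin m) {u : Fin n → ℝ} (hu : u ∈ U) :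
    eulerLagrange s t σ (tonti s T) (prolong t g u) = T σ (prolong s g u) := by
  set Ω : Set (ℝ × (Fin n → ℝ)) := (Set.univ ×ˢ U) ∩ (fun q => (q.2, q.1 • g q.2)) ⁻¹' W with hΩdef
  have hg2 : ContDiffOn ℝ ∞ (fun q : ℝ × (Fin n → ℝ) => g q.2) (Set.univ ×ˢ U) :=
    hg.comp contDiffOn_snd fun q hq => hq.2
  have hΓ0 : ContDiffOn ℝ ∞ (fun q : ℝ × (Fin n → ℝ) => q.1 • g q.2) (Set.univ ×ˢ U) :=
    contDiffOn_fst.smul hg2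
  have hΩ : IsOpen Ω := (continuousOn_snd.prodMk hΓ0.continuousOn).isOpen_inter_preimage
    (isOpen_univ.prod hU) hW
  have hΓ : ContDiffOn ℝ ∞ (fun q : ℝ × (Fin n → ℝ) => q.1 • g q.2) Ω :=
    hΓ0.mono Set.inter_subset_left
  have hΓW : ∀ q ∈ Ω, (q.2, q.1 • g q.2) ∈ W := fun q hq => hq.2
  have hmem : ∀ v ∈ U, ∀ τ ∈ Set.Icc (0 : ℝ) 1, (τ, v) ∈ Ω := fun v hv τ hτ =>
    ⟨⟨Set.mem_univ _, hv⟩, hstar _ (hgW v hv) τ hτ⟩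
  -- The integrand of ∂L/∂y^σ_β along g, written through the scaled sections τg so that it is
  -- visibly smooth in (τ, v) jointly.
  set A : MIdx n s → ℝ × (Fin n → ℝ) → ℝ := fun β q =>
    (if β.1 = 0 then T σ (prolong s (fun v => q.1 • g v) q.2) else 0) +
      q.1 * ∑ ν, linCoeff s T (fun v => q.1 • g v) ν σ β.1 q.2 * g q.2 ν with hA
  have hAs : ∀ β, ContDiffOn ℝ ∞ (A β) Ω := by
    intro β
    refine ContDiffOn.add ?_ (contDiffOn_fst.mul (ContDiffOn.sum fun ν _ => ContDiffOn.mul ?_ ?_))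
    · split_ifs
      · exact contDiffOn_comp_prolong_param hΩ hΓ hΓW (hT σ)
      · exact contDiffOn_const
    · exact contDiffOn_comp_prolong_param hΩ hΓ hΓW
        (contDiffOn_dirDeriv (isOpen_jetsOver s hW) (hT ν) (vecY s σ β.1))
    · exact (contDiffOn_pi.1 hg2 ν).mono Set.inter_subset_left
  have h1 : ∀ β : MIdx n s, mderiv β.1 (fun v => partialY σ β.1 (tonti s T) (prolong s g v)) u =
      ∫ τ in (0 : ℝ)..1, mderiv β.1 (fun v => A β (τ, v)) u := by
    intro β
    refine Eq.trans ?_ (mderiv_integral_param hΩ (hAs β) hU hmem β.1 hu)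
    refine mderiv_congr hU (fun v hv => ?_) β.1 hu
    rw [partialY_tonti hW hstar hT σ β (prolong_mem_jetsOver hgW s hv)]
    simp only [hA, linCoeff, prolong_smul hU hg _ hv,
      coordY_prolong _ (show ∑ i, (0 : Fin n → ℕ) i ≤ s by simp), mderiv_zero]
  have hint : ∀ β : MIdx n s, IntervalIntegrable (fun τ => (-1 : ℝ) ^ (∑ i, β.1 i) *
      mderiv β.1 (fun v => A β (τ, v)) u) MeasureTheory.volume 0 1 := fun β =>
    (intervalIntegrable_slice (contDiffOn_mderiv_param hΩ (hAs β) β.1).continuousOn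
      (hmem u hu)).const_mul _
  rw [eulerLagrange_prolong hW hU hg hgW ht (contDiffOn_tonti hW hstar hT) σ hu]
  simp only [h1, ← intervalIntegral.integral_const_mul]
  rw [← intervalIntegral.integral_finsetSum fun β _ => hint β]
  have hsum : IntervalIntegrable (fun τ => ∑ β : MIdx n s, (-1 : ℝ) ^ (∑ i, β.1 i) *
      mderiv β.1 (fun v => A β (τ, v)) u) MeasureTheory.volume 0 1 := by
    have := IntervalIntegrable.sum Finset.univ fun β _ => hint β
    rwa [Finset.sum_fn] at this
  -- The heart of the argument: under the integral sign, the Euler-Lagrange expression is an exact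
  -- derivative in τ.
  have hderiv : ∀ τ ∈ Set.uIcc (0 : ℝ) 1,
      HasDerivAt (fun τ => τ * T σ (fibreScale s τ (prolong s g u)))
        (∑ β : MIdx n s, (-1 : ℝ) ^ (∑ i, β.1 i) * mderiv β.1 (fun v => A β (τ, v)) u) τ := by
    intro τ hτ
    rw [Set.uIcc_of_le zero_le_one] at hτ
    set γ : (Fin n → ℝ) → Fin m → ℝ := fun v => τ • g v with hγdef
    have hγ : ContDiffOn ℝ ∞ γ U := hg.const_smul τ
    have hγW : ∀ v ∈ U, (v, γ v) ∈ W := fun v hv => hstar _ (hgW v hv) τ hτ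
    have hlin := contDiffOn_linCoeff hW hU hγ hγW hT
    have hgσ := contDiffOn_pi.1 hg
    have hz : fibreScale s τ (prolong s g u) ∈ jetsOver s W :=
      fibreScale_mem hstar (prolong_mem_jetsOver hgW s hu) hτ
    have h2 : ∀ β : MIdx n s, mderiv β.1 (fun v => A β (τ, v)) u =
        mderiv β.1 (fun v => if β.1 = 0 then T σ (prolong s γ v) else 0) u +
          τ * ∑ ν, mderiv β.1 (fun v => linCoeff s T γ ν σ β.1 v * g v ν) u := by
      intro β
      have hp : ∀ ν ∈ Finset.univ, ContDiffOn ℝ ∞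
          (fun v => linCoeff s T γ ν σ β.1 v * g v ν) U := fun ν _ => (hlin ν σ β.1).mul (hgσ ν)
      have hc : ContDiffOn ℝ ∞ (fun v => if β.1 = 0 then T σ (prolong s γ v) else 0) U := by
        split_ifs
        · exact (hT σ).comp (contDiffOn_prolong hU hγ s) fun v hv => prolong_mem_jetsOver hγW s hv
        · exact contDiffOn_const
      refine (mderiv_fun_add hU hc (contDiffOn_const.mul (ContDiffOn.sum hp)) β.1 hu).trans ?_
      exact congrArg _ ((mderiv_const_mul hU (ContDiffOn.sum hp) τ β.1 hu).trans
        (congrArg (τ * ·) (mderiv_fun_sum hU Finset.univ hp β.1 hu)))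
    have h3 : ∑ β : MIdx n s, (-1 : ℝ) ^ (∑ i, β.1 i) * mderiv β.1 (fun v => A β (τ, v)) u =
        T σ (prolong s γ u) + τ * ∑ ν, ∑ α : MIdx n s,
          linCoeff s T γ σ ν α.1 u * mderiv α.1 (fun v => g v ν) u := by
      simp only [h2, mul_add, Finset.sum_add_distrib]
      congr 1
      · rw [Finset.sum_eq_single (⟨0, by simp⟩ : MIdx n s)]
        · simp [mderiv_zero]
        · intro β _ hβ
          have hβ0 : β.1 ≠ 0 := fun h => hβ (Subtype.ext h)
          simp [hβ0, mderiv_fun_zero]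
        · simp
      · rw [Finset.mul_sum]
        simp only [Finset.mul_sum]
        rw [Finset.sum_comm]
        refine Finset.sum_congr rfl fun ν _ => ?_
        rw [← Finset.mul_sum]
        -- The alternating sum of ∂^β(P^β_{νσ} g^ν) is the formal adjoint applied to g;
        -- self-adjointness at τg turns it into the linearization itself, which is the derivative of
        -- T_σ along τ ↦ χ_τ.
        have h4 := sum_mderiv_mul hU s (P := linCoeff s T γ ν σ) (fun α => hlin ν σ α) (hgσ ν) hu
        simp only [mul_left_comm _ τ]
        rw [← Finset.mul_sum, h4]
        congr 1
        refine Finset.sum_congr rfl fun α _ => ?_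
        have h5 := hskew τ hτ u hu σ ν α
        rw [skewCoeff, sub_eq_zero] at h5
        rw [h5]
    have h6 : HasDerivAt (fun τ => fibreScale s τ (prolong s g u))
        ((0, (prolong s g u).2) : JSpace n m s) τ := by
      simp only [fibreScale_apply]
      have := (hasDerivAt_id τ).smul_const (prolong s g u).2
      rw [one_smul] at this
      exact (hasDerivAt_const τ _).prodMk this
    have h7 := ((hT σ).differentiableAt_of_isOpen (isOpen_jetsOver s hW) hz).hasFDerivAt.comp_hasDerivAt
      τ h6
    have h8 := (hasDerivAt_id τ).mul h7
    rw [h3]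
    refine HasDerivAt.congr_deriv (f := fun τ => τ * T σ (fibreScale s τ (prolong s g u))) h8 ?_
    rw [one_mul, jspace_vertical_eq_sum, map_sum]
    simp only [Function.comp_apply, id, map_sum, map_smul, smul_eq_mul]
    rw [prolong_smul hU hg τ hu]
    congr 2
    refine Finset.sum_congr rfl fun ν _ => Finset.sum_congr rfl fun α _ => ?_
    rw [linCoeff, prolong_smul hU hg τ hu, mul_comm]
    rfl
  -- The primitive vanishes at τ = 0 because of the factor τ, and χ_1 is the identity.
  rw [intervalIntegral.integral_eq_sub_of_hasDerivAt hderiv hsum]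
  simp only [zero_mul, one_mul, sub_zero, fibreScale_apply, one_smul, Prod.mk.eta]

end Tonti

/-! ### Equations with vanishing Helmholtz-Sonin form are variational -/

section TontiLagrangeForm

variable {n m s : ℕ}
  {X : Type*} [TopologicalSpace X] [ChartedSpace (Fin n → ℝ) X]
  {Y : Type*} [TopologicalSpace Y] [ChartedSpace ((Fin n → ℝ) × (Fin m → ℝ)) Y]
  {π : Y → X} {T : DifferentialEquation n m π s}

/-- Evaluated on coordinate vectors, the form leaves the coefficients of order zero undetermined up
to symmetry. Skew-adjointness of P - P*, used along sections over an open set, removes this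
ambiguity. -/
theorem DifferentialEquation.HelmholtzSoninVanishes.skewCoeff_eq_zero {t : ℕ} (ht : 2 * s ≤ t)
    (h : T.HelmholtzSoninVanishes t) (c : AdaptedChart n m π) {U : Set (Fin n → ℝ)} (hU : IsOpen U)
    {g : (Fin n → ℝ) → Fin m → ℝ} (hg : ContDiffOn ℝ ∞ g U) (hgW : ∀ u ∈ U, (u, g u) ∈ c.chart.target)
    {u : Fin n → ℝ} (hu : u ∈ U) (σ ν : Fin m) (α : MIdx n s) :
    skewCoeff s (linCoeff s (T.comp c) g) σ ν α.1 u = 0 := by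
  have key : ∀ v ∈ U, ∀ σ ν (α : MIdx n s),
      skewCoeff s (linCoeff s (T.comp c) g) σ ν α.1 v =
        if α.1 = 0 then skewCoeff s (linCoeff s (T.comp c) g) ν σ α.1 v else 0 := by
    intro v hv σ ν α
    have h1 := h c (prolong t g v) (by
      rw [c.jetDomain_eq]; exact prolong_mem_jetsOver hgW t hv)
    have h2 := helmholtzForm_apply (by omega : s ≤ t) (T.comp c) (prolong t g v) σ ν α
    rw [DifferentialEquation.helmholtzSoninForm] at h1
    rw [h1] at h2
    simp only [← helmholtz_prolong c.chart.open_target hU hg hgW ht (T.contDiffOn_comp c) _ _ α hv]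
    exact sub_eq_zero.1 h2.symm
  refine skewCoeff_eq_zero_of_symm hU
    (contDiffOn_linCoeff c.chart.open_target hU hg hgW (T.contDiffOn_comp c)) ?_ ?_ hu σ ν α
  · intro v hv σ ν α hα
    rw [key v hv σ ν α, if_neg hα]
  · intro v hv σ ν
    have := key v hv σ ν ⟨0, by simp⟩
    rwa [if_pos rfl] at this

/-- The horizontal form `L dx^1 ∧ ... ∧ dx^n`. -/
def LocalLagrangeForm.ofDensity (c : AdaptedChart n m π) {r : ℕ} (L : JSpace n m r → ℝ)
    (hL : ContDiffOn ℝ ∞ L (c.jetDomain r)) : LocalLagrangeForm c r where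
  form z := L z • wedge fun i : Fin n => coordX r i
  smooth := hL.smul contDiffOn_const
  horizontal z _ v a ha := by
    rw [ContinuousAlternatingMap.smul_apply, wedge_apply,
      Matrix.det_eq_zero_of_column_eq_zero a fun i => congrFun ha i, smul_zero]

theorem LocalLagrangeForm.density_ofDensity (c : AdaptedChart n m π) {r : ℕ}
    (L : JSpace n m r → ℝ) (hL : ContDiffOn ℝ ∞ L (c.jetDomain r)) :
    (LocalLagrangeForm.ofDensity c L hL).density = L := by
  funext z
  rw [LocalLagrangeForm.density, ofDensity, ContinuousAlternatingMap.smul_apply, wedge_apply]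
  exact (congrArg (L z * ·) (det_vecX (n := n) (m := m) (t := r))).trans (mul_one _)

/-- On a chart that is star-shaped along the fibres, a differential equation with vanishing
Helmholtz-Sonin form is the Euler-Lagrange form of its Tonti-Vainberg Lagrangian. -/
theorem exists_eqEulerLagrange_tonti {t : ℕ} (ht : 2 * s ≤ t) (h : T.HelmholtzSoninVanishes t)
    (c : AdaptedChart n m π) (hc : c.FibreStarShaped) :
    ∃ l : LocalLagrangeForm c s, (∀ z ∈ c.jetDomain s, l.density z = tonti s (T.comp c) z) ∧
      T.EqEulerLagrange l := by
  have hW := c.chart.open_target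
  have hL : ContDiffOn ℝ ∞ (tonti s (T.comp c)) (c.jetDomain s) := by
    rw [c.jetDomain_eq]
    exact contDiffOn_tonti hW hc (T.contDiffOn_comp c)
  refine ⟨LocalLagrangeForm.ofDensity c _ hL, fun z _ => by rw [LocalLagrangeForm.density_ofDensity],
    ?_⟩
  rw [T.eqEulerLagrange_iff, LocalLagrangeForm.density_ofDensity]
  intro t' hst ht' z hz σ
  rw [c.jetDomain_eq] at hz
  have hgs : ContDiff ℝ ∞ (polyWithJet z) := contDiff_polyWithJet z
  have hU : IsOpen {u | (u, polyWithJet z u) ∈ c.chart.target} :=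
    hW.preimage (continuous_id.prodMk hgs.continuous)
  have hzU : z.1 ∈ {u | (u, polyWithJet z u) ∈ c.chart.target} := by
    have h1 : targetPoint t' z ∈ c.chart.target := hz
    rwa [← prolong_polyWithJet z, targetPoint_prolong] at h1
  -- Star-shapedness keeps the scaled sections τg in the chart, so the Helmholtz conditions hold
  -- along each of them.
  have h2 := eulerLagrange_tonti hW hc (T.contDiffOn_comp c) hU hgs.contDiffOn (fun u hu => hu)
    (fun τ hτ u hu σ ν α => h.skewCoeff_eq_zero ht c hU (hgs.contDiffOn.const_smul τ)
      (fun v hv => hc _ hv τ hτ) hu σ ν α) ht' σ hzU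
  rw [prolong_polyWithJet] at h2
  rw [h2, ← jproj_prolong hst, prolong_polyWithJet]

end TontiLagrangeForm

/-! ## Existence of adapted charts that are star-shaped along the fibres -/

section StarShapedChart

variable {n m : ℕ}

/-- A translation moves the image of the point to the origin, and restriction to the preimage of a
small ball makes the image of the chart exactly that ball, which scaling by τ ∈ [0, 1] preserves. -/
theorem exists_ball_chart {F : Type*} [TopologicalSpace F] [ChartedSpace (Fin m → ℝ) F]
    [IsManifold 𝓘(ℝ, Fin m → ℝ) ∞ F] (f : F) :
    ∃ (k : OpenPartialHomeomorph F (Fin m → ℝ)) (ε : ℝ), f ∈ k.source ∧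
      k.target = Metric.ball 0 ε ∧ k ∈ IsManifold.maximalAtlas 𝓘(ℝ, Fin m → ℝ) ∞ F := by
  set κ := chartAt (Fin m → ℝ) f with hκ
  set κ' := κ.trans (Homeomorph.subRight (κ f)).toOpenPartialHomeomorph with hκ'
  have hf : f ∈ κ'.source := by simp [hκ', hκ]
  have h0 : κ' f = 0 := by simp [hκ']
  obtain ⟨ε, hε, hball⟩ := Metric.isOpen_iff.1 κ'.open_target 0 (h0 ▸ κ'.map_source hf)
  have hκ'm : κ' ∈ IsManifold.maximalAtlas 𝓘(ℝ, Fin m → ℝ) ∞ F := by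
    rw [IsManifold.mem_maximalAtlas_iff_contMDiffOn]
    have h1 : ContMDiffOn 𝓘(ℝ, Fin m → ℝ) 𝓘(ℝ, Fin m → ℝ) ∞ κ κ.source := contMDiffOn_chart
    have h2 : ContMDiffOn 𝓘(ℝ, Fin m → ℝ) 𝓘(ℝ, Fin m → ℝ) ∞ κ.symm κ.target :=
      contMDiffOn_chart_symm
    have h3 : ContMDiff 𝓘(ℝ, Fin m → ℝ) 𝓘(ℝ, Fin m → ℝ) ∞ (fun v => v - κ f) :=
      (contDiff_id.sub contDiff_const).contMDiff
    have h4 : ContMDiff 𝓘(ℝ, Fin m → ℝ) 𝓘(ℝ, Fin m → ℝ) ∞ (fun v => v + κ f) :=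
      (contDiff_id.add contDiff_const).contMDiff
    exact ⟨(h3.comp_contMDiffOn h1).mono fun x hx => hx.1,
      h2.comp h4.contMDiffOn fun v hv => hv.2⟩
  have hs : IsOpen (κ'.source ∩ κ' ⁻¹' Metric.ball 0 ε) :=
    κ'.isOpen_inter_preimage Metric.isOpen_ball
  refine ⟨κ'.restr (κ'.source ∩ κ' ⁻¹' Metric.ball 0 ε), ε, ?_, ?_,
    restr_mem_maximalAtlas (contDiffGroupoid ∞ 𝓘(ℝ, Fin m → ℝ)) hκ'm hs⟩
  · rw [κ'.restr_source' _ hs]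
    refine ⟨hf, hf, ?_⟩
    rw [Set.mem_preimage, h0]
    exact Metric.mem_ball_self hε
  · rw [OpenPartialHomeomorph.restr_target, hs.interior_eq]
    ext v
    constructor
    · rintro ⟨h1, -, h2⟩
      rwa [Set.mem_preimage, κ'.right_inv h1] at h2
    · intro hv
      refine ⟨hball hv, κ'.map_target (hball hv), ?_⟩
      rwa [Set.mem_preimage, κ'.right_inv (hball hv)]

/-- A local trivialization followed by the product of a base chart and a ball chart of the typical
fibre has an image whose fibres are balls centred at 0. The base chart is restricted to the base set
of the trivialization, so that its domain is the projection of the domain upstairs. -/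
theorem exists_fibreStarShaped
    {X : Type*} [TopologicalSpace X] [ChartedSpace (Fin n → ℝ) X]
    [IsManifold 𝓘(ℝ, Fin n → ℝ) ∞ X]
    {Y : Type*} [TopologicalSpace Y] [ChartedSpace ((Fin n → ℝ) × (Fin m → ℝ)) Y]
    [IsManifold 𝓘(ℝ, (Fin n → ℝ) × (Fin m → ℝ)) ∞ Y]
    {F : Type*} [TopologicalSpace F] [ChartedSpace (Fin m → ℝ) F]
    [IsManifold 𝓘(ℝ, Fin m → ℝ) ∞ F] {π : Y → X} (hπ : IsSmoothFibreBundle n m F π) (y : Y) :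
    ∃ c : AdaptedChart n m π, y ∈ c.chart.source ∧ c.FibreStarShaped := by
  obtain ⟨e, hye, hes, het⟩ := hπ (π y)
  obtain ⟨k, ε, hfk, hkt, hk⟩ := exists_ball_chart (m := m) (e y).2
  set φ := chartAt (Fin n → ℝ) (π y) with hφ
  have hys : y ∈ e.source := e.mem_source.2 hye
  set ψ := e.toOpenPartialHomeomorph.trans (φ.prod k) with hψ
  have hsource : ∀ y', y' ∈ ψ.source ↔ π y' ∈ e.baseSet ∧ π y' ∈ φ.source ∧ (e y').2 ∈ k.source := by
    intro y'
    rw [hψ, OpenPartialHomeomorph.trans_source]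
    constructor
    · rintro ⟨h1, h2, h3⟩
      refine ⟨e.mem_source.1 h1, ?_, h3⟩
      rwa [← e.coe_fst h1]
    · rintro ⟨h1, h2, h3⟩
      have h1' := e.mem_source.2 h1
      refine ⟨h1', ?_, h3⟩
      change (e y').1 ∈ φ.source
      rwa [e.coe_fst h1']
  have htarget : ∀ p, p ∈ ψ.target ↔ p.1 ∈ φ.target ∧ p.2 ∈ Metric.ball 0 ε ∧
      φ.symm p.1 ∈ e.baseSet := by
    intro p
    rw [hψ, OpenPartialHomeomorph.trans_target, ← hkt]
    constructor
    · rintro ⟨⟨h1, h2⟩, h3⟩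
      exact ⟨h1, h2, (e.mem_target.1 h3)⟩
    · rintro ⟨h1, h2, h3⟩
      exact ⟨⟨h1, h2⟩, e.mem_target.2 h3⟩
  have hφs : ContMDiffOn 𝓘(ℝ, Fin n → ℝ) 𝓘(ℝ, Fin n → ℝ) ∞ φ φ.source := contMDiffOn_chart
  have hφt : ContMDiffOn 𝓘(ℝ, Fin n → ℝ) 𝓘(ℝ, Fin n → ℝ) ∞ φ.symm φ.target :=
    contMDiffOn_chart_symm
  rw [IsManifold.mem_maximalAtlas_iff_contMDiffOn] at hk
  refine ⟨⟨ψ, φ.restr e.baseSet, ?_, ?_, ?_, ?_⟩, ?_, ?_⟩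
  · rw [IsManifold.mem_maximalAtlas_iff_contMDiffOn]
    constructor
    · have h1 : ContMDiffOn 𝓘(ℝ, (Fin n → ℝ) × (Fin m → ℝ)) (𝓘(ℝ, Fin n → ℝ).prod 𝓘(ℝ, Fin m → ℝ)) ∞
          e ψ.source := hes.mono fun y' hy' => e.mem_source.2 ((hsource y').1 hy').1
      have h2 := hφs.comp (contMDiff_fst.comp_contMDiffOn h1) fun y' hy' => by
        have := (hsource y').1 hy'
        change (e y').1 ∈ φ.source
        rw [e.coe_fst (e.mem_source.2 this.1)]
        exact this.2.1
      have h3 := hk.1.comp (contMDiff_snd.comp_contMDiffOn h1) fun y' hy' =>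
        ((hsource y').1 hy').2.2
      exact h2.prodMk_space h3
    · have h1 := hφt.comp (contDiff_fst (𝕜 := ℝ) (n := ∞) (E := Fin n → ℝ)
        (F := Fin m → ℝ)).contMDiff.contMDiffOn fun p (hp : p ∈ ψ.target) => ((htarget p).1 hp).1
      have h2 := hk.2.comp (contDiff_snd (𝕜 := ℝ) (n := ∞) (E := Fin n → ℝ)
        (F := Fin m → ℝ)).contMDiff.contMDiffOn fun p (hp : p ∈ ψ.target) => by
          have := ((htarget p).1 hp).2.1
          rwa [← hkt] at this
      exact het.comp (h1.prodMk h2) fun p hp => e.mem_target.2 ((htarget p).1 hp).2.2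
  · exact restr_mem_maximalAtlas (contDiffGroupoid ∞ 𝓘(ℝ, Fin n → ℝ))
      (IsManifold.chart_mem_maximalAtlas (π y)) e.open_baseSet
  · ext x
    rw [φ.restr_source' _ e.open_baseSet]
    constructor
    · rintro ⟨h1, h2⟩
      -- A point over `x` in the domain of the chart is the one with the fibre coordinate of `y`.
      have h3 : (x, (e y).2) ∈ e.target := e.mem_target.2 h2
      have h4 := e.map_target h3
      have h5 : e (e.toOpenPartialHomeomorph.symm (x, (e y).2)) = (x, (e y).2) := e.right_inv h3
      have h6 : π (e.toOpenPartialHomeomorph.symm (x, (e y).2)) = x := by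
        rw [← e.coe_fst h4]
        exact congrArg Prod.fst h5
      refine ⟨_, (hsource _).2 ⟨by rw [h6]; exact h2, by rw [h6]; exact h1, ?_⟩, h6⟩
      rw [h5]
      exact hfk
    · rintro ⟨y', hy', rfl⟩
      have := (hsource y').1 hy'
      exact ⟨this.2.1, this.1⟩
  · intro y' hy'
    exact congrArg φ (e.coe_fst (e.mem_source.2 ((hsource y').1 hy').1))
  · exact (hsource y).2 ⟨hye, mem_chart_source _ _, hfk⟩
  · intro p hp τ hτ
    obtain ⟨h1, h2, h3⟩ := (htarget p).1 hp
    refine (htarget _).2 ⟨h1, ?_, h3⟩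
    rw [mem_ball_zero_iff] at h2 ⊢
    calc ‖τ • p.2‖ = τ * ‖p.2‖ := by rw [norm_smul, Real.norm_of_nonneg hτ.1]
      _ ≤ 1 * ‖p.2‖ := mul_le_mul_of_nonneg_right hτ.2 (norm_nonneg _)
      _ < ε := by rwa [one_mul]

end StarShapedChart

end JetVar

end

/-! ### The Helmholtz criterion -/

theorem mainTheorem7 {n m : ℕ}
    {X : Type*} [TopologicalSpace X] [ChartedSpace (Fin n → ℝ) X]
    [IsManifold 𝓘(ℝ, Fin n → ℝ) ∞ X]
    {Y : Type*} [TopologicalSpace Y] [ChartedSpace ((Fin n → ℝ) × (Fin m → ℝ)) Y]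
    [IsManifold 𝓘(ℝ, (Fin n → ℝ) × (Fin m → ℝ)) ∞ Y]
    {F : Type*} [TopologicalSpace F] [ChartedSpace (Fin m → ℝ) F]
    [IsManifold 𝓘(ℝ, Fin m → ℝ) ∞ F]
    (π : Y → X) (hπ : JetVar.IsSmoothFibreBundle n m F π)
    (s : ℕ) (T : JetVar.DifferentialEquation n m π s) (t : ℕ) (ht : 2 * s < t) :
    (T.IsLocallyVariational ↔ T.HelmholtzSoninVanishes t) ∧
    (T.HelmholtzSoninVanishes t →
      ∀ c : JetVar.AdaptedChart n m π, c.FibreStarShaped →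
        ∃ l : JetVar.LocalLagrangeForm c s,
          (∀ z ∈ c.jetDomain s, l.density z = JetVar.tonti s (T.comp c) z) ∧
          T.EqEulerLagrange l) := by
  have hback : T.HelmholtzSoninVanishes t →
      ∀ c : JetVar.AdaptedChart n m π, c.FibreStarShaped →
        ∃ l : JetVar.LocalLagrangeForm c s,
          (∀ z ∈ c.jetDomain s, l.density z = JetVar.tonti s (T.comp c) z) ∧
          T.EqEulerLagrange l := fun h c hc => JetVar.exists_eqEulerLagrange_tonti ht.le h c hc
  refine ⟨⟨fun hT c z hz => ?_, fun h y => ?_⟩, hback⟩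
  · exact JetVar.helmholtzForm_eq_zero fun σ ν α =>
      JetVar.helmholtz_eq_zero_of_isLocallyVariational hT c ht.le hz σ ν α
  · obtain ⟨c, hy, hc⟩ := JetVar.exists_fibreStarShaped hπ y
    obtain ⟨l, -, hl⟩ := hback h c hc
    exact ⟨c, hy, s, l, hl⟩
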